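/- Let $\mathbb{K}$ be a field of characteristic zero and let $\mathbf{Ch}(\mathbb{K})$ be the symmetric monoidal category of (possibly unbounded) chain complexes of $\mathbb{K}$-vector spaces, with symmetric braiding given by the Koszul sign rule. Let $\mathbf{Alg}_{\mathsf{uLie}}$ be the category of unital Lie algebras in $\mathbf{Ch}(\mathbb{K})$, i.e. chain complexes $V$ with chain maps $[\cdot,\cdot]:V\otimes V\to V$ and $\eta:\mathbb{K}\to V$ such that $[\cdot,\cdot]$ satisfies the graded antisymmetry and Jacobi identities and $[v,\eta(1)]=0$ for all $v\in V$. Let $\mathbf{Alg}_{\mathsf{As}}$ be the category of associative and unital algebras in $\mathbf{Ch}(\mathbb{K})$, i.e. differential graded algebras. Let $\overline{\mathbf{C}}=(\mathbf{C},\perp)$ be an orthogonal category: a small category $\mathbf{C}$ with a relation $\perp$ on pairs of morphisms with common target that is symmetric and such that $f_1\perp f_2$ implies $g f_1 h_1\perp g f_2 h_2$ for all composable $g,h_1,h_2$. Let $\mathbf{LFT}(\overline{\mathbf{C}})$ (linear field theories) be the full subcategory of the category of functors $\mathfrak{B}:\mathbf{C}\to\mathbf{Alg}_{\mathsf{uLie}}$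 on those $\mathfrak{B}$ for which the map $[\mathfrak{B}(f_1)(-),\mathfrak{B}(f_2)(-)]:\mathfrak{B}(c_1)\otimes\mathfrak{B}(c_2)\to\mathfrak{B}(c)$ is zero for all $(f_1:c_1\to c)\perp(f_2:c_2\to c)$. Let $\mathbf{QFT}(\overline{\mathbf{C}})$ (quantum field theories) be the full subcategory of the category of functors $\mathfrak{A}:\mathbf{C}\to\mathbf{Alg}_{\mathsf{As}}$ defined by the same condition with the graded commutator in place of the Lie bracket. The linear quantization functor $\mathfrak{Q}_{\mathsf{lin}}:\mathbf{LFT}(\overline{\mathbf{C}})\to\mathbf{QFT}(\overline{\mathbf{C}})$ is the left adjoint of the functor $\mathfrak{U}_{\mathsf{lin}}:\mathbf{QFT}(\overline{\mathbf{C}})\to\mathbf{LFT}(\overline{\mathbf{C}})$ that replaces objectwise the product of an algebra by its graded commutator and keeps the unit. Explicitly, $\mathfrak{Q}_{\mathsf{lin}}(\mathfrak{B})(c)=\phi_!(\mathfrak{B}(c))$, where $\phi_!(V)$ is the unital universal enveloping algebra of $V$, i.e. the quotient of the tensor algebra $T^\otimes V$ by the two-sided differential graded ideal generated by $v_1\otimes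 v_2-(-1)^{|v_1||v_2|}v_2\otimes v_1-[v_1,v_2]$, for homogeneous $v_1,v_2\in V$, and $\eta(1)-1$. Let $W\subseteq\mathrm{Mor}\,\mathbf{C}$ be a subset. A linear or quantum field theory $\mathfrak{A}$ on $\overline{\mathbf{C}}$ is called homotopy $W$-constant if for every $(f:c\to c')\in W$ the chain map underlying $\mathfrak{A}(f):\mathfrak{A}(c)\to\mathfrak{A}(c')$ is a quasi-isomorphism. Then for every homotopy $W$-constant $\mathfrak{B}\in\mathbf{LFT}(\overline{\mathbf{C}})$, the quantum field theory $\mathfrak{Q}_{\mathsf{lin}}(\mathfrak{B})\in\mathbf{QFT}(\overline{\mathbf{C}})$ is homotopy $W$-constant. -/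

import Mathlib

open CategoryTheory

universe u v w

noncomputable section

namespace LinearQuantization

/-- The category `Ch(K)` of unbounded chain complexes of `K`-vector spaces (the differential lowers
the degree by one). -/
abbrev Ch (K : Type u) [Field K] := ChainComplex (ModuleCat.{u} K) ℤ

/-- A unital Lie algebra in the symmetric monoidal category `Ch(K)`, i.e. an algebra over the unital
Lie operad. A chain map out of a tensor product `V ⊗ V` is given by its bilinear components
`V_p × V_q → V_{p+q}` and is compatible with the differentials by the graded Leibniz rule; a chain
map out of the monoidal unit is a cycle of degree zero. Permuting inputs produces Koszul signs. -/
structure ULie (K : Type u) [Field K] where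
  /-- the underlying chain complex -/
  cpx : Ch K
  /-- the Lie bracket -/
  bracket : ∀ {p q n : ℤ}, p + q = n → (cpx.X p →ₗ[K] cpx.X q →ₗ[K] cpx.X n)
  /-- the unit -/
  unit : cpx.X 0
  d_bracket : ∀ {p q n p' q' n' : ℤ} (h : p + q = n) (h₁ : p' + q = n') (h₂ : p + q' = n')
    (_ : p' + 1 = p) (_ : q' + 1 = q) (x : cpx.X p) (y : cpx.X q),
    cpx.d n n' (bracket h x y) =
      bracket h₁ (cpx.d p p' x) y + p.negOnePow • bracket h₂ x (cpx.d q q' y)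
  d_unit : cpx.d 0 (-1) unit = 0
  bracket_antisymm : ∀ {p q n : ℤ} (h : p + q = n) (h' : q + p = n) (x : cpx.X p) (y : cpx.X q),
    bracket h x y = -((p * q).negOnePow • bracket h' y x)
  jacobi : ∀ {p q r pq qr rp n : ℤ} (hpq : p + q = pq) (hqr : q + r = qr) (hrp : r + p = rp)
    (h₁ : p + qr = n) (h₂ : q + rp = n) (h₃ : r + pq = n)
    (x : cpx.X p) (y : cpx.X q) (z : cpx.X r),
    bracket h₁ x (bracket hqr y z) +
      (p * (q + r)).negOnePow • bracket h₂ y (bracket hrp z x) +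
      (r * (p + q)).negOnePow • bracket h₃ z (bracket hpq x y) = 0
  bracket_unit : ∀ {p n : ℤ} (h : p + 0 = n) (x : cpx.X p), bracket h x unit = 0

/-- A morphism of unital Lie algebras in `Ch(K)`. -/
@[ext]
structure ULie.Hom {K : Type u} [Field K] (V W : ULie K) where
  /-- the underlying chain map -/
  hom : V.cpx ⟶ W.cpx
  map_bracket : ∀ {p q n : ℤ} (h : p + q = n) (x : V.cpx.X p) (y : V.cpx.X q),
    hom.f n (V.bracket h x y) = W.bracket h (hom.f p x) (hom.f q y)
  map_unit : hom.f 0 V.unit = W.unit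

instance ULie.category {K : Type u} [Field K] : Category (ULie K) where
  Hom V W := ULie.Hom V W
  id V := { hom := 𝟙 V.cpx, map_bracket := by intros; simp, map_unit := by simp }
  comp f g :=
    { hom := f.hom ≫ g.hom
      map_bracket := by intros; simp [f.map_bracket, g.map_bracket]
      map_unit := by simp [f.map_unit, g.map_unit] }

/-- The chain complex underlying a unital Lie algebra. -/
def ULie.forget (K : Type u) [Field K] : ULie K ⥤ Ch K where
  obj V := V.cpx
  map f := f.hom

/-- An associative and unital algebra in the symmetric monoidal category `Ch(K)`, i.e. a
differential graded algebra. -/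
structure DGA (K : Type u) [Field K] where
  /-- the underlying chain complex -/
  cpx : Ch K
  /-- the multiplication -/
  mul : ∀ {p q n : ℤ}, p + q = n → (cpx.X p →ₗ[K] cpx.X q →ₗ[K] cpx.X n)
  /-- the unit -/
  one : cpx.X 0
  d_mul : ∀ {p q n p' q' n' : ℤ} (h : p + q = n) (h₁ : p' + q = n') (h₂ : p + q' = n')
    (_ : p' + 1 = p) (_ : q' + 1 = q) (x : cpx.X p) (y : cpx.X q),
    cpx.d n n' (mul h x y) =
      mul h₁ (cpx.d p p' x) y + p.negOnePow • mul h₂ x (cpx.d q q' y)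
  d_one : cpx.d 0 (-1) one = 0
  one_mul : ∀ {p : ℤ} (h : 0 + p = p) (x : cpx.X p), mul h one x = x
  mul_one : ∀ {p : ℤ} (h : p + 0 = p) (x : cpx.X p), mul h x one = x
  mul_assoc : ∀ {p q r pq qr n : ℤ} (hpq : p + q = pq) (hqr : q + r = qr)
    (h₁ : pq + r = n) (h₂ : p + qr = n) (x : cpx.X p) (y : cpx.X q) (z : cpx.X r),
    mul h₁ (mul hpq x y) z = mul h₂ x (mul hqr y z)

/-- A morphism of differential graded algebras. -/
@[ext]
structure DGA.Hom {K : Type u} [Field K] (A B : DGA K) where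
  /-- the underlying chain map -/
  hom : A.cpx ⟶ B.cpx
  map_mul : ∀ {p q n : ℤ} (h : p + q = n) (x : A.cpx.X p) (y : A.cpx.X q),
    hom.f n (A.mul h x y) = B.mul h (hom.f p x) (hom.f q y)
  map_one : hom.f 0 A.one = B.one

instance DGA.category {K : Type u} [Field K] : Category (DGA K) where
  Hom A B := DGA.Hom A B
  id A := { hom := 𝟙 A.cpx, map_mul := by intros; simp, map_one := by simp }
  comp f g :=
    { hom := f.hom ≫ g.hom
      map_mul := by intros; simp [f.map_mul, g.map_mul]
      map_one := by simp [f.map_one, g.map_one] }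

/-- The chain complex underlying a differential graded algebra. -/
def DGA.forget (K : Type u) [Field K] : DGA K ⥤ Ch K where
  obj A := A.cpx
  map f := f.hom

/-- The graded commutator `μ - μᵒᵖ` of a differential graded algebra,
`(x, y) ↦ x y - (-1)^{pq} y x` on elements of degrees `p` and `q`. -/
def DGA.commutator {K : Type u} [Field K] (A : DGA K) {p q n : ℤ} (h : p + q = n) :
    A.cpx.X p →ₗ[K] A.cpx.X q →ₗ[K] A.cpx.X n :=
  A.mul h - (p * q).negOnePow • (A.mul (by omega : q + p = n)).flip

lemma DGA.commutator_apply {K : Type u} [Field K] (A : DGA K) {p q n : ℤ} (h : p + q = n)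
    (h' : q + p = n) (x : A.cpx.X p) (y : A.cpx.X q) :
    A.commutator h x y = A.mul h x y - (p * q).negOnePow • A.mul h' y x := rfl

lemma map_sign_smul {M N F : Type*} [AddCommGroup M] [AddCommGroup N] [FunLike F M N]
    [AddMonoidHomClass F M N] (f : F) (e : ℤˣ) (x : M) : f (e • x) = e • f x := by
  obtain rfl | rfl := Int.units_eq_one_or e <;> simp

lemma sign_smul_apply {R M N : Type*} [CommRing R] [AddCommGroup M] [AddCommGroup N] [Module R M]
    [Module R N] (e : ℤˣ) (f : M →ₗ[R] N) (x : M) : (e • f) x = e • f x := by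
  obtain rfl | rfl := Int.units_eq_one_or e <;> simp

lemma DGA.commutator_leibniz {K : Type u} [Field K] (A : DGA K) {p q n p' q' n' : ℤ}
    (h : p + q = n) (h₁ : p' + q = n') (h₂ : p + q' = n') (hp : p' + 1 = p) (hq : q' + 1 = q)
    (x : A.cpx.X p) (y : A.cpx.X q) :
    A.cpx.d n n' (A.commutator h x y) =
      A.commutator h₁ (A.cpx.d p p' x) y + p.negOnePow • A.commutator h₂ x (A.cpx.d q q' y) := by
  have e₁ : (p * q).negOnePow = (p' * q).negOnePow * q.negOnePow := by
    rw [← Int.negOnePow_add, ← hp]; congr 1; ring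
  have e₂ : (p * q).negOnePow = (p * q').negOnePow * p.negOnePow := by
    rw [← Int.negOnePow_add, ← hq]; congr 1; ring
  have e₃ : (p * q).negOnePow * q.negOnePow = (p' * q).negOnePow := by
    rw [e₁, _root_.mul_assoc, ← Int.negOnePow_add, Int.negOnePow_even _ ⟨q, rfl⟩, _root_.mul_one]
  rw [A.commutator_apply h (by omega), A.commutator_apply h₁ (by omega),
    A.commutator_apply h₂ (by omega), map_sub, map_sign_smul, A.d_mul h h₁ h₂ hp hq,
    A.d_mul _ (by omega : q' + p = n') (by omega : q + p' = n') hq hp, smul_add, smul_smul, e₃,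
    smul_sub, smul_smul, e₂, mul_comm p.negOnePow]
  abel

lemma DGA.commutator_jacobi {K : Type u} [Field K] (A : DGA K) {p q r pq qr rp n : ℤ}
    (hpq : p + q = pq) (hqr : q + r = qr) (hrp : r + p = rp)
    (h₁ : p + qr = n) (h₂ : q + rp = n) (h₃ : r + pq = n)
    (x : A.cpx.X p) (y : A.cpx.X q) (z : A.cpx.X r) :
    A.commutator h₁ x (A.commutator hqr y z) +
      (p * (q + r)).negOnePow • A.commutator h₂ y (A.commutator hrp z x) +
      (r * (p + q)).negOnePow • A.commutator h₃ z (A.commutator hpq x y) = 0 := by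
  have eqr : r + q = qr := by omega
  have erp : p + r = rp := by omega
  have epq : q + p = pq := by omega
  rw [A.commutator_apply h₁ (by omega), A.commutator_apply h₂ (by omega),
    A.commutator_apply h₃ (by omega), A.commutator_apply hqr eqr, A.commutator_apply hrp erp,
    A.commutator_apply hpq epq]
  simp only [map_sub, LinearMap.sub_apply, map_sign_smul, sign_smul_apply]
  rw [A.mul_assoc hqr hrp (by omega) h₂, A.mul_assoc eqr epq (by omega) h₃,
    A.mul_assoc hrp hpq (by omega) h₃, A.mul_assoc erp eqr (by omega) h₁,
    A.mul_assoc hpq hqr (by omega) h₁, A.mul_assoc epq erp (by omega) h₂]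
  subst hpq hqr hrp
  simp only [mul_add, Int.negOnePow_add, mul_comm r p, mul_comm q p, mul_comm r q]
  obtain a | a := Int.units_eq_one_or (p * q).negOnePow <;>
  obtain b | b := Int.units_eq_one_or (p * r).negOnePow <;>
  obtain c | c := Int.units_eq_one_or (q * r).negOnePow <;>
  simp only [a, b, c, one_smul, _root_.mul_one, Units.neg_smul, mul_neg, neg_neg] <;>
  abel

lemma DGA.commutator_antisymm {K : Type u} [Field K] (A : DGA K) {p q n : ℤ} (h : p + q = n)
    (h' : q + p = n) (x : A.cpx.X p) (y : A.cpx.X q) :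
    A.commutator h x y = -((p * q).negOnePow • A.commutator h' y x) := by
  rw [A.commutator_apply h h', A.commutator_apply h' h, mul_comm q p]
  obtain e | e := Int.units_eq_one_or (p * q).negOnePow <;>
  simp only [e, one_smul, Units.neg_smul] <;> abel

lemma DGA.commutator_one {K : Type u} [Field K] (A : DGA K) {p n : ℤ} (h : p + 0 = n)
    (x : A.cpx.X p) : A.commutator h x A.one = 0 := by
  obtain rfl : p = n := by omega
  rw [A.commutator_apply h (by omega), A.mul_one, A.one_mul]
  simp

lemma DGA.Hom.map_commutator {K : Type u} [Field K] {A B : DGA K} (f : A.Hom B) {p q n : ℤ}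
    (h : p + q = n) (x : A.cpx.X p) (y : A.cpx.X q) :
    f.hom.f n (A.commutator h x y) = B.commutator h (f.hom.f p x) (f.hom.f q y) := by
  rw [DGA.commutator_apply _ h (by omega), DGA.commutator_apply _ h (by omega), ← f.map_mul,
    ← f.map_mul, map_sub, map_sign_smul]

/-- The functor from differential graded algebras to unital Lie algebras
which takes the graded commutator as Lie bracket. -/
def phiStar (K : Type u) [Field K] : DGA K ⥤ ULie K where
  obj A :=
    { cpx := A.cpx
      bracket := A.commutator
      unit := A.one
      d_bracket := A.commutator_leibniz
      d_unit := A.d_one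
      bracket_antisymm := A.commutator_antisymm
      jacobi := A.commutator_jacobi
      bracket_unit := A.commutator_one }
  map f :=
    { hom := f.hom
      map_bracket := f.map_commutator
      map_unit := f.map_one }

/-- The inclusion of the degree `p` part of `V` into the tensor algebra of `V`. -/
def ULie.tgen {K : Type u} [Field K] (V : ULie K) (p : ℤ) :
    V.cpx.X p →ₗ[K] TensorAlgebra K (DirectSum ℤ fun n => V.cpx.X n) :=
  (TensorAlgebra.ι K).comp (DirectSum.lof K ℤ (fun n => V.cpx.X n) p)

/-- The relations of the unital universal enveloping algebra: the graded commutator of two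
generators is their Lie bracket, and the unit of `V` is the unit of the tensor algebra. -/
inductive ULie.Rel {K : Type u} [Field K] (V : ULie K) :
    TensorAlgebra K (DirectSum ℤ fun n => V.cpx.X n) →
      TensorAlgebra K (DirectSum ℤ fun n => V.cpx.X n) → Prop
  | bracket {p q n : ℤ} (h : p + q = n) (x : V.cpx.X p) (y : V.cpx.X q) :
      ULie.Rel V
        (V.tgen p x * V.tgen q y - (p * q).negOnePow • (V.tgen q y * V.tgen p x))
        (V.tgen n (V.bracket h x y))
  | unit : ULie.Rel V (V.tgen 0 V.unit) 1

/-- The algebra underlying the unital universal enveloping algebra: the quotient of the tensor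
algebra by the two-sided ideal generated by the relations. -/
def ULie.Env {K : Type u} [Field K] (V : ULie K) : Type u := RingQuot V.Rel

instance ULie.Env.ring {K : Type u} [Field K] (V : ULie K) : Ring V.Env :=
  inferInstanceAs (Ring (RingQuot V.Rel))

instance ULie.Env.algebra {K : Type u} [Field K] (V : ULie K) : Algebra K V.Env :=
  inferInstanceAs (Algebra K (RingQuot V.Rel))

/-- The projection of the tensor algebra onto the enveloping algebra. -/
def ULie.Env.mk {K : Type u} [Field K] (V : ULie K) :
    TensorAlgebra K (DirectSum ℤ fun n => V.cpx.X n) →ₐ[K] V.Env :=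
  RingQuot.mkAlgHom K V.Rel

/-- The canonical map from the degree `p` part of `V` to the enveloping algebra. -/
def ULie.gen {K : Type u} [Field K] (V : ULie K) (p : ℤ) : V.cpx.X p →ₗ[K] V.Env :=
  (ULie.Env.mk V).toLinearMap.comp (V.tgen p)

lemma ULie.gen_bracket {K : Type u} [Field K] (V : ULie K) {p q n : ℤ} (h : p + q = n)
    (x : V.cpx.X p) (y : V.cpx.X q) :
    V.gen n (V.bracket h x y) =
      V.gen p x * V.gen q y - (p * q).negOnePow • (V.gen q y * V.gen p x) := by
  have := RingQuot.mkAlgHom_rel K (ULie.Rel.bracket (V := V) h x y)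
  change ULie.Env.mk V _ = ULie.Env.mk V _ at this
  rw [map_sub, map_sign_smul, map_mul, map_mul] at this
  exact this.symm

lemma ULie.gen_unit {K : Type u} [Field K] (V : ULie K) : V.gen 0 V.unit = 1 := by
  have := RingQuot.mkAlgHom_rel K (ULie.Rel.unit (V := V))
  change ULie.Env.mk V _ = ULie.Env.mk V _ at this
  rw [map_one] at this
  exact this

lemma ULie.Env.induction {K : Type u} [Field K] (V : ULie K) {P : V.Env → Prop}
    (scalar : ∀ k : K, P (algebraMap K V.Env k)) (gen : ∀ p x, P (V.gen p x))
    (mul : ∀ a b, P a → P b → P (a * b)) (add : ∀ a b, P a → P b → P (a + b)) (a : V.Env) :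
    P a := by
  obtain ⟨t, rfl⟩ := RingQuot.mkAlgHom_surjective K V.Rel a
  change P (ULie.Env.mk V t)
  induction t using TensorAlgebra.induction with
  | algebraMap k => rw [AlgHom.commutes]; exact scalar k
  | ι m =>
    induction m using DirectSum.induction_on with
    | zero => simpa using scalar 0
    | of p x => exact gen p x
    | add x y hx hy => rw [map_add, map_add]; exact add _ _ hx hy
  | mul a b ha hb => rw [map_mul]; exact mul _ _ ha hb
  | add a b ha hb => rw [map_add]; exact add _ _ ha hb

/-- Algebra homomorphisms out of the enveloping algebra. -/
def ULie.Env.lift {K : Type u} [Field K] (V : ULie K) {B : Type v} [Ring B] [Algebra K B]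
    (g : ∀ p, V.cpx.X p →ₗ[K] B)
    (hb : ∀ {p q n : ℤ} (h : p + q = n) (x : V.cpx.X p) (y : V.cpx.X q),
      g n (V.bracket h x y) = g p x * g q y - (p * q).negOnePow • (g q y * g p x))
    (hu : g 0 V.unit = 1) : V.Env →ₐ[K] B :=
  RingQuot.liftAlgHom K ⟨TensorAlgebra.lift K (DirectSum.toModule K ℤ B g), by
    intro a b r
    cases r with
    | bracket h x y => 
      rw [map_sub, map_sign_smul, map_mul, map_mul]
      simp only [ULie.tgen, LinearMap.comp_apply, TensorAlgebra.lift_ι_apply,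
        DirectSum.toModule_lof, hb h]
    | unit =>
      simp only [ULie.tgen, LinearMap.comp_apply, TensorAlgebra.lift_ι_apply,
        DirectSum.toModule_lof, hu, map_one]⟩

lemma ULie.Env.lift_gen {K : Type u} [Field K] (V : ULie K) {B : Type v} [Ring B] [Algebra K B]
    (g : ∀ p, V.cpx.X p →ₗ[K] B)
    (hb : ∀ {p q n : ℤ} (h : p + q = n) (x : V.cpx.X p) (y : V.cpx.X q),
      g n (V.bracket h x y) = g p x * g q y - (p * q).negOnePow • (g q y * g p x))
    (hu : g 0 V.unit = 1) (p : ℤ) (x : V.cpx.X p) :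
    ULie.Env.lift V g hb hu (V.gen p x) = g p x := by
  change RingQuot.liftAlgHom K _ (RingQuot.mkAlgHom K V.Rel _) = _
  rw [RingQuot.liftAlgHom_mkAlgHom_apply]
  simp only [ULie.tgen, LinearMap.comp_apply, TensorAlgebra.lift_ι_apply, DirectSum.toModule_lof]

/-- `V.IsWord n a` says that `a` is a product `v₁ ⋯ vₖ` (`k ≥ 0`) of homogeneous elements of `V`
whose degrees add up to `n`. -/
inductive ULie.IsWord {K : Type u} [Field K] (V : ULie K) : ℤ → V.Env → Prop
  | one : ULie.IsWord V 0 1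
  | cons {p q n : ℤ} (h : p + q = n) (x : V.cpx.X p) {a : V.Env} (_ : ULie.IsWord V q a) :
      ULie.IsWord V n (V.gen p x * a)

/-- The degree `n` part of the enveloping algebra. -/
def ULie.grade {K : Type u} [Field K] (V : ULie K) (n : ℤ) : Submodule K V.Env :=
  Submodule.span K {a | V.IsWord n a}

lemma ULie.IsWord.mem_grade {K : Type u} [Field K] {V : ULie K} {n : ℤ} {a : V.Env}
    (h : V.IsWord n a) : a ∈ V.grade n := Submodule.subset_span h

lemma ULie.grade_le {K : Type u} [Field K] (V : ULie K) {n : ℤ} {S : Submodule K V.Env}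
    (h : ∀ a, V.IsWord n a → a ∈ S) : V.grade n ≤ S := Submodule.span_le.2 h

lemma ULie.one_mem_grade {K : Type u} [Field K] (V : ULie K) : (1 : V.Env) ∈ V.grade 0 :=
  ULie.IsWord.one.mem_grade

lemma ULie.gen_mem_grade {K : Type u} [Field K] (V : ULie K) (p : ℤ) (x : V.cpx.X p) :
    V.gen p x ∈ V.grade p := by
  simpa using (ULie.IsWord.cons (add_zero p) x ULie.IsWord.one).mem_grade

lemma ULie.gen_mul_mem_grade {K : Type u} [Field K] (V : ULie K) {p q n : ℤ} (h : p + q = n)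
    (x : V.cpx.X p) {b : V.Env} (hb : b ∈ V.grade q) : V.gen p x * b ∈ V.grade n :=
  V.grade_le (S := (V.grade n).comap (LinearMap.mulLeft K (V.gen p x)))
    (fun _ hw => (ULie.IsWord.cons h x hw).mem_grade) hb

lemma ULie.mul_mem_grade {K : Type u} [Field K] (V : ULie K) {p q n : ℤ} (h : p + q = n)
    {a b : V.Env} (ha : a ∈ V.grade p) (hb : b ∈ V.grade q) : a * b ∈ V.grade n := by
  refine V.grade_le (S := (V.grade n).comap (LinearMap.mulRight K b)) (fun w hw => ?_) ha
  change w * b ∈ V.grade n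
  clear ha a
  induction hw generalizing n with
  | one => rw [one_mul]; obtain rfl : q = n := by omega
           exact hb
  | cons h' x _ ih =>
    rw [mul_assoc]
    exact V.gen_mul_mem_grade (by rw [← h, ← h', add_assoc]) x (ih rfl)

/-- The endomorphism `(a, b) ↦ (d x * b + (-1)^p x * a, x * b)` of `Env × Env` for `x` of degree `p`,
an auxiliary construction for the extension of the differential to a graded derivation. -/
def ULie.diffAux {K : Type u} [Field K] (V : ULie K) (p : ℤ) :
    V.cpx.X p →ₗ[K] Module.End K (V.Env × V.Env) :=
  LinearMap.mk₂ K
    (fun x ab => (V.gen (p - 1) (V.cpx.d p (p - 1) x) * ab.2 + p.negOnePow • (V.gen p x * ab.1),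
      V.gen p x * ab.2))
    (fun x y ab => by
      ext <;> simp only [map_add, add_mul, smul_add, Prod.mk_add_mk]
      abel)
    (fun c x ab => by
      ext <;> simp [smul_comm c])
    (fun x ab ab' => by
      ext <;> simp only [mul_add, smul_add, Prod.mk_add_mk, Prod.fst_add, Prod.snd_add]
      abel)
    (fun c x ab => by
      ext <;> simp [smul_comm c])

lemma ULie.diffAux_apply {K : Type u} [Field K] (V : ULie K) {p p' : ℤ} (hp : p' + 1 = p)
    (x : V.cpx.X p) (a b : V.Env) :
    V.diffAux p x (a, b) = (V.gen p' (V.cpx.d p p' x) * b + p.negOnePow • (V.gen p x * a),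
      V.gen p x * b) := by
  obtain rfl : p' = p - 1 := by omega
  rfl

lemma sign_mul_left {A : Type*} [Ring A] (e : ℤˣ) (a b : A) : (e • a) * b = e • (a * b) := by
  obtain rfl | rfl := Int.units_eq_one_or e <;> simp

lemma sign_mul_right {A : Type*} [Ring A] (e : ℤˣ) (a b : A) : a * (e • b) = e • (a * b) := by
  obtain rfl | rfl := Int.units_eq_one_or e <;> simp

lemma ULie.diffAux_bracket {K : Type u} [Field K] (V : ULie K) {p q n : ℤ} (h : p + q = n)
    (x : V.cpx.X p) (y : V.cpx.X q) :
    V.diffAux n (V.bracket h x y) = V.diffAux p x * V.diffAux q y -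
      (p * q).negOnePow • (V.diffAux q y * V.diffAux p x) := by
  obtain ⟨p', hp⟩ : ∃ p', p' + 1 = p := ⟨p - 1, by omega⟩
  obtain ⟨q', hq⟩ : ∃ q', q' + 1 = q := ⟨q - 1, by omega⟩
  obtain ⟨n', hn⟩ : ∃ n', n' + 1 = n := ⟨n - 1, by omega⟩
  have e₁ : (p * q).negOnePow = (p' * q).negOnePow * q.negOnePow := by
    rw [← Int.negOnePow_add, ← hp]; congr 1; ring
  have e₂ : (p * q).negOnePow = (p * q').negOnePow * p.negOnePow := by
    rw [← Int.negOnePow_add, ← hq]; congr 1; ring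
  have e₃ : n.negOnePow = p.negOnePow * q.negOnePow := by rw [← h, Int.negOnePow_add]
  have e₄ : (p' * q).negOnePow = (p * q).negOnePow * q.negOnePow := by
    rw [e₁, mul_assoc, Int.units_mul_self, mul_one]
  have e₅ : (p * q').negOnePow = (p * q).negOnePow * p.negOnePow := by
    rw [e₂, mul_assoc, Int.units_mul_self, mul_one]
  refine LinearMap.ext fun ⟨a, b⟩ => ?_
  rw [LinearMap.sub_apply, sign_smul_apply, Module.End.mul_apply, Module.End.mul_apply,
    V.diffAux_apply hn, V.diffAux_apply hp, V.diffAux_apply hq, V.diffAux_apply hp,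
    V.diffAux_apply hq, V.d_bracket h (by omega : p' + q = n') (by omega) hp hq, map_add,
    map_sign_smul, V.gen_bracket, V.gen_bracket, V.gen_bracket]
  ext
  · simp only [Prod.fst_sub, Prod.smul_fst, e₃, e₄, e₅]
    obtain i | i := Int.units_eq_one_or p.negOnePow <;>
    obtain j | j := Int.units_eq_one_or q.negOnePow <;>
    obtain k | k := Int.units_eq_one_or (p * q).negOnePow <;>
    simp only [i, j, k, one_smul, mul_one, Units.neg_smul, mul_neg, neg_neg] <;>
    noncomm_ring
  · simp only [Prod.snd_sub, Prod.smul_snd, sub_mul, sign_mul_left, mul_assoc]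

/-- The algebra homomorphism `a ↦ ((c, b) ↦ (d a * b + ± a * c, a * b))`. -/
def ULie.diffHom {K : Type u} [Field K] (V : ULie K) : V.Env →ₐ[K] Module.End K (V.Env × V.Env) :=
  ULie.Env.lift V V.diffAux V.diffAux_bracket (by
    refine LinearMap.ext fun ⟨a, b⟩ => ?_
    rw [V.diffAux_apply (by omega : (-1 : ℤ) + 1 = 0), V.d_unit, V.gen_unit]
    simp)

/-- The differential of the enveloping algebra: the unique graded derivation which extends
the differential of `V`. -/
def ULie.diff {K : Type u} [Field K] (V : ULie K) : V.Env →ₗ[K] V.Env :=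
  (LinearMap.fst K V.Env V.Env).comp
    ((LinearMap.applyₗ ((0, 1) : V.Env × V.Env)).comp V.diffHom.toLinearMap)

lemma ULie.diffHom_snd {K : Type u} [Field K] (V : ULie K) (a c b : V.Env) :
    (V.diffHom a (c, b)).2 = a * b := by
  induction a using ULie.Env.induction generalizing c b with
  | scalar k => rw [AlgHom.commutes]; simp [Algebra.smul_def]
  | gen p x => 
    rw [ULie.diffHom, ULie.Env.lift_gen, V.diffAux_apply (by omega : (p - 1) + 1 = p)]
  | mul a a' h h' =>
    rw [map_mul, Module.End.mul_apply, mul_assoc, ← h' c b]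
    exact h _ _
  | add a a' h h' => rw [map_add, LinearMap.add_apply, Prod.snd_add, h, h', add_mul]

lemma ULie.diffHom_apply {K : Type u} [Field K] (V : ULie K) (a : V.Env) :
    V.diffHom a (0, 1) = (V.diff a, a) := by
  ext
  · rfl
  · rw [V.diffHom_snd, mul_one]

lemma ULie.diff_one {K : Type u} [Field K] (V : ULie K) : V.diff 1 = 0 := by
  change (V.diffHom 1 (0, 1)).1 = 0
  rw [map_one]; rfl

lemma ULie.diff_gen_mul {K : Type u} [Field K] (V : ULie K) {p p' : ℤ} (hp : p' + 1 = p)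
    (x : V.cpx.X p) (a : V.Env) :
    V.diff (V.gen p x * a) =
      V.gen p' (V.cpx.d p p' x) * a + p.negOnePow • (V.gen p x * V.diff a) := by
  change (V.diffHom (V.gen p x * a) (0, 1)).1 = _
  rw [map_mul, Module.End.mul_apply, V.diffHom_apply, ULie.diffHom, ULie.Env.lift_gen,
    V.diffAux_apply hp]

lemma ULie.diff_gen {K : Type u} [Field K] (V : ULie K) {p p' : ℤ} (hp : p' + 1 = p)
    (x : V.cpx.X p) : V.diff (V.gen p x) = V.gen p' (V.cpx.d p p' x) := by
  simpa [V.diff_one] using V.diff_gen_mul hp x 1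

lemma ULie.diff_mem_grade {K : Type u} [Field K] (V : ULie K) {n n' : ℤ} (hn : n' + 1 = n)
    {a : V.Env} (ha : a ∈ V.grade n) : V.diff a ∈ V.grade n' := by
  refine V.grade_le (S := (V.grade n').comap V.diff) (fun w hw => ?_) ha
  change V.diff w ∈ V.grade n'
  clear ha a
  induction hw generalizing n' with
  | one => rw [V.diff_one]; exact zero_mem _
  | @cons p q n h x a hw ih =>
    rw [V.diff_gen_mul (by omega : (p - 1) + 1 = p)]
    refine add_mem (V.gen_mul_mem_grade (by omega) _ hw.mem_grade) ?_
    have := V.gen_mul_mem_grade (by omega : p + (q - 1) = n') x (ih (n' := q - 1) (by omega))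
    obtain e | e := Int.units_eq_one_or p.negOnePow
    · simpa [e] using this
    · simpa [e] using this

lemma ULie.diff_mul {K : Type u} [Field K] (V : ULie K) {p : ℤ} {a : V.Env} (ha : a ∈ V.grade p)
    (b : V.Env) : V.diff (a * b) = V.diff a * b + p.negOnePow • (a * V.diff b) := by
  induction ha using Submodule.span_induction with
  | mem w hw =>
    induction hw with
    | one => simp [V.diff_one]
    | @cons p q n h x a hw ih =>
      have hp : (p - 1) + 1 = p := by omega
      rw [mul_assoc, V.diff_gen_mul hp, V.diff_gen_mul hp, ih, add_mul, mul_add, smul_add,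
        sign_mul_left, sign_mul_right, smul_smul, ← Int.negOnePow_add, h, mul_assoc, mul_assoc,
        mul_assoc, add_assoc]
  | zero => simp
  | add x y _ _ hx hy =>
    rw [add_mul, map_add, map_add, hx, hy, add_mul, add_mul, smul_add]
    abel
  | smul c x _ hx =>
    rw [smul_mul_assoc, map_smul, map_smul, hx, smul_mul_assoc, smul_mul_assoc, smul_add,
      smul_comm c]

lemma ULie.diff_diff {K : Type u} [Field K] (V : ULie K) {n : ℤ} {a : V.Env}
    (ha : a ∈ V.grade n) : V.diff (V.diff a) = 0 := by
  refine V.grade_le (S := LinearMap.ker (V.diff.comp V.diff)) (fun w hw => ?_) ha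
  change V.diff (V.diff w) = 0
  clear ha a
  induction hw with
  | one => rw [V.diff_one, map_zero]
  | @cons p q n h x a hw ih =>
    have hp : (p - 1) + 1 = p := by omega
    have hp' : (p - 2) + 1 = p - 1 := by omega
    have hd : V.cpx.d (p - 1) (p - 2) (V.cpx.d p (p - 1) x) = 0 := by
      rw [← ModuleCat.comp_apply, V.cpx.d_comp_d]; rfl
    have he : p.negOnePow = -(p - 1).negOnePow := by rw [← Int.negOnePow_succ, hp]
    rw [V.diff_gen_mul hp, map_add, map_sign_smul, V.diff_gen_mul hp', V.diff_gen_mul hp, ih, hd,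
      map_zero, mul_zero, smul_zero, zero_mul, he, Units.neg_smul]
    simp

/-- The chain complex underlying the unital universal enveloping algebra. -/
def ULie.envCpx {K : Type u} [Field K] (V : ULie K) : Ch K where
  X n := ModuleCat.of K (V.grade n)
  d i j := if h : j + 1 = i then
      ModuleCat.ofHom (V.diff.restrict (p := V.grade i) (q := V.grade j)
        (fun _ ha => V.diff_mem_grade h ha))
    else 0
  shape i j h := dif_neg h
  d_comp_d' i j k hij hjk := by
    rw [dif_pos (show j + 1 = i from hij), dif_pos (show k + 1 = j from hjk)]
    ext x
    exact V.diff_diff x.2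

/-- The inclusion of the degree `n` part of the enveloping algebra. -/
def ULie.val {K : Type u} [Field K] (V : ULie K) (n : ℤ) : V.envCpx.X n →ₗ[K] V.Env :=
  (V.grade n).subtype

lemma ULie.val_injective {K : Type u} [Field K] (V : ULie K) (n : ℤ) :
    Function.Injective (V.val n) := Subtype.val_injective

lemma ULie.val_mem {K : Type u} [Field K] (V : ULie K) {n : ℤ} (x : V.envCpx.X n) :
    V.val n x ∈ V.grade n := Subtype.prop (p := (· ∈ V.grade n)) x

/-- A homogeneous element of the enveloping algebra, as an element of the chain complex. -/
def ULie.toCpx {K : Type u} [Field K] (V : ULie K) {n : ℤ} (a : V.Env) (h : a ∈ V.grade n) :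
    V.envCpx.X n := (⟨a, h⟩ : V.grade n)

lemma ULie.val_toCpx {K : Type u} [Field K] (V : ULie K) {n : ℤ} (a : V.Env)
    (h : a ∈ V.grade n) : V.val n (V.toCpx a h) = a := rfl

lemma ULie.val_d {K : Type u} [Field K] (V : ULie K) {i j : ℤ} (h : j + 1 = i)
    (x : V.envCpx.X i) : V.val j (V.envCpx.d i j x) = V.diff (V.val i x) := by
  have : V.envCpx.d i j = ModuleCat.ofHom (V.diff.restrict (p := V.grade i) (q := V.grade j)
        (fun _ ha => V.diff_mem_grade h ha)) := dif_pos h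
  rw [this]; rfl

/-- The multiplication of homogeneous elements of the enveloping algebra. -/
def ULie.envMul {K : Type u} [Field K] (V : ULie K) {p q n : ℤ} (h : p + q = n) :
    V.envCpx.X p →ₗ[K] V.envCpx.X q →ₗ[K] V.envCpx.X n :=
  LinearMap.mk₂ K
    (fun x y => V.toCpx (V.val p x * V.val q y) (V.mul_mem_grade h (V.val_mem x) (V.val_mem y)))
    (fun _ _ _ => Subtype.ext (add_mul _ _ _)) (fun _ _ _ => Subtype.ext (smul_mul_assoc _ _ _))
    (fun _ _ _ => Subtype.ext (mul_add _ _ _)) (fun _ _ _ => Subtype.ext (mul_smul_comm _ _ _))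

lemma ULie.val_envMul {K : Type u} [Field K] (V : ULie K) {p q n : ℤ} (h : p + q = n)
    (x : V.envCpx.X p) (y : V.envCpx.X q) : V.val n (V.envMul h x y) = V.val p x * V.val q y := rfl

/-- The unital universal enveloping algebra of a unital Lie algebra in `Ch(K)`. -/
def ULie.env {K : Type u} [Field K] (V : ULie K) : DGA K where
  cpx := V.envCpx
  mul := V.envMul
  one := V.toCpx 1 V.one_mem_grade
  d_mul {p q n p' q' n'} h h₁ h₂ hp hq x y := V.val_injective n' (by
    rw [V.val_d (by omega), V.val_envMul, V.diff_mul (V.val_mem x), map_add, map_sign_smul,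
      V.val_envMul, V.val_envMul, V.val_d hp, V.val_d hq])
  d_one := V.val_injective _ (by
    rw [V.val_d (by omega), V.val_toCpx, V.diff_one, map_zero])
  one_mul _ x := V.val_injective _ (by rw [V.val_envMul, V.val_toCpx, _root_.one_mul])
  mul_one _ x := V.val_injective _ (by rw [V.val_envMul, V.val_toCpx, _root_.mul_one])
  mul_assoc _ _ _ _ x y z := V.val_injective _ (by
    rw [V.val_envMul, V.val_envMul, V.val_envMul, V.val_envMul, _root_.mul_assoc])

/-- The canonical chain map from a unital Lie algebra to its enveloping algebra. -/
def ULie.toEnvCpx {K : Type u} [Field K] (V : ULie K) : V.cpx ⟶ V.envCpx where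
  f n := ModuleCat.ofHom ((V.gen n).codRestrict (V.grade n) (V.gen_mem_grade n))
  comm' := by
    intro i j hij
    ext x
    refine V.val_injective j ?_
    exact (V.val_d hij _).trans (V.diff_gen hij x)

lemma ULie.val_toEnvCpx {K : Type u} [Field K] (V : ULie K) {n : ℤ} (x : V.cpx.X n) :
    V.val n (V.toEnvCpx.f n x) = V.gen n x := rfl

lemma ULie.env_induction {K : Type u} [Field K] (V : ULie K)
    {P : ∀ n, V.envCpx.X n → Prop} (one : P 0 (V.toCpx 1 V.one_mem_grade))
    (gen_mul : ∀ {p q n : ℤ} (h : p + q = n) (x : V.cpx.X p) (a : V.envCpx.X q),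
      P q a → P n (V.envMul h (V.toEnvCpx.f p x) a))
    (zero : ∀ n, P n 0)
    (add : ∀ n (a b : V.envCpx.X n), P n a → P n b → P n (a + b))
    (smul : ∀ n (c : K) (a : V.envCpx.X n), P n a → P n (c • a)) (n : ℤ) (a : V.envCpx.X n) :
    P n a := by
  have key : ∀ w (hw : w ∈ V.grade n), P n (V.toCpx w hw) := by
    clear a
    intro w₀ hw₀
    refine Submodule.span_induction (p := fun w hw => P n (V.toCpx w hw)) ?_ (zero n)
      (fun _ _ _ _ ha hb => add n _ _ ha hb) (fun c _ _ ha => smul n c _ ha) hw₀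
    clear hw₀ w₀
    intro w hw
    induction hw with
    | one => exact one
    | cons h x hw ih => exact gen_mul h x _ ih
  exact key (V.val n a) (V.val_mem a)

/-- The canonical morphism from a unital Lie algebra to its enveloping algebra. -/
def ULie.toEnv {K : Type u} [Field K] (V : ULie K) : V ⟶ (phiStar K).obj V.env where
  hom := V.toEnvCpx
  map_bracket := by
    intro p q n h x y
    have h' : q + p = n := by omega
    refine V.val_injective n ?_
    refine (V.gen_bracket h x y).trans ?_
    refine Eq.trans ?_ (congrArg (V.val n) (V.env.commutator_apply h h' (V.toEnvCpx.f p x)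
      (V.toEnvCpx.f q y)).symm)
    change _ = V.val n (V.envMul h _ _ - (p * q).negOnePow • V.envMul h' _ _)
    rw [map_sub, map_sign_smul, V.val_envMul, V.val_envMul]
    rfl
  map_unit := V.val_injective 0 V.gen_unit

/-- Left multiplication by an element of degree `p` of a differential graded algebra on the direct
sum of its homogeneous parts. -/
def DGA.leftMul {K : Type u} [Field K] (A : DGA K) (p : ℤ) :
    A.cpx.X p →ₗ[K] Module.End K (DirectSum ℤ fun n => A.cpx.X n) :=
  LinearMap.flip (DirectSum.toModule K ℤ _ fun q =>
    LinearMap.flip ((A.mul (rfl : p + q = p + q)).compr₂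
      (DirectSum.lof K ℤ (fun n => A.cpx.X n) (p + q))))

lemma DGA.leftMul_lof {K : Type u} [Field K] (A : DGA K) {p q n : ℤ} (h : p + q = n)
    (x : A.cpx.X p) (y : A.cpx.X q) :
    A.leftMul p x (DirectSum.lof K ℤ (fun n => A.cpx.X n) q y) =
      DirectSum.lof K ℤ (fun n => A.cpx.X n) n (A.mul h x y) := by
  subst h
  simp [DGA.leftMul]

lemma DGA.leftMul_mul {K : Type u} [Field K] (A : DGA K) {p q n : ℤ} (h : p + q = n)
    (x : A.cpx.X p) (y : A.cpx.X q) :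
    A.leftMul n (A.mul h x y) = A.leftMul p x * A.leftMul q y := by
  refine DirectSum.linearMap_ext K fun r => LinearMap.ext fun z => ?_
  simp only [LinearMap.comp_apply, Module.End.mul_apply]
  rw [A.leftMul_lof rfl, A.leftMul_lof rfl, A.leftMul_lof (by rw [← h, add_assoc] : p + (q + r) = n + r),
    A.mul_assoc h rfl]

lemma DGA.leftMul_one {K : Type u} [Field K] (A : DGA K) : A.leftMul 0 A.one = 1 := by
  refine DirectSum.linearMap_ext K fun r => LinearMap.ext fun z => ?_
  simp only [LinearMap.comp_apply, Module.End.one_apply]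
  rw [A.leftMul_lof (zero_add r), A.one_mul]

/-- The value at `1` of an endomorphism, projected to degree `n`. -/
def DGA.evalOne {K : Type u} [Field K] (A : DGA K) (n : ℤ) :
    Module.End K (DirectSum ℤ fun n => A.cpx.X n) →ₗ[K] A.cpx.X n :=
  (DirectSum.component K ℤ (fun n => A.cpx.X n) n).comp
    (LinearMap.applyₗ (DirectSum.lof K ℤ (fun n => A.cpx.X n) 0 A.one))

lemma DGA.evalOne_leftMul {K : Type u} [Field K] (A : DGA K) (n : ℤ) (x : A.cpx.X n) :
    A.evalOne n (A.leftMul n x) = x := by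
  simp only [DGA.evalOne, LinearMap.comp_apply, LinearMap.applyₗ_apply_apply]
  rw [A.leftMul_lof (add_zero n), A.mul_one, DirectSum.component.lof_self]

lemma DGA.leftMul_injective {K : Type u} [Field K] (A : DGA K) (n : ℤ) :
    Function.Injective (A.leftMul n) :=
  Function.LeftInverse.injective (A.evalOne_leftMul n)

lemma ULie.leftMul_bracket {K : Type u} [Field K] (V : ULie K) (A : DGA K) (f : V.cpx ⟶ A.cpx)
    (hb : ∀ {p q n : ℤ} (h : p + q = n) (x : V.cpx.X p) (y : V.cpx.X q),
      f.f n (V.bracket h x y) = A.commutator h (f.f p x) (f.f q y))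
    {p q n : ℤ} (h : p + q = n) (x : V.cpx.X p) (y : V.cpx.X q) :
    (A.leftMul n).comp (f.f n).hom (V.bracket h x y) =
      (A.leftMul p).comp (f.f p).hom x * (A.leftMul q).comp (f.f q).hom y -
        (p * q).negOnePow •
          ((A.leftMul q).comp (f.f q).hom y * (A.leftMul p).comp (f.f p).hom x) := by
  have h' : q + p = n := by omega
  simp only [LinearMap.comp_apply]
  rw [← A.leftMul_mul h, ← A.leftMul_mul h', ← map_sign_smul, ← map_sub, ← A.commutator_apply]
  exact congrArg _ (hb h x y)

/-- The algebra homomorphism induced by a morphism of unital Lie algebras `V ⟶ A`. -/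
def ULie.descHom {K : Type u} [Field K] (V : ULie K) (A : DGA K) (f : V.cpx ⟶ A.cpx)
    (hb : ∀ {p q n : ℤ} (h : p + q = n) (x : V.cpx.X p) (y : V.cpx.X q),
      f.f n (V.bracket h x y) = A.commutator h (f.f p x) (f.f q y))
    (hu : f.f 0 V.unit = A.one) :
    V.Env →ₐ[K] Module.End K (DirectSum ℤ fun n => A.cpx.X n) :=
  ULie.Env.lift V (fun p => (A.leftMul p).comp (f.f p).hom) (V.leftMul_bracket A f hb)
    ((congrArg (A.leftMul 0) hu).trans A.leftMul_one)

lemma ULie.descHom_gen {K : Type u} [Field K] (V : ULie K) (A : DGA K) (f : V.cpx ⟶ A.cpx)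
    (hb : ∀ {p q n : ℤ} (h : p + q = n) (x : V.cpx.X p) (y : V.cpx.X q),
      f.f n (V.bracket h x y) = A.commutator h (f.f p x) (f.f q y))
    (hu : f.f 0 V.unit = A.one) (p : ℤ) (x : V.cpx.X p) :
    V.descHom A f hb hu (V.gen p x) = A.leftMul p (f.f p x) :=
   ULie.Env.lift_gen V (fun p => (A.leftMul p).comp (f.f p).hom) (V.leftMul_bracket A f hb)
    _ p x

/-- The components of the morphism of differential graded algebras out of the enveloping algebra
induced by a morphism of unital Lie algebras `V ⟶ A`. -/
def ULie.descLin {K : Type u} [Field K] (V : ULie K) (A : DGA K) (f : V.cpx ⟶ A.cpx)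
    (hb : ∀ {p q n : ℤ} (h : p + q = n) (x : V.cpx.X p) (y : V.cpx.X q),
      f.f n (V.bracket h x y) = A.commutator h (f.f p x) (f.f q y))
    (hu : f.f 0 V.unit = A.one) (n : ℤ) : V.envCpx.X n →ₗ[K] A.cpx.X n :=
  (A.evalOne n).comp ((V.descHom A f hb hu).toLinearMap.comp (V.val n))

lemma ULie.leftMul_descLin {K : Type u} [Field K] (V : ULie K) (A : DGA K) (f : V.cpx ⟶ A.cpx)
    (hb : ∀ {p q n : ℤ} (h : p + q = n) (x : V.cpx.X p) (y : V.cpx.X q),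
      f.f n (V.bracket h x y) = A.commutator h (f.f p x) (f.f q y))
    (hu : f.f 0 V.unit = A.one) (n : ℤ) (a : V.envCpx.X n) :
    A.leftMul n (V.descLin A f hb hu n a) = V.descHom A f hb hu (V.val n a) := by
  suffices h : ∃ b, V.descHom A f hb hu (V.val n a) = A.leftMul n b by
    obtain ⟨b, h⟩ := h
    change A.leftMul n (A.evalOne n (V.descHom A f hb hu (V.val n a))) = _
    rw [h, A.evalOne_leftMul]
  induction n, a using V.env_induction with
  | one => exact ⟨A.one, by rw [V.val_toCpx, map_one, A.leftMul_one]⟩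
  | gen_mul h x a ih =>
    obtain ⟨b, ih⟩ := ih
    exact ⟨A.mul h (f.f _ x) b, by
      rw [V.val_envMul, map_mul, ih, A.leftMul_mul, V.val_toEnvCpx, V.descHom_gen]⟩
  | zero n => exact ⟨0, by simp⟩
  | add n a b ha hb =>
    obtain ⟨a', ha⟩ := ha
    obtain ⟨b', hb⟩ := hb
    exact ⟨a' + b', by simp only [map_add, ha, hb]⟩
  | smul n c a ha =>
    obtain ⟨a', ha⟩ := ha
    exact ⟨c • a', by simp only [map_smul, ha]⟩

lemma ULie.descLin_one {K : Type u} [Field K] (V : ULie K) (A : DGA K) (f : V.cpx ⟶ A.cpx)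
    (hb : ∀ {p q n : ℤ} (h : p + q = n) (x : V.cpx.X p) (y : V.cpx.X q),
      f.f n (V.bracket h x y) = A.commutator h (f.f p x) (f.f q y))
    (hu : f.f 0 V.unit = A.one) :
    V.descLin A f hb hu 0 (V.toCpx 1 V.one_mem_grade) = A.one :=
  A.leftMul_injective 0 (by
    rw [V.leftMul_descLin, V.val_toCpx, map_one, A.leftMul_one])

lemma ULie.descLin_mul {K : Type u} [Field K] (V : ULie K) (A : DGA K) (f : V.cpx ⟶ A.cpx)
    (hb : ∀ {p q n : ℤ} (h : p + q = n) (x : V.cpx.X p) (y : V.cpx.X q),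
      f.f n (V.bracket h x y) = A.commutator h (f.f p x) (f.f q y))
    (hu : f.f 0 V.unit = A.one) {p q n : ℤ} (h : p + q = n) (x : V.envCpx.X p)
    (y : V.envCpx.X q) :
    V.descLin A f hb hu n (V.envMul h x y) =
      A.mul h (V.descLin A f hb hu p x) (V.descLin A f hb hu q y) :=
  A.leftMul_injective n (by
    rw [V.leftMul_descLin, V.val_envMul, map_mul, A.leftMul_mul, V.leftMul_descLin,
      V.leftMul_descLin])

lemma ULie.descLin_toEnvCpx {K : Type u} [Field K] (V : ULie K) (A : DGA K) (f : V.cpx ⟶ A.cpx)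
    (hb : ∀ {p q n : ℤ} (h : p + q = n) (x : V.cpx.X p) (y : V.cpx.X q),
      f.f n (V.bracket h x y) = A.commutator h (f.f p x) (f.f q y))
    (hu : f.f 0 V.unit = A.one) {p : ℤ} (x : V.cpx.X p) :
    V.descLin A f hb hu p (V.toEnvCpx.f p x) = f.f p x :=
  A.leftMul_injective p (by
    rw [V.leftMul_descLin, V.val_toEnvCpx, V.descHom_gen])

lemma ULie.descLin_d {K : Type u} [Field K] (V : ULie K) (A : DGA K) (f : V.cpx ⟶ A.cpx)
    (hb : ∀ {p q n : ℤ} (h : p + q = n) (x : V.cpx.X p) (y : V.cpx.X q),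
      f.f n (V.bracket h x y) = A.commutator h (f.f p x) (f.f q y))
    (hu : f.f 0 V.unit = A.one) {n n' : ℤ} (hn : n' + 1 = n) (a : V.envCpx.X n) :
    V.descLin A f hb hu n' (V.envCpx.d n n' a) = A.cpx.d n n' (V.descLin A f hb hu n a) := by
  induction n, a using V.env_induction generalizing n' with
  | one =>
    obtain rfl : n' = -1 := by omega
    rw [V.descLin_one, A.d_one]
    exact (congrArg _ V.env.d_one).trans (map_zero _)
  | @gen_mul p q n h x a ih =>
    have hp : (p - 1) + 1 = p := by omega
    have hq : (q - 1) + 1 = q := by omega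
    have h₁ : (p - 1) + q = n' := by omega
    have h₂ : p + (q - 1) = n' := by omega
    have e := V.env.d_mul h h₁ h₂ hp hq
      (V.toEnvCpx.f p x) a
    change V.envCpx.d n n' (V.envMul h _ _) = V.envMul h₁ (V.envCpx.d _ _ _) _ +
      p.negOnePow • V.envMul h₂ _ (V.envCpx.d _ _ _) at e
    have e' : V.envCpx.d p (p - 1) (V.toEnvCpx.f p x) =
        V.toEnvCpx.f (p - 1) (V.cpx.d p (p - 1) x) := by
      rw [← ModuleCat.comp_apply, ← ModuleCat.comp_apply, V.toEnvCpx.comm]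
    have e'' : A.cpx.d p (p - 1) (f.f p x) = f.f (p - 1) (V.cpx.d p (p - 1) x) := by
      rw [← ModuleCat.comp_apply, ← ModuleCat.comp_apply, f.comm]
    rw [e, map_add, map_sign_smul, V.descLin_mul, V.descLin_mul, V.descLin_mul, ih hq, e',
      V.descLin_toEnvCpx, V.descLin_toEnvCpx, A.d_mul h _ _ hp hq, e'']
  | zero n => simp
  | add n a b ha hb => simp only [map_add, ha hn, hb hn]
  | smul n c a ha => simp only [map_smul, ha hn]

/-- The morphism of differential graded algebras out of the enveloping algebra
induced by a morphism of unital Lie algebras. -/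
def ULie.desc {K : Type u} [Field K] {V : ULie K} {A : DGA K} (f : V ⟶ (phiStar K).obj A) :
    V.env ⟶ A where
  hom :=
    { f := fun n => ModuleCat.ofHom (V.descLin A f.hom f.map_bracket f.map_unit n)
      comm' := by
        intro i j hij
        ext x
        exact (V.descLin_d A f.hom f.map_bracket f.map_unit hij x).symm }
  map_mul h x y := V.descLin_mul A f.hom f.map_bracket f.map_unit h x y
  map_one := V.descLin_one A f.hom f.map_bracket f.map_unit

/-- The universal property of the unital universal enveloping algebra. -/
def ULie.envEquiv {K : Type u} [Field K] (V : ULie K) (A : DGA K) :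
    (V.env ⟶ A) ≃ (V ⟶ (phiStar K).obj A) where
  toFun g := V.toEnv ≫ (phiStar K).map g
  invFun := ULie.desc
  left_inv g := by
    refine DGA.Hom.ext (HomologicalComplex.hom_ext _ _ fun n => ?_)
    ext a
    set f := V.toEnv ≫ (phiStar K).map g
    change V.descLin A f.hom f.map_bracket f.map_unit n a = g.hom.f n a
    induction n, a using V.env_induction with
    | one => exact (V.descLin_one ..).trans g.map_one.symm
    | gen_mul h x a ih =>
      refine (V.descLin_mul A f.hom f.map_bracket f.map_unit h _ _).trans ?_
      refine Eq.trans ?_ (g.map_mul h _ _).symm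
      rw [ih]
      exact congrArg (fun t => A.mul h t _)
        (V.descLin_toEnvCpx A f.hom f.map_bracket f.map_unit x)
    | zero n => exact (map_zero _).trans (map_zero _).symm
    | add n a b ha hb => 
      rw [map_add, ha, hb]
      exact (map_add (g.hom.f n).hom a b).symm
    | smul n c a ha =>
      rw [map_smul, ha]
      exact (map_smul (g.hom.f n).hom c a).symm
  right_inv f := by
    refine ULie.Hom.ext (HomologicalComplex.hom_ext _ _ fun n => ?_)
    ext x
    exact V.descLin_toEnvCpx A f.hom f.map_bracket f.map_unit x

/-- The unital universal enveloping algebra functor. -/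
def phiShriek (K : Type u) [Field K] : ULie K ⥤ DGA K :=
  Adjunction.leftAdjointOfEquiv (G := phiStar K) (fun V A => V.envEquiv A)
    (by intros; rfl)

/-- The unital universal enveloping algebra functor is left adjoint to the functor which takes
a differential graded algebra to the unital Lie algebra given by the graded commutator. -/
def phiAdjunction (K : Type u) [Field K] : phiShriek K ⊣ phiStar K :=
  Adjunction.adjunctionOfEquivLeft (G := phiStar K) (fun V A => V.envEquiv A)
    (by intros; rfl)

lemma phiShriek_map_gen {K : Type u} [Field K] {V W : ULie K} (f : V ⟶ W) {p : ℤ}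
    (x : V.cpx.X p) :
    ((phiShriek K).map f).hom.f p (V.toEnvCpx.f p x) = W.toEnvCpx.f p (f.hom.f p x) := by
  let g : V ⟶ (phiStar K).obj W.env := f ≫ W.envEquiv W.env (𝟙 W.env)
  exact V.descLin_toEnvCpx W.env g.hom g.map_bracket g.map_unit x

/-- The components of the map of enveloping algebras induced by a morphism `V ⟶ W`,
with values in the underlying algebra. -/
def ULie.mapVal {K : Type u} [Field K] {V W : ULie K} (f : V ⟶ W) (n : ℤ) :
    V.envCpx.X n →ₗ[K] W.Env :=
  (W.val n).comp (((phiShriek K).map f).hom.f n).hom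

lemma ULie.mapVal_gen_mul {K : Type u} [Field K] {V W : ULie K} (f : V ⟶ W) {p q n : ℤ}
    (h : p + q = n) (x : V.cpx.X p) (a : V.envCpx.X q) :
    ULie.mapVal f n (V.envMul h (V.toEnvCpx.f p x) a) =
      W.gen p (f.hom.f p x) * ULie.mapVal f q a := by
  refine (congrArg (W.val n) (((phiShriek K).map f).map_mul h (V.toEnvCpx.f p x) a)).trans ?_
  refine (W.val_envMul h _ _).trans ?_
  rw [phiShriek_map_gen]
  rfl

lemma ULie.mapVal_one {K : Type u} [Field K] {V W : ULie K} (f : V ⟶ W) :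
    ULie.mapVal f 0 (V.toCpx 1 V.one_mem_grade) = 1 :=
  congrArg (W.val 0) ((phiShriek K).map f).map_one

/-- An orthogonality relation on a category `C`, turning `C` into an orthogonal category: a
symmetric relation on pairs of morphisms with common target which is stable under pre- and
postcomposition. -/
structure Orthogonality (C : Type v) [Category.{w} C] where
  /-- the relation `f₁ ⊥ f₂` -/
  rel : ∀ {c₁ c₂ c : C}, (c₁ ⟶ c) → (c₂ ⟶ c) → Prop
  symm : ∀ {c₁ c₂ c : C} {f₁ : c₁ ⟶ c} {f₂ : c₂ ⟶ c}, rel f₁ f₂ → rel f₂ f₁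
  comp : ∀ {c₁ c₂ c b₁ b₂ d : C} {f₁ : c₁ ⟶ c} {f₂ : c₂ ⟶ c} (h₁ : b₁ ⟶ c₁) (h₂ : b₂ ⟶ c₂)
    (g : c ⟶ d), rel f₁ f₂ → rel (h₁ ≫ f₁ ≫ g) (h₂ ≫ f₂ ≫ g)

/-- A functor to unital Lie algebras is a linear field theory if the Lie bracket
`[B(f₁)(-), B(f₂)(-)] : B(c₁) ⊗ B(c₂) ⟶ B(c)` vanishes for all orthogonal pairs. -/
def IsLFT (K : Type u) [Field K] {C : Type v} [Category.{w} C] (O : Orthogonality C) :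
    ObjectProperty (C ⥤ ULie K) := fun B =>
  ∀ {c₁ c₂ c : C} (f₁ : c₁ ⟶ c) (f₂ : c₂ ⟶ c), O.rel f₁ f₂ →
    ∀ {p q n : ℤ} (h : p + q = n) (x : (B.obj c₁).cpx.X p) (y : (B.obj c₂).cpx.X q),
      (B.obj c).bracket h ((B.map f₁).hom.f p x) ((B.map f₂).hom.f q y) = 0

/-- The category of `Ch(K)`-valued linear field theories, a full subcategory of the category of
functors to unital Lie algebras. -/
abbrev LFT (K : Type u) [Field K] {C : Type v} [Category.{w} C] (O : Orthogonality C) :=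
  (IsLFT K O).FullSubcategory

/-- A functor to differential graded algebras is a quantum field theory if the graded commutator
`[A(f₁)(-), A(f₂)(-)] : A(c₁) ⊗ A(c₂) ⟶ A(c)` vanishes for all orthogonal pairs. -/
def IsQFT (K : Type u) [Field K] {C : Type v} [Category.{w} C] (O : Orthogonality C) :
    ObjectProperty (C ⥤ DGA K) := fun A =>
  ∀ {c₁ c₂ c : C} (f₁ : c₁ ⟶ c) (f₂ : c₂ ⟶ c), O.rel f₁ f₂ →
    ∀ {p q n : ℤ} (h : p + q = n) (x : (A.obj c₁).cpx.X p) (y : (A.obj c₂).cpx.X q),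
      (A.obj c).commutator h ((A.map f₁).hom.f p x) ((A.map f₂).hom.f q y) = 0

/-- The category of `Ch(K)`-valued quantum field theories, a full subcategory of the category of
functors to differential graded algebras. -/
abbrev QFT (K : Type u) [Field K] {C : Type v} [Category.{w} C] (O : Orthogonality C) :=
  (IsQFT K O).FullSubcategory

/-- The functor `QFT ⥤ LFT` which takes graded commutators objectwise. -/
def Ulin (K : Type u) [Field K] {C : Type v} [Category.{w} C] (O : Orthogonality C) :
    QFT K O ⥤ LFT K O :=
  (IsLFT K O).lift ((IsQFT K O).ι ⋙ (Functor.whiskeringRight C _ _).obj (phiStar K))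
    (fun A _ _ _ f₁ f₂ r _ _ _ h x y => A.property f₁ f₂ r h x y)

lemma sign_comm_one {V : Type*} [Ring V] (p : ℤ) (a : V) :
    1 * a = (0 * p).negOnePow • (a * 1) := by simp

lemma sign_comm_mul {R : Type*} [Ring R] {a a' b : R} {p p' n q : ℤ} (h : p + p' = n)
    (ha : a * b = (p * q).negOnePow • (b * a)) (ha' : a' * b = (p' * q).negOnePow • (b * a')) :
    (a * a') * b = (n * q).negOnePow • (b * (a * a')) := by
  rw [mul_assoc, ha', sign_mul_right, ← mul_assoc, ha, sign_mul_left, smul_smul, ← h, add_mul,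
    Int.negOnePow_add, mul_comm, mul_assoc]

lemma sign_comm_symm {R : Type*} [Ring R] {a b : R} {p q : ℤ}
    (h : a * b = (p * q).negOnePow • (b * a)) : b * a = (q * p).negOnePow • (a * b) := by
  rw [h, smul_smul, mul_comm q p, Int.units_mul_self, one_smul]

/-- If the brackets of the images of `f₁` and `f₂` vanish, then the graded commutators of the
images of the induced morphisms of enveloping algebras vanish. -/
lemma ULie.mapVal_commute {K : Type u} [Field K] {V₁ V₂ V : ULie K} (f₁ : V₁ ⟶ V) (f₂ : V₂ ⟶ V)
    (hf : ∀ {p q n : ℤ} (h : p + q = n) (x : V₁.cpx.X p) (y : V₂.cpx.X q),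
      V.bracket h (f₁.hom.f p x) (f₂.hom.f q y) = 0) {p q : ℤ} (a : V₁.envCpx.X p)
    (b : V₂.envCpx.X q) :
    ULie.mapVal f₁ p a * ULie.mapVal f₂ q b =
      (p * q).negOnePow • (ULie.mapVal f₂ q b * ULie.mapVal f₁ p a) := by
  have key : ∀ {p : ℤ} (x : V₁.cpx.X p) (q : ℤ) (b : V₂.envCpx.X q),
      V.gen p (f₁.hom.f p x) * ULie.mapVal f₂ q b =
      (p * q).negOnePow • (ULie.mapVal f₂ q b * V.gen p (f₁.hom.f p x)) := by
    intro p x q b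
    refine sign_comm_symm ?_
    induction q, b using V₂.env_induction with
    | one =>
      rw [ULie.mapVal_one]
      exact sign_comm_one _ _
    | @gen_mul q q' m h y b ih =>
      rw [ULie.mapVal_gen_mul]
      refine sign_comm_mul h (sign_comm_symm ?_) ih
      have := V.gen_bracket rfl (f₁.hom.f p x) (f₂.hom.f q y)
      rw [hf, map_zero] at this
      exact (sub_eq_zero.1 this.symm)
    | zero n => simp
    | add n a b ha hb => simp only [map_add, add_mul, mul_add, smul_add, ha, hb]
    | smul n c a ha => simp only [map_smul, smul_mul_assoc, mul_smul_comm, ha, smul_comm c]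
  induction p, a using V₁.env_induction with
  | one =>
    rw [ULie.mapVal_one]
    exact sign_comm_one _ _
  | @gen_mul p p' m h x a ih =>
    rw [ULie.mapVal_gen_mul]
    exact sign_comm_mul h (key x q b) ih
  | zero n => simp
  | add n a b ha hb => simp only [map_add, add_mul, mul_add, smul_add, ha, hb]
  | smul n c a ha => simp only [map_smul, smul_mul_assoc, mul_smul_comm, ha, smul_comm c]

lemma phiShriek_commutator {K : Type u} [Field K] {V₁ V₂ V : ULie K} (f₁ : V₁ ⟶ V) (f₂ : V₂ ⟶ V)
    (hf : ∀ {p q n : ℤ} (h : p + q = n) (x : V₁.cpx.X p) (y : V₂.cpx.X q),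
      V.bracket h (f₁.hom.f p x) (f₂.hom.f q y) = 0) {p q n : ℤ} (h : p + q = n)
    (a : ((phiShriek K).obj V₁).cpx.X p) (b : ((phiShriek K).obj V₂).cpx.X q) :
    ((phiShriek K).obj V).commutator h (((phiShriek K).map f₁).hom.f p a)
      (((phiShriek K).map f₂).hom.f q b) = 0 := by
  have h' : q + p = n := by omega
  refine V.val_injective n ?_
  refine (map_sub (V.val n) (V.envMul h (((phiShriek K).map f₁).hom.f p a)
    (((phiShriek K).map f₂).hom.f q b)) ((p * q).negOnePow •
      V.envMul h' (((phiShriek K).map f₂).hom.f q b) (((phiShriek K).map f₁).hom.f p a))).trans ?_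
  refine (sub_eq_zero.2 ?_).trans (map_zero (V.val n)).symm
  refine Eq.trans ?_ (map_sign_smul (V.val n) _ _).symm
  exact ULie.mapVal_commute f₁ f₂ hf a b

/-- The linear quantization functor `LFT ⥤ QFT`, which takes unital universal enveloping algebras
objectwise. It is the left adjoint of `Ulin`, see `qlinAdjunction`. -/
def Qlin (K : Type u) [Field K] {C : Type v} [Category.{w} C] (O : Orthogonality C) :
    LFT K O ⥤ QFT K O :=
  (IsQFT K O).lift ((IsLFT K O).ι ⋙ (Functor.whiskeringRight C _ _).obj (phiShriek K))
    (fun B _ _ _ f₁ f₂ r _ _ _ h x y =>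
      phiShriek_commutator (B.obj.map f₁) (B.obj.map f₂) (B.property f₁ f₂ r) h x y)

/-- Linear quantization is left adjoint to the functor which takes graded commutators. -/
def qlinAdjunction (K : Type u) [Field K] {C : Type v} [Category.{w} C] (O : Orthogonality C) :
    Qlin K O ⊣ Ulin K O :=
  ((phiAdjunction K).whiskerRight C).restrictFullyFaithful (IsLFT K O).fullyFaithfulι
    (IsQFT K O).fullyFaithfulι (Iso.refl _) (Iso.refl _)

/-- A linear field theory is homotopy `W`-constant if the chain map underlying `B(f)` is a
quasi-isomorphism for every morphism `f` in `W`. -/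
def LFT.HomotopyConstant {K : Type u} [Field K] {C : Type v} [Category.{w} C]
    {O : Orthogonality C} (W : MorphismProperty C) (B : LFT K O) : Prop :=
  ∀ ⦃c c' : C⦄ (f : c ⟶ c'), W f → QuasiIso ((ULie.forget K).map (B.obj.map f))

/-- A quantum field theory is homotopy `W`-constant if the chain map underlying `A(f)` is a
quasi-isomorphism for every morphism `f` in `W`. -/
def QFT.HomotopyConstant {K : Type u} [Field K] {C : Type v} [Category.{w} C]
    {O : Orthogonality C} (W : MorphismProperty C) (A : QFT K O) : Prop :=
  ∀ ⦃c c' : C⦄ (f : c ⟶ c'), W f → QuasiIso ((DGA.forget K).map (A.obj.map f))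

end LinearQuantization

end

set_option linter.unusedSectionVars false

noncomputable section

/-! Homotopy constancy is tested on one morphism at a time, so it suffices that `phiShriek`
preserves quasi-isomorphisms (`quasiIso_phiShriek_map`). Characteristic zero serves to divide by
positive integers, in each of the two halves of the argument.

Removing the bracket: as in the Poincaré–Birkhoff–Witt theorem, symmetrizing products gives an
isomorphism of complexes `ULie.symIso` from the enveloping algebra of the abelian `V.ab` to that of
`V`. It is natural in `V`, so the brackets may be assumed to be zero (`quasiIso_mapCpx_iff`). Its
inverse is built without a basis, by extending a function on commuting letters to words of
increasing length. On words of length `n + 1` the symmetric group acts by affine maps: exchanging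
two neighbours adds the value, already known, on the shorter word in which they are bracketed.
Antisymmetry and the Jacobi identity make this an action (`isCocycle_brAt`, `IsCocycle.isCoxeter`),
and an average over it obeys the exchange rule of the enveloping algebra (`symmetrize_append`,
`ULie.pbwFun`).

Abelian case: the enveloping algebra is the graded symmetric algebra with the unit of `V` set equal
to `1`. If that unit is a boundary, the enveloping algebras of source and target are both acyclic.
Otherwise there are representatives of the homology which include the unit, and a contraction `h`
with `d h + h d = 1 - P`, where `P` projects onto them and `h` kills the unit. Extended to a
derivation, `h` makes `d h + h d` multiply a product by its number of factors `x - P x`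
(`ULie.laplace_isWeighted`). Dividing by this number shows that `P` induces the identity on the
homology of the enveloping algebra (`ULie.IsAbelian.exists_envMap_eq_add_diff`). A quasi-isomorphism
`f` carries representatives bijectively to representatives, which yields a morphism `g` back such
that `f` and `g` are mutually inverse up to such projections (`ULie.IsAbelian.quasiIso_mapCpx`). -/

namespace LinearQuantization

/-! ### Averages over the symmetric group, from the Coxeter relations alone -/

section Averaging

variable {K : Type*} [Field K] {R : Type*} [Ring R] [Algebra K R]

/-- The product `s 0 * s 1 * ⋯ * s (k - 1)`. -/
def cyc (s : ℕ → R) : ℕ → R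
  | 0 => 1
  | k + 1 => s 0 * cyc (fun i => s (i + 1)) k

/-- The average over the symmetric group on `n` letters, where the adjacent transpositions are
represented by `s 0, …, s (n - 2)`. -/
def avg (K : Type*) [Field K] {R : Type*} [Ring R] [Algebra K R] (s : ℕ → R) : ℕ → R
  | 0 => 1
  -- The `n + 1` products `cyc s k` represent the right cosets of the subgroup generated by `s 1, s
  -- 2, …`, which fixes the first letter.
  | n + 1 => avg K (fun i => s (i + 1)) n *
      ((n + 1 : K)⁻¹ • ∑ k ∈ Finset.range (n + 1), cyc s k)

/-- The elements `s 0, …, s (n - 2)` satisfy the Coxeter relations of the symmetric group on `n`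
letters. -/
structure IsCoxeter (s : ℕ → R) (n : ℕ) : Prop where
  sq : ∀ i, i + 1 < n → s i * s i = 1
  comm : ∀ i j, i + 2 ≤ j → j + 1 < n → s i * s j = s j * s i
  braid : ∀ i, i + 2 < n → s i * s (i + 1) * s i = s (i + 1) * s i * s (i + 1)

lemma IsCoxeter.shift {s : ℕ → R} {n : ℕ} (h : IsCoxeter s (n + 1)) :
    IsCoxeter (fun i => s (i + 1)) n where
  sq i hi := h.sq _ (by omega)
  comm i j hij hj := h.comm _ _ (by omega) (by omega)
  braid i hi := h.braid _ (by omega)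

lemma IsCoxeter.op {s : ℕ → R} {n : ℕ} (h : IsCoxeter s n) :
    IsCoxeter (fun i => MulOpposite.op (s i)) n where
  sq i hi := by rw [← MulOpposite.op_mul, h.sq i hi, MulOpposite.op_one]
  comm i j hij hj := by rw [← MulOpposite.op_mul, ← MulOpposite.op_mul, h.comm i j hij hj]
  braid i hi := by simp only [← MulOpposite.op_mul, ← mul_assoc, h.braid i hi]

/-- The definition splits off the first factor, as suits shifted sequences; the inductions below
need to split off the last one. -/
lemma cyc_succ (s : ℕ → R) (k : ℕ) : cyc s (k + 1) = cyc s k * s k := by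
  induction k generalizing s with
  | zero => simp [cyc]
  | succ k ih => rw [cyc, ih, cyc, mul_assoc]

/-- All factors of `cyc s k` have index at most `i - 2`, so they commute with `s i`. -/
lemma IsCoxeter.cyc_mul_of_lt {s : ℕ → R} {n : ℕ} (h : IsCoxeter s n) {k i : ℕ} (hk : k < i)
    (hi : i + 1 < n) : cyc s k * s i = s i * cyc s k := by
  induction k with
  | zero => simp [cyc]
  | succ k ih =>
    rw [cyc_succ, mul_assoc, h.comm k i (by omega) hi, ← mul_assoc, ih (by omega), mul_assoc]

/-- The braid relation gives the case `k = i + 2`; every later factor commutes with `s i`. -/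
lemma IsCoxeter.cyc_mul_of_gt {s : ℕ → R} {n : ℕ} (h : IsCoxeter s n) {k i : ℕ} (hi : i + 1 < k)
    (hk : k < n) : cyc s k * s i = s (i + 1) * cyc s k := by
  induction k with
  | zero => omega
  | succ k ih =>
    obtain rfl | hk' : k = i + 1 ∨ i + 1 < k := by omega
    · rw [cyc_succ, cyc_succ, mul_assoc, mul_assoc, ← mul_assoc (s i), h.braid i (by omega),
        ← mul_assoc, ← mul_assoc, h.cyc_mul_of_lt (by omega) (by omega)]
      simp only [mul_assoc]
    · rw [cyc_succ, mul_assoc, ← h.comm i k (by omega) (by omega), ← mul_assoc,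
        ih hk' (by omega), mul_assoc]

/-- Right multiplication by `s i` permutes the cosets: it exchanges the terms `i` and `i + 1` of the
sum, and in any other term it passes to the left of `cyc s k` as a generator of the subgroup, where
the shifted average absorbs it by induction. -/
lemma avg_mul {s : ℕ → R} {n : ℕ} (h : IsCoxeter s n) {i : ℕ} (hi : i + 1 < n) :
    avg K s n * s i = avg K s n := by
  induction n generalizing s i with
  | zero => omega
  | succ n ih =>
    rw [avg, mul_assoc, smul_mul_assoc, mul_smul_comm, mul_smul_comm, Finset.sum_mul,
      Finset.mul_sum, Finset.mul_sum]
    congr 1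
    refine Finset.sum_equiv (Equiv.swap i (i + 1)) (fun k => ?_) (fun k hk => ?_)
    · rw [Equiv.swap_apply_def]
      split_ifs <;> simp only [Finset.mem_range] <;> omega
    · rw [Finset.mem_range] at hk
      obtain rfl | rfl | hlt | hgt : k = i ∨ k = i + 1 ∨ k < i ∨ i + 1 < k := by omega
      · rw [Equiv.swap_apply_left, cyc_succ]
      · rw [Equiv.swap_apply_right, cyc_succ, mul_assoc, h.sq i (by omega), mul_one]
      · rw [Equiv.swap_apply_of_ne_of_ne (by omega) (by omega), h.cyc_mul_of_lt hlt hi,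
          ← mul_assoc]
        -- As `k < i`, the index `i` is positive, so `s i` belongs to the shifted sequence.
        obtain ⟨j, rfl⟩ : ∃ j, i = j + 1 := ⟨i - 1, by omega⟩
        rw [ih h.shift (i := j) (by omega)]
      · rw [Equiv.swap_apply_of_ne_of_ne (by omega) (by omega), h.cyc_mul_of_gt hgt hk,
          ← mul_assoc, ih h.shift (by omega)]

variable [CharZero K]

/-- Each of the `n + 1` coset terms fixes `z`, and the factor `(n + 1)⁻¹` normalizes their sum; this
needs characteristic zero. -/
lemma avg_mul_eq_of_fixed {s : ℕ → R} {n : ℕ} {z : R} (hz : ∀ i, i + 1 < n → s i * z = z) :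
    avg K s n * z = z := by
  have hc : ∀ (k : ℕ) (s : ℕ → R), (∀ i, i < k → s i * z = z) → cyc s k * z = z := by
    intro k
    induction k with
    | zero => intros; simp [cyc]
    | succ k ih =>
      intro s hs
      rw [cyc_succ, mul_assoc, hs k (by omega), ih s (fun i hi => hs i (by omega))]
  induction n generalizing s with
  | zero => simp [avg]
  | succ n ih =>
    rw [avg, mul_assoc, smul_mul_assoc, Finset.sum_mul, Finset.sum_congr rfl (fun k hk =>
      hc k s (fun i hi => hz i (by rw [Finset.mem_range] at hk; omega)))]
    rw [Finset.sum_const, Finset.card_range, ← Nat.cast_smul_eq_nsmul K, smul_smul]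
    rw [Nat.cast_succ, inv_mul_cancel₀ (by exact_mod_cast Nat.succ_ne_zero n), one_smul]
    exact ih (fun i hi => hz (i + 1) (by omega))

/-- The average `t` formed in the opposite algebra is absorbing on the other side. The product `avg
K s n * t` equals `t`, because `t` is fixed by every `s i`, and equals `avg K s n`, because the
latter absorbs every `s i`. Hence the two averages coincide. -/
lemma mul_avg {s : ℕ → R} {n : ℕ} (h : IsCoxeter s n) {i : ℕ} (hi : i + 1 < n) :
    s i * avg K s n = avg K s n := by
  set t := MulOpposite.unop (avg K (fun i => MulOpposite.op (s i)) n) with ht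
  have h₁ : ∀ i, i + 1 < n → s i * t = t := fun i hi =>
    MulOpposite.op_injective (avg_mul (K := K) h.op hi)
  have h₂ : avg K s n * t = t := avg_mul_eq_of_fixed h₁
  have h₃ : avg K s n * t = avg K s n := by
    refine MulOpposite.op_injective ?_
    rw [MulOpposite.op_mul, ht, MulOpposite.op_unop]
    refine avg_mul_eq_of_fixed fun i hi => ?_
    rw [← MulOpposite.op_mul, avg_mul h hi]
  rw [← h₃, h₂, h₁ i hi]

end Averaging

/-! ### Averages acting on modules -/

section AveragingModule

variable {K : Type*} [Field K] {X Y : Type*} [AddCommGroup X] [Module K X] [AddCommGroup Y]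
  [Module K Y]

lemma cyc_intertwine {s : ℕ → Module.End K X} {s' : ℕ → Module.End K Y} (J : X →ₗ[K] Y) {k : ℕ}
    (h : ∀ i, i < k → ∀ x, J (s i x) = s' i (J x)) (x : X) : J (cyc s k x) = cyc s' k (J x) := by
  induction k generalizing x with
  | zero => rfl
  | succ k ih =>
    rw [cyc_succ, cyc_succ, Module.End.mul_apply, Module.End.mul_apply,
      ih (fun i hi => h i (by omega)), h k (by omega)]

lemma avg_intertwine {s : ℕ → Module.End K X} {s' : ℕ → Module.End K Y} (J : X →ₗ[K] Y) {n : ℕ}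
    (h : ∀ i, i + 1 < n → ∀ x, J (s i x) = s' i (J x)) (x : X) :
    J (avg K s n x) = avg K s' n (J x) := by
  induction n generalizing s s' x with
  | zero => rfl
  | succ n ih =>
    rw [avg, avg, Module.End.mul_apply, Module.End.mul_apply, ih (fun i hi => h _ (by omega))]
    simp only [LinearMap.smul_apply, LinearMap.sum_apply, map_smul, map_sum]
    congr 1
    refine Finset.sum_congr rfl fun k hk => ?_
    rw [Finset.mem_range] at hk
    rw [cyc_intertwine J (fun i hi => h i (by omega))]

lemma avg_apply_mem {s : ℕ → Module.End K X} (p : Submodule K X) {n : ℕ}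
    (h : ∀ i, i + 1 < n → ∀ x ∈ p, s i x ∈ p) {x : X} (hx : x ∈ p) : avg K s n x ∈ p := by
  have hc : ∀ (k : ℕ) (s : ℕ → Module.End K X), (∀ i, i < k → ∀ x ∈ p, s i x ∈ p) →
      ∀ x ∈ p, cyc s k x ∈ p := by
    intro k
    induction k with
    | zero => intro s _ x hx; exact hx
    | succ k ih =>
      intro s hs x hx
      rw [cyc_succ, Module.End.mul_apply]
      exact ih s (fun i hi => hs i (by omega)) _ (hs k (by omega) x hx)
  induction n generalizing s x with
  | zero => exact hx
  | succ n ih =>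
    rw [avg, Module.End.mul_apply]
    refine ih (fun i hi => h _ (by omega)) ?_
    simp only [LinearMap.smul_apply, LinearMap.sum_apply]
    refine p.smul_mem _ (p.sum_mem fun k hk => ?_)
    rw [Finset.mem_range] at hk
    exact hc k s (fun i hi => h i (by omega)) x hx

/-- The map `c ↦ c • x` intertwines the trivial action on `K` with the given one, and the trivial
action averages to `1`. -/
lemma avg_apply_eq_of_fixed [CharZero K] {s : ℕ → Module.End K X} {n : ℕ} {x : X}
    (h : ∀ i, i + 1 < n → s i x = x) : avg K s n x = x := by
  have h₁ := avg_intertwine (s := fun _ => (1 : Module.End K K)) (s' := s) (n := n)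
    (LinearMap.toSpanSingleton K X x) (fun i hi c => by simp [h i hi]) 1
  have h₂ : avg K (fun _ => (1 : Module.End K K)) n = 1 := by
    simpa using avg_mul_eq_of_fixed (K := K) (s := fun _ => (1 : Module.End K K)) (n := n) (z := 1)
      (fun _ _ => one_mul 1)
  simpa [h₂] using h₁.symm

end AveragingModule

/-! ### Words in homogeneous letters and affine exchanges of neighbouring letters -/

section Words

/-- Swap the entries at the positions `i` and `i + 1` of a list. -/
def swapAt {α : Type*} : ℕ → List α → List α
  | 0, x :: y :: l => y :: x :: l
  | i + 1, x :: l => x :: swapAt i l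
  | _, l => l

lemma swapAt_append {α : Type*} (a : List α) (k : ℕ) (l : List α) :
    swapAt (a.length + k) (a ++ l) = a ++ swapAt k l := by
  induction a with
  | nil => simp
  | cons x a ih => rw [List.length_cons, Nat.add_right_comm]; exact congrArg _ ih

lemma swapAt_length_append {α : Type*} (a : List α) (x y : α) (b : List α) :
    swapAt a.length (a ++ x :: y :: b) = a ++ y :: x :: b :=
  swapAt_append a 0 (x :: y :: b)

lemma length_swapAt {α : Type*} (i : ℕ) (l : List α) : (swapAt i l).length = l.length := by
  induction l generalizing i with
  | nil => cases i <;> rfl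
  | cons x l ih =>
    cases i with
    | zero => cases l <;> rfl
    | succ i => exact congrArg (· + 1) (ih i)

lemma swapAt_map {α β : Type*} (f : α → β) (i : ℕ) (l : List α) :
    swapAt i (l.map f) = (swapAt i l).map f := by
  induction l generalizing i with
  | nil => cases i <;> rfl
  | cons x l ih =>
    cases i with
    | zero => cases l <;> rfl
    | succ i => exact congrArg (f x :: ·) (ih i)

lemma exists_eq_append_cons_cons {α : Type*} {i : ℕ} {l : List α} (h : i + 1 < l.length) :
    ∃ a x y b, l = a ++ x :: y :: b ∧ a.length = i := by
  induction i generalizing l with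
  | zero =>
    match l, h with
    | x :: y :: b, _ => exact ⟨[], x, y, b, rfl, rfl⟩
  | succ i ih =>
    match l, h with
    | z :: l, h =>
      obtain ⟨a, x, y, b, rfl, rfl⟩ := ih (l := l) (by simpa using h)
      exact ⟨z :: a, x, y, b, rfl, rfl⟩

variable {K : Type u} [Field K]

/-- A homogeneous element of a chain complex together with its degree. -/
abbrev Letter (E : Ch K) : Type u := Σ p : ℤ, E.X p

variable {E : Ch K}

/-- The Koszul sign of the exchange of two homogeneous elements. -/
def koszul (x y : Letter E) : ℤˣ := (x.1 * y.1).negOnePow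

lemma koszul_comm (x y : Letter E) : koszul x y = koszul y x := by
  rw [koszul, koszul, mul_comm]

lemma koszul_mul_self (x y : Letter E) : koszul x y * koszul x y = 1 := Int.units_mul_self _

/-- The Koszul sign of the exchange of the entries at the positions `i` and `i + 1`. -/
def signAt : ℕ → List (Letter E) → ℤˣ
  | 0, x :: y :: _ => koszul x y
  | i + 1, _ :: l => signAt i l
  | _, _ => 1

lemma signAt_append (a : List (Letter E)) (k : ℕ) (l : List (Letter E)) :
    signAt (a.length + k) (a ++ l) = signAt k l := by
  induction a with
  | nil => simp
  | cons x a ih => rw [List.length_cons, Nat.add_right_comm]; exact ih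

lemma signAt_length_append (a : List (Letter E)) (x y : Letter E) (b : List (Letter E)) :
    signAt a.length (a ++ x :: y :: b) = koszul x y :=
  signAt_append a 0 (x :: y :: b)

/-- The total degree of a word. -/
def wordDeg (w : List (Letter E)) : ℤ := (w.map Sigma.fst).sum

lemma wordDeg_swapAt (i : ℕ) (w : List (Letter E)) : wordDeg (swapAt i w) = wordDeg w := by
  induction w generalizing i with
  | nil => cases i <;> rfl
  | cons x l ih =>
    cases i with
    | zero =>
      cases l with
      | nil => rfl
      | cons y l => simp only [wordDeg, swapAt, List.map_cons, List.sum_cons]; ring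
    | succ i => exact congrArg (x.1 + ·) (ih i)

variable {A : Type*} [AddCommGroup A] [Module K A]

/-- A function on words is multilinear if it is linear in every letter. -/
def IsMultilinear (φ : List (Letter E) → A) : Prop :=
  ∀ (a b : List (Letter E)) (p : ℤ), IsLinearMap K fun x : E.X p => φ (a ++ ⟨p, x⟩ :: b)

lemma IsMultilinear.map_zero {φ : List (Letter E) → A} (h : IsMultilinear φ)
    (a b : List (Letter E)) (p : ℤ) : φ (a ++ ⟨p, 0⟩ :: b) = 0 := (h a b p).map_zero

/-- Where a letter goes and which sign appears depend on its degree but not on its value. This is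
why exchanges preserve multilinearity. -/
lemma exists_swapAt_insert (i : ℕ) (a b : List (Letter E)) (p : ℤ) :
    ∃ (a' b' : List (Letter E)) (e : ℤˣ), ∀ x : E.X p,
      swapAt i (a ++ ⟨p, x⟩ :: b) = a' ++ ⟨p, x⟩ :: b' ∧ signAt i (a ++ ⟨p, x⟩ :: b) = e := by
  induction i generalizing a with
  | zero =>
    match a, b with
    | [], [] => exact ⟨[], [], 1, fun x => ⟨rfl, rfl⟩⟩
    | [], y :: b => exact ⟨[y], b, (p * y.1).negOnePow, fun x => ⟨rfl, rfl⟩⟩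
    | [y], b => exact ⟨[], y :: b, (y.1 * p).negOnePow, fun x => ⟨rfl, rfl⟩⟩
    | y :: z :: a, b => exact ⟨z :: y :: a, b, koszul y z, fun x => ⟨rfl, rfl⟩⟩
  | succ i ih =>
    match a with
    | [] => exact ⟨[], swapAt i b, signAt i b, fun x => ⟨rfl, rfl⟩⟩
    | y :: a =>
      obtain ⟨a', b', e, h⟩ := ih a
      exact ⟨y :: a', b', e, fun x => ⟨congrArg (y :: ·) (h x).1, (h x).2⟩⟩

/-- The exchange of the letters at the positions `i` and `i + 1` acting on functions on words of
length `n`, up to a correction term `C i`. The second component makes this a linear operator. -/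
def swapOp (n : ℕ) (C : ℕ → List (Letter E) → A) (i : ℕ) :
    Module.End K ((List (Letter E) → A) × K) where
  toFun φ := (fun w => if w.length = n then signAt i w • φ.1 (swapAt i w) + φ.2 • C i w else φ.1 w,
    φ.2)
  map_add' φ ψ := by
    refine Prod.ext (funext fun w => ?_) rfl
    simp only [Prod.fst_add, Prod.snd_add, Pi.add_apply]
    split_ifs
    · rw [smul_add, add_smul]; abel
    · rfl
  map_smul' c φ := by
    refine Prod.ext (funext fun w => ?_) rfl
    simp only [Prod.smul_fst, Prod.smul_snd, Pi.smul_apply, RingHom.id_apply]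
    split_ifs
    · rw [smul_add, smul_comm c, smul_assoc]
    · rfl

lemma swapOp_fst (n : ℕ) (C : ℕ → List (Letter E) → A) (i : ℕ)
    (φ : (List (Letter E) → A) × K) {w : List (Letter E)} (h : w.length = n) :
    (swapOp n C i φ).1 w = signAt i w • φ.1 (swapAt i w) + φ.2 • C i w := if_pos h

lemma swapOp_fst_of_ne (n : ℕ) (C : ℕ → List (Letter E) → A) (i : ℕ)
    (φ : (List (Letter E) → A) × K) {w : List (Letter E)} (h : w.length ≠ n) :
    (swapOp n C i φ).1 w = φ.1 w := if_neg h

lemma swapOp_snd (n : ℕ) (C : ℕ → List (Letter E) → A) (i : ℕ)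
    (φ : (List (Letter E) → A) × K) : (swapOp n C i φ).2 = φ.2 := rfl

lemma swapOp_append (n : ℕ) (C : ℕ → List (Letter E) → A) (φ : (List (Letter E) → A) × K)
    {a b : List (Letter E)} {x y : Letter E} (h : (a ++ x :: y :: b).length = n) :
    (swapOp n C a.length φ).1 (a ++ x :: y :: b) =
      koszul x y • φ.1 (a ++ y :: x :: b) + φ.2 • C a.length (a ++ x :: y :: b) := by
  rw [swapOp_fst _ _ _ _ h, swapAt_length_append, signAt_length_append]

/-- The conditions on the correction terms under which the operators `swapOp n C i` satisfy the
Coxeter relations. -/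
structure IsCocycle (n : ℕ) (C : ℕ → List (Letter E) → A) : Prop where
  antisymm : ∀ (a : List (Letter E)) (x y : Letter E) (b : List (Letter E)),
    (a ++ x :: y :: b).length = n →
      koszul x y • C a.length (a ++ y :: x :: b) + C a.length (a ++ x :: y :: b) = 0
  comm : ∀ (a : List (Letter E)) (x y : Letter E) (b : List (Letter E)) (z t : Letter E)
    (c : List (Letter E)), (a ++ x :: y :: (b ++ z :: t :: c)).length = n →
      koszul x y • C (a.length + (b.length + 2)) (a ++ y :: x :: (b ++ z :: t :: c)) +
        C a.length (a ++ x :: y :: (b ++ z :: t :: c)) =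
      koszul z t • C a.length (a ++ x :: y :: (b ++ t :: z :: c)) +
        C (a.length + (b.length + 2)) (a ++ x :: y :: (b ++ z :: t :: c))
  braid : ∀ (a : List (Letter E)) (x y z : Letter E) (b : List (Letter E)),
    (a ++ x :: y :: z :: b).length = n →
      (koszul x y * koszul x z) • C a.length (a ++ y :: z :: x :: b) +
        koszul x y • C (a.length + 1) (a ++ y :: x :: z :: b) +
        C a.length (a ++ x :: y :: z :: b) =
      (koszul y z * koszul x z) • C (a.length + 1) (a ++ z :: x :: y :: b) +
        koszul y z • C a.length (a ++ x :: z :: y :: b) +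
        C (a.length + 1) (a ++ x :: y :: z :: b)

lemma isCocycle_zero (n : ℕ) : IsCocycle n (0 : ℕ → List (Letter E) → A) where
  antisymm := by simp
  comm := by simp
  braid := by simp

lemma swapOp_append_two (n : ℕ) (C : ℕ → List (Letter E) → A) (φ : (List (Letter E) → A) × K)
    {a b c : List (Letter E)} {x y z t : Letter E}
    (h : (a ++ x :: y :: (b ++ z :: t :: c)).length = n) :
    (swapOp n C (a.length + (b.length + 2)) φ).1 (a ++ x :: y :: (b ++ z :: t :: c)) =
      koszul z t • φ.1 (a ++ x :: y :: (b ++ t :: z :: c)) +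
        φ.2 • C (a.length + (b.length + 2)) (a ++ x :: y :: (b ++ z :: t :: c)) := by
  rw [swapOp_fst _ _ _ _ h, swapAt_append, signAt_append]
  change signAt b.length (b ++ z :: t :: c) •
    φ.1 (a ++ x :: y :: swapAt b.length (b ++ z :: t :: c)) + _ = _
  rw [swapAt_length_append, signAt_length_append]

lemma swapOp_append_one (n : ℕ) (C : ℕ → List (Letter E) → A) (φ : (List (Letter E) → A) × K)
    {a b : List (Letter E)} {x y z : Letter E} (h : (a ++ x :: y :: z :: b).length = n) :
    (swapOp n C (a.length + 1) φ).1 (a ++ x :: y :: z :: b) =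
      koszul y z • φ.1 (a ++ x :: z :: y :: b) +
        φ.2 • C (a.length + 1) (a ++ x :: y :: z :: b) := by
  rw [swapOp_fst _ _ _ _ h, swapAt_append, signAt_append]
  rfl

/-- Both sides of each Coxeter relation are affine in `φ`. Their linear parts agree because Koszul
signs multiply correctly, and the three fields of `IsCocycle` equate the translation parts. Words of
another length are left untouched by all operators. -/
lemma IsCocycle.isCoxeter {n : ℕ} {C : ℕ → List (Letter E) → A} (h : IsCocycle n C) :
    IsCoxeter (swapOp n C) n where
  sq i hi := by
    refine LinearMap.ext fun φ => Prod.ext (funext fun w => ?_) rfl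
    rw [Module.End.mul_apply, Module.End.one_apply]
    by_cases hw : w.length = n
    · obtain ⟨a, x, y, b, rfl, rfl⟩ := exists_eq_append_cons_cons (hw ▸ hi)
      have hw' : (a ++ y :: x :: b).length = n := by simpa using hw
      have hC := h.antisymm a x y b hw
      rw [swapOp_append _ _ _ hw, swapOp_append _ _ _ hw', swapOp_snd, smul_add, smul_smul,
        koszul_comm y x, koszul_mul_self, one_smul, add_assoc, smul_comm (koszul x y) φ.2,
        ← smul_add, hC, smul_zero, add_zero]
    · rw [swapOp_fst_of_ne _ _ _ _ hw, swapOp_fst_of_ne _ _ _ _ hw]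
  comm i j hij hj := by
    refine LinearMap.ext fun φ => Prod.ext (funext fun w => ?_) rfl
    rw [Module.End.mul_apply, Module.End.mul_apply]
    by_cases hw : w.length = n
    · obtain ⟨a, x, y, l, rfl, rfl⟩ := exists_eq_append_cons_cons (i := i) (l := w) (by omega)
      obtain ⟨k, rfl⟩ : ∃ k, j = a.length + (k + 2) := ⟨j - 2 - a.length, by omega⟩
      obtain ⟨b, z, t, c, rfl, rfl⟩ := exists_eq_append_cons_cons (i := k) (l := l) (by
        simp at hw; omega)
      have h₁ : (a ++ y :: x :: (b ++ z :: t :: c)).length = n := by simpa using hw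
      have h₂ : (a ++ x :: y :: (b ++ t :: z :: c)).length = n := by simpa using hw
      have hC := h.comm a x y b z t c hw
      rw [swapOp_append _ _ _ hw, swapOp_append_two _ _ _ h₁, swapOp_append_two _ _ _ hw,
        swapOp_append _ _ _ h₂, swapOp_snd, swapOp_snd, smul_add, smul_add, smul_smul, smul_smul,
        mul_comm (koszul z t), add_assoc, add_assoc, smul_comm (koszul x y) φ.2,
        smul_comm (koszul z t) φ.2, ← smul_add, ← smul_add, hC]
    · rw [swapOp_fst_of_ne _ _ _ _ hw, swapOp_fst_of_ne _ _ _ _ hw, swapOp_fst_of_ne _ _ _ _ hw,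
        swapOp_fst_of_ne _ _ _ _ hw]
  braid i hi := by
    refine LinearMap.ext fun φ => Prod.ext (funext fun w => ?_) rfl
    simp only [Module.End.mul_apply]
    by_cases hw : w.length = n
    · obtain ⟨a, x, y, l, rfl, rfl⟩ := exists_eq_append_cons_cons (i := i) (l := w) (by omega)
      match l, hi, hw with
      | [], hi, hw => simp at hw; omega
      | z :: b, hi, hw =>
      have h₁ : (a ++ y :: x :: z :: b).length = n := by simpa using hw
      have h₂ : (a ++ y :: z :: x :: b).length = n := by simpa using hw
      have h₃ : (a ++ x :: z :: y :: b).length = n := by simpa using hw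
      have h₄ : (a ++ z :: x :: y :: b).length = n := by simpa using hw
      have hC := h.braid a x y z b hw
      rw [swapOp_append _ _ _ hw, swapOp_append_one _ _ _ h₁, swapOp_append _ _ _ h₂,
        swapOp_append_one _ _ _ hw, swapOp_append _ _ _ h₃, swapOp_append_one _ _ _ h₄]
      simp only [swapOp_snd]
      have e₁ := congrArg (φ.2 • ·) hC
      simp only [smul_add, smul_comm φ.2 (_ : ℤˣ)] at e₁
      simp only [smul_add, smul_smul, add_assoc] at e₁ ⊢
      have e₂ : koszul x y * (koszul x z * koszul y z) = koszul y z * (koszul x z * koszul x y) := by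
        ac_rfl
      rw [e₁, e₂]
    · simp only [swapOp_fst_of_ne _ _ _ _ hw]

end Words

/-! ### Symmetrization of functions on words, with correction terms -/

section Symmetrization

variable {K : Type u} [Field K] {E : Ch K} {A : Type*} [AddCommGroup A] [Module K A]

/-- The average of `π` over all reorderings of words of length `n`, with the correction terms `C`
for every exchange of adjacent letters. -/
def symmetrize (n : ℕ) (C : ℕ → List (Letter E) → A) (π : List (Letter E) → A) :
    List (Letter E) → A :=
  -- The second component `1` switches the corrections on.
  (avg K (swapOp n C) n (π, 1)).1

lemma avg_swapOp_snd (n m : ℕ) (C : ℕ → List (Letter E) → A) (φ : (List (Letter E) → A) × K)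
    [CharZero K] : (avg K (swapOp n C) m φ).2 = φ.2 := by
  have h := avg_intertwine (s := swapOp n C) (s' := fun _ => 1) (n := m)
    (LinearMap.snd K (List (Letter E) → A) K) (fun i hi x => rfl) φ
  exact h.trans (avg_apply_eq_of_fixed (fun _ _ => rfl))

/-- This is `mul_avg` evaluated at a word: the average is a fixed point of every affine exchange. It
is the source of the exchange rule in the enveloping algebra. -/
lemma symmetrize_append [CharZero K] {n : ℕ} {C : ℕ → List (Letter E) → A} (hC : IsCocycle n C)
    (π : List (Letter E) → A) {a b : List (Letter E)} {x y : Letter E}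
    (h : (a ++ x :: y :: b).length = n) :
    symmetrize n C π (a ++ x :: y :: b) = koszul x y • symmetrize n C π (a ++ y :: x :: b) +
      C a.length (a ++ x :: y :: b) := by
  have h₁ := mul_avg (K := K) hC.isCoxeter (i := a.length) (by simp at h; omega)
  have h₂ := congrArg (fun T => (T (π, 1)).1 (a ++ x :: y :: b)) h₁
  simp only [Module.End.mul_apply] at h₂
  rw [swapOp_append _ _ _ h, avg_swapOp_snd, one_smul] at h₂
  exact h₂.symm

lemma symmetrize_mem_of_swapOp (p : Submodule K (List (Letter E) → A)) {n : ℕ}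
    {C : ℕ → List (Letter E) → A}
    (h : ∀ i, i + 1 < n → ∀ φ ∈ p, ∀ c : K, (swapOp n C i (φ, c)).1 ∈ p)
    {π : List (Letter E) → A} (hπ : π ∈ p) : symmetrize n C π ∈ p :=
  avg_apply_mem (p.comap (LinearMap.fst K _ K)) (fun i hi x hx => h i hi x.1 hx x.2) hπ

variable (A E) in
/-- The multilinear functions on words. -/
def multilinearSubmodule : Submodule K (List (Letter E) → A) where
  carrier := {φ | IsMultilinear φ}
  zero_mem' _ _ _ := (0 : _ →ₗ[K] A).isLinear
  add_mem' h h' a b p := ((h a b p).mk' _ + (h' a b p).mk' _).isLinear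
  smul_mem' c _ h a b p := (c • (h a b p).mk' _).isLinear

lemma isLinearMap_sign_smul {M : Type*} [AddCommGroup M] [Module K M] {f : M → A}
    (h : IsLinearMap K f) (e : ℤˣ) : IsLinearMap K fun x => e • f x :=
  ⟨fun x y => by rw [h.map_add, smul_add], fun c x => by rw [h.map_smul, smul_comm]⟩

lemma isMultilinear_symmetrize {n : ℕ} {C : ℕ → List (Letter E) → A}
    (hC : ∀ i, i + 1 < n → IsMultilinear (C i)) {π : List (Letter E) → A}
    (hπ : IsMultilinear π) : IsMultilinear (symmetrize n C π) := by
  refine symmetrize_mem_of_swapOp (multilinearSubmodule E A) (fun i hi φ hφ c => ?_) hπ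
  intro a b p
  by_cases hn : (a ++ ⟨p, 0⟩ :: b : List (Letter E)).length = n
  · have hn' : ∀ x : E.X p, (a ++ ⟨p, x⟩ :: b).length = n := fun x => by simpa using hn
    obtain ⟨a', b', e, h⟩ := exists_swapAt_insert i a b p
    have h₁ : (fun x : E.X p => (swapOp n C i (φ, c)).1 (a ++ ⟨p, x⟩ :: b)) =
        fun x => e • φ (a' ++ ⟨p, x⟩ :: b') + c • C i (a ++ ⟨p, x⟩ :: b) := by
      funext x
      rw [swapOp_fst _ _ _ _ (hn' x), (h x).1, (h x).2]
    rw [h₁]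
    exact ((isLinearMap_sign_smul (hφ a' b' p) e).mk' _ + c • (hC i hi a b p).mk' _).isLinear
  · have hn' : ∀ x : E.X p, (a ++ ⟨p, x⟩ :: b).length ≠ n := fun x => by simpa using hn
    have h₁ : (fun x : E.X p => (swapOp n C i (φ, c)).1 (a ++ ⟨p, x⟩ :: b)) =
        fun x => φ (a ++ ⟨p, x⟩ :: b) := funext fun x => swapOp_fst_of_ne _ _ _ _ (hn' x)
    rw [h₁]
    exact hφ a b p

lemma sign_smul_mem {M : Type*} [AddCommGroup M] [Module K M] (p : Submodule K M) (e : ℤˣ) {x : M}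
    (h : x ∈ p) : e • x ∈ p := by
  obtain rfl | rfl := Int.units_eq_one_or e <;> simpa using h

lemma symmetrize_mem_grading {n : ℕ} {C : ℕ → List (Letter E) → A} (G : ℤ → Submodule K A)
    (hC : ∀ i, i + 1 < n → ∀ w, C i w ∈ G (wordDeg w)) {π : List (Letter E) → A}
    (hπ : ∀ w, π w ∈ G (wordDeg w)) (w : List (Letter E)) :
    symmetrize n C π w ∈ G (wordDeg w) := by
  refine symmetrize_mem_of_swapOp (Submodule.pi Set.univ fun w => G (wordDeg w))
    (fun i hi φ hφ c w _ => ?_) (fun w _ => hπ w) w trivial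
  by_cases hn : w.length = n
  · rw [swapOp_fst _ _ _ _ hn]
    refine add_mem (sign_smul_mem _ _ ?_) (Submodule.smul_mem _ _ (hC i hi w))
    change φ (swapAt i w) ∈ G (wordDeg w)
    rw [← wordDeg_swapAt i w]
    exact hφ _ trivial
  · rw [swapOp_fst_of_ne _ _ _ _ hn]
    exact hφ w trivial

/-- Symmetrization is compatible with linear maps which commute with exchanges of letters. -/
lemma symmetrize_intertwine {E' : Ch K} {A' : Type*} [AddCommGroup A'] [Module K A'] {n n' m : ℕ}
    {C : ℕ → List (Letter E) → A} {C' : ℕ → List (Letter E') → A'}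
    (J : (List (Letter E) → A) →ₗ[K] (List (Letter E') → A'))
    (h : ∀ i, i + 1 < m → ∀ φ (c : K),
      J ((swapOp n C i (φ, c)).1) = (swapOp n' C' i (J φ, c)).1)
    (φ : (List (Letter E) → A) × K) :
    J (avg K (swapOp n C) m φ).1 = (avg K (swapOp n' C') m (J φ.1, φ.2)).1 :=
  congrArg Prod.fst (avg_intertwine (s := swapOp n C) (s' := swapOp n' C') (n := m)
    (J.prodMap LinearMap.id) (fun i hi x => Prod.ext (h i hi x.1 x.2) rfl) φ)

/-- Symmetrization only depends on the values on words of the given length. -/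
lemma symmetrize_congr {n : ℕ} (C : ℕ → List (Letter E) → A) {π π' : List (Letter E) → A}
    (h : ∀ w, w.length = n → π w = π' w) {w : List (Letter E)} (hw : w.length = n) :
    symmetrize n C π w = symmetrize n C π' w := by
  -- `J` erases the values on words of other lengths; it commutes with all exchanges because they
  -- preserve length.
  let J : (List (Letter E) → A) →ₗ[K] (List (Letter E) → A) :=
    LinearMap.pi fun w => if w.length = n then LinearMap.proj w else 0
  have hJ : ∀ φ (w : List (Letter E)), J φ w = if w.length = n then φ w else 0 := by
    intro φ w
    simp only [J, LinearMap.pi_apply]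
    split_ifs <;> rfl
  have hJs : ∀ i φ (c : K), J ((swapOp n C i (φ, c)).1) = (swapOp n C i (J φ, c)).1 := by
    intro i φ c
    funext w
    rw [hJ]
    split_ifs with hw
    · rw [swapOp_fst _ _ _ _ hw, swapOp_fst _ _ _ _ hw]
      dsimp only
      rw [hJ, if_pos ((length_swapAt i w).trans hw)]
    · rw [swapOp_fst_of_ne _ _ _ _ hw]
      dsimp only
      rw [hJ, if_neg hw]
  have h₁ : ∀ π, symmetrize n C π w = symmetrize n C (J π) w := fun π => by
    have := congrFun (symmetrize_intertwine J (m := n) (fun i _ => hJs i) (π, 1)) w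
    rwa [hJ, if_pos hw] at this
  rw [h₁ π, h₁ π']
  congr 1
  funext w
  rw [hJ, hJ]
  split_ifs with hw
  · exact h w hw
  · rfl

lemma symmetrize_comp {A' : Type*} [AddCommGroup A'] [Module K A'] (n : ℕ) (g : A →ₗ[K] A')
    (π : List (Letter E) → A) (w : List (Letter E)) :
    g (symmetrize n 0 π w) = symmetrize n 0 (fun w => g (π w)) w := by
  refine congrFun (symmetrize_intertwine (C := 0) (C' := 0) (g.compLeft _) (m := n)
    (fun i hi φ c => ?_) (π, 1)) w
  funext w
  change g _ = _
  by_cases hw : w.length = n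
  · rw [swapOp_fst _ _ _ _ hw, swapOp_fst _ _ _ _ hw]
    simp
  · rw [swapOp_fst_of_ne _ _ _ _ hw, swapOp_fst_of_ne _ _ _ _ hw]
    rfl

lemma signAt_map {E' : Ch K} (f : E ⟶ E') (i : ℕ) (w : List (Letter E)) :
    signAt i (w.map fun x => (⟨x.1, f.f x.1 x.2⟩ : Letter E')) = signAt i w := by
  induction w generalizing i with
  | nil => cases i <;> rfl
  | cons x l ih =>
    cases i with
    | zero => cases l <;> rfl
    | succ i => exact ih i

/-- A chain map preserves the degrees of letters, hence all Koszul signs. -/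
lemma symmetrize_map {E' : Ch K} (f : E ⟶ E') (n : ℕ) (π : List (Letter E') → A)
    (w : List (Letter E)) :
    symmetrize n 0 π (w.map fun x => (⟨x.1, f.f x.1 x.2⟩ : Letter E')) =
      symmetrize n 0 (fun w => π (w.map fun x => (⟨x.1, f.f x.1 x.2⟩ : Letter E'))) w := by
  refine congrFun (symmetrize_intertwine (C := 0) (C' := 0) (LinearMap.funLeft K A
    (fun w : List (Letter E) => w.map fun x => (⟨x.1, f.f x.1 x.2⟩ : Letter E'))) (m := n)
    (fun i hi φ c => ?_) (π, 1)) w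
  funext w
  rw [LinearMap.funLeft_apply]
  by_cases hw : w.length = n
  · rw [swapOp_fst _ _ _ _ hw, swapOp_fst _ _ _ _ (by simpa using hw), signAt_map, swapAt_map]
    rfl
  · rw [swapOp_fst_of_ne _ _ _ _ hw, swapOp_fst_of_ne _ _ _ _ (by simpa using hw)]
    rfl

lemma symmetrize_of_symmetric [CharZero K] {n : ℕ} {π : List (Letter E) → A}
    (h : ∀ (a : List (Letter E)) (x y : Letter E) (b : List (Letter E)),
      (a ++ x :: y :: b).length = n → π (a ++ x :: y :: b) = koszul x y • π (a ++ y :: x :: b))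
    (w : List (Letter E)) : symmetrize n 0 π w = π w := by
  refine congrFun (congrArg Prod.fst (avg_apply_eq_of_fixed (K := K) (n := n)
    (s := swapOp n (0 : ℕ → List (Letter E) → A)) (x := (π, 1)) fun i hi => ?_)) w
  refine Prod.ext (funext fun w => ?_) rfl
  by_cases hw : w.length = n
  · obtain ⟨a, x, y, b, rfl, rfl⟩ := exists_eq_append_cons_cons (hw ▸ hi)
    rw [swapOp_append _ _ _ hw]
    simp [h a x y b hw]
  · rw [swapOp_fst_of_ne _ _ _ _ hw]

/-- Symmetrization removes antisymmetric correction terms. -/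
lemma symmetrize_symmetrize [CharZero K] {n : ℕ} {C : ℕ → List (Letter E) → A}
    (hC : IsCocycle n C) (π : List (Letter E) → A) (w : List (Letter E)) :
    symmetrize n 0 (symmetrize n C π) w = symmetrize n 0 π w := by
  set N := avg K (swapOp n (0 : ℕ → List (Letter E) → A)) n with hN
  -- `J` sets the second component to zero and so switches the corrections off.
  let J : (List (Letter E) → A) × K →ₗ[K] (List (Letter E) → A) × K :=
    (LinearMap.inl K _ K).comp (LinearMap.fst K _ K)
  have hJ : ∀ φ, J φ = (φ.1, 0) := fun _ => rfl
  have hNJ : ∀ φ, (N (J φ)).1 = (N φ).1 := fun φ => by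
    have h := avg_intertwine (s := swapOp n (0 : ℕ → List (Letter E) → A))
      (s' := swapOp n 0) (n := n) J (fun i hi x => ?_) φ
    · rw [← h]; rfl
    · rw [hJ, hJ]
      refine Prod.ext (funext fun w => ?_) rfl
      by_cases hw : w.length = n
      · simp [swapOp_fst _ _ _ _ hw]
      · simp [swapOp_fst_of_ne _ _ _ _ hw]
  -- After `J`, a corrected exchange differs from the plain one by a multiple of the correction
  -- itself.
  have hD : ∀ i, i + 1 < n → ∀ φ, J (swapOp n C i φ) =
      swapOp n 0 i (J φ) + φ.2 • ((fun w => if w.length = n then C i w else 0), 0) := by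
    intro i hi φ
    refine Prod.ext (funext fun w => ?_) (by simp [hJ, swapOp_snd])
    rw [hJ, hJ]
    by_cases hw : w.length = n
    · simp [swapOp_fst _ _ _ _ hw, hw]
    · simp [swapOp_fst_of_ne _ _ _ _ hw, hw]
  -- The correction is negated by the plain exchange `i`, which `N` absorbs; so `N` takes it to its
  -- own negative, hence to zero.
  have hN0 : ∀ i, i + 1 < n → N ((fun w => if w.length = n then C i w else 0), 0) = 0 := by
    intro i hi
    set c : (List (Letter E) → A) × K := ((fun w => if w.length = n then C i w else 0), 0) with hc
    have h₁ : swapOp n 0 i c = -c := by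
      refine Prod.ext (funext fun w => ?_) (by simp [swapOp_snd, hc])
      by_cases hw : w.length = n
      · obtain ⟨a, x, y, b, rfl, rfl⟩ := exists_eq_append_cons_cons (hw ▸ hi)
        have hw' : (a ++ y :: x :: b).length = n := by simpa using hw
        rw [swapOp_append _ _ _ hw]
        simp only [hc, Pi.zero_apply, smul_zero, add_zero, Prod.fst_neg, Pi.neg_apply]
        rw [if_pos hw, if_pos hw', eq_neg_iff_add_eq_zero]
        exact hC.antisymm a x y b hw
      · rw [swapOp_fst_of_ne _ _ _ _ hw]
        simp [hc, hw]
    have h₂ : N (swapOp n 0 i c) = N c := by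
      rw [← Module.End.mul_apply, hN, avg_mul (isCocycle_zero n).isCoxeter hi]
    rw [h₁, map_neg, neg_eq_iff_add_eq_zero, ← two_smul K, smul_eq_zero] at h₂
    exact h₂.resolve_left two_ne_zero
  -- `N ∘ J` is therefore unchanged by every corrected exchange, and so by their average.
  have key := avg_intertwine (s := swapOp n C) (s' := fun _ => 1) (n := n) (N.comp J)
    (fun i hi φ => by
      rw [LinearMap.comp_apply, hD i hi, map_add, map_smul, hN0 i hi, smul_zero, add_zero,
        ← Module.End.mul_apply, hN, avg_mul (isCocycle_zero n).isCoxeter hi]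
      rfl) (π, 1)
  rw [avg_apply_eq_of_fixed (s := fun _ => 1) (fun _ _ => rfl)] at key
  have h₃ := congrArg (fun φ : (List (Letter E) → A) × K => φ.1 w) key
  simp only [LinearMap.comp_apply, hNJ] at h₃
  refine Eq.trans ?_ h₃
  change (N (symmetrize n C π, 1)).1 w = _
  rw [← hNJ, ← hNJ (avg K (swapOp n C) n (π, 1))]
  rfl

/-- Moving a letter `u` of degree zero, which does not interact with other letters, from position
`j` to position `j + k` of a word. -/
lemma cyc_swapOp_unit {n : ℕ} {C : ℕ → List (Letter E) → A} {u : E.X 0}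
    {π : List (Letter E) → A} (hπ : ∀ a b, π (a ++ ⟨0, u⟩ :: b) = π (a ++ b))
    (hC : ∀ a y b, (a ++ ⟨0, u⟩ :: y :: b : List (Letter E)).length = n →
      C a.length (a ++ ⟨0, u⟩ :: y :: b) = 0) (k : ℕ) (a l : List (Letter E)) (hk : k ≤ l.length)
    (hn : (a ++ ⟨0, u⟩ :: l).length = n) :
    (cyc (fun i => swapOp n C (a.length + i)) k (π, (1 : K))).1 (a ++ ⟨0, u⟩ :: l) = π (a ++ l) := by
  induction k generalizing a l with
  | zero => exact hπ a l
  | succ k ih =>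
    match l, hk with
    | y :: l, hk =>
      rw [cyc, Module.End.mul_apply]
      refine (swapOp_append n C _ hn).trans ?_
      rw [hC a y l hn, smul_zero, add_zero]
      have h := ih (a ++ [y]) l (by simpa using hk) (by simp at hn ⊢; omega)
      simp only [List.append_assoc, List.singleton_append, List.length_append, List.length_cons,
        List.length_nil] at h
      have e : (fun i => swapOp n C (a.length + (i + 1))) =
          fun i => swapOp n C (a.length + (0 + 1) + i) := by
        funext i; congr 1; omega
      rw [e, h]
      -- The letter `u` has degree zero, so it passes `y` without a sign.
      simp [koszul]

lemma cyc_swapOp_of_ne {n : ℕ} {C : ℕ → List (Letter E) → A} (j k : ℕ)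
    (φ : (List (Letter E) → A) × K) {w : List (Letter E)} (hw : w.length ≠ n) :
    (cyc (fun i => swapOp n C (j + i)) k φ).1 w = φ.1 w := by
  induction k with
  | zero => rfl
  | succ k ih => 
    rw [cyc, Module.End.mul_apply, swapOp_fst_of_ne _ _ _ _ hw]
    clear ih
    induction k generalizing j with
    | zero => rfl
    | succ k ih =>
      rw [cyc, Module.End.mul_apply, swapOp_fst_of_ne _ _ _ _ hw]
      have e : (fun i => swapOp n C (j + (i + 1 + 1))) = fun i => swapOp n C ((j + 1) + (i + 1)) := by
        funext i; congr 1; omega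
      rw [e]
      exact ih (j + 1)

/-- Symmetrization is compatible with inserting a unit. -/
lemma symmetrize_unit [CharZero K] {n : ℕ} {C C' : ℕ → List (Letter E) → A} {u : E.X 0}
    {π : List (Letter E) → A} (hπ : ∀ a b, π (a ++ ⟨0, u⟩ :: b) = π (a ++ b))
    (hC : ∀ a y b, (a ++ ⟨0, u⟩ :: y :: b : List (Letter E)).length = n + 1 →
      C a.length (a ++ ⟨0, u⟩ :: y :: b) = 0)
    (hC' : ∀ i t, i + 1 < n → t.length = n → C (i + 1) (⟨0, u⟩ :: t) = C' i t)
    (t : List (Letter E)) :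
    symmetrize (n + 1) C π (⟨0, u⟩ :: t) = symmetrize n C' π t := by
  let J : (List (Letter E) → A) × K →ₗ[K] (List (Letter E) → A) × K :=
    (LinearMap.funLeft K A (fun t => (⟨0, u⟩ : Letter E) :: t)).prodMap LinearMap.id
  -- Putting `u` in front turns the exchanges of the remaining letters, shifted by one position,
  -- into the exchanges on words of length `n`.
  have h₁ := avg_intertwine (s := fun i => swapOp (n + 1) C (i + 1)) (s' := swapOp n C') (n := n)
    J (fun i hi φ => by
      refine Prod.ext (funext fun w => ?_) rfl
      change (swapOp (n + 1) C (i + 1) φ).1 (⟨0, u⟩ :: w) = _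
      by_cases hw : w.length = n
      · rw [swapOp_fst _ _ _ _ (by simpa using hw), swapOp_fst _ _ _ _ hw, hC' i w hi hw]
        rfl
      · rw [swapOp_fst_of_ne _ _ _ _ (by simpa using hw), swapOp_fst_of_ne _ _ _ _ hw]
        rfl)
  have hn : (n + 1 : K) ≠ 0 := by exact_mod_cast Nat.succ_ne_zero n
  -- The coset term `k` carries the leading `u` to position `k`, where `π` ignores it. All `n + 1`
  -- terms thus agree, and their mean is their common value.
  have hc : ∀ k ∈ Finset.range (n + 1), J (cyc (swapOp (n + 1) C) k (π, 1)) = (π, 1) := by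
    intro k hk
    rw [Finset.mem_range] at hk
    refine Prod.ext (funext fun w => ?_) ?_
    · change (cyc (swapOp (n + 1) C) k (π, 1)).1 (⟨0, u⟩ :: w) = π w
      have e : swapOp (n + 1) C = fun i => swapOp (n + 1) C (0 + i) := by
        funext i; rw [zero_add]
      rw [e]
      by_cases hw : w.length = n
      · exact cyc_swapOp_unit hπ hC k [] w (by omega) (by simpa using hw)
      · exact (cyc_swapOp_of_ne 0 k (π, 1) (by simpa using hw)).trans (hπ [] w)
    · change (cyc (swapOp (n + 1) C) k (π, (1 : K))).2 = 1
      exact (cyc_intertwine (s := swapOp (n + 1) C) (s' := fun _ => 1) (k := k)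
        (LinearMap.snd K (List (Letter E) → A) K) (fun i hi x => rfl) (π, 1)).trans (by
          have : cyc (fun _ => (1 : Module.End K K)) k = 1 := by
            clear hk
            induction k with
            | zero => rfl
            | succ k ih => rw [cyc_succ, ih, mul_one]
          rw [this]; rfl)
  change (J (avg K (swapOp (n + 1) C) (n + 1) (π, 1))).1 t = _
  rw [avg, Module.End.mul_apply, h₁]
  simp only [LinearMap.smul_apply, LinearMap.sum_apply]
  rw [map_smul, map_sum, Finset.sum_congr rfl hc, Finset.sum_const, Finset.card_range,
    ← Nat.cast_smul_eq_nsmul K, smul_smul, Nat.cast_succ, inv_mul_cancel₀ hn, one_smul]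
  rfl

end Symmetrization

/-! ### Linear maps out of the enveloping algebra as functions on words -/

section EnvFun

variable {K : Type u} [Field K] (V : ULie K) {A : Type*} [AddCommGroup A] [Module K A]

/-- The bracket of two homogeneous elements. -/
def ULie.br (x y : Letter V.cpx) : Letter V.cpx := ⟨x.1 + y.1, V.bracket rfl x.2 y.2⟩

lemma ULie.br_mk {p q n : ℤ} (h : p + q = n) (x : V.cpx.X p) (y : V.cpx.X q) :
    V.br ⟨p, x⟩ ⟨q, y⟩ = ⟨n, V.bracket h x y⟩ := by
  subst h; rfl

lemma ULie.unit_bracket {p n : ℤ} (h : 0 + p = n) (x : V.cpx.X p) : V.bracket h V.unit x = 0 := by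
  rw [V.bracket_antisymm h (by omega : p + 0 = n), V.bracket_unit]
  simp

/-- The product in the enveloping algebra of the letters of a word. -/
def ULie.word (w : List (Letter V.cpx)) : V.Env := (w.map fun x => V.gen x.1 x.2).prod

@[simp] lemma ULie.word_nil : V.word [] = 1 := rfl

lemma ULie.word_cons (x : Letter V.cpx) (w : List (Letter V.cpx)) :
    V.word (x :: w) = V.gen x.1 x.2 * V.word w := by simp [ULie.word]

lemma ULie.word_append (w w' : List (Letter V.cpx)) :
    V.word (w ++ w') = V.word w * V.word w' := by simp [ULie.word]

lemma ULie.isMultilinear_word : IsMultilinear V.word := fun a b p => by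
  simp only [V.word_append, V.word_cons]
  exact ((LinearMap.mulLeft K (V.word a)).comp ((LinearMap.mulRight K (V.word b)).comp
    (V.gen p))).isLinear

lemma ULie.word_unit (a b : List (Letter V.cpx)) :
    V.word (a ++ ⟨0, V.unit⟩ :: b) = V.word (a ++ b) := by
  simp only [V.word_append, V.word_cons]
  rw [V.gen_unit, one_mul]

lemma ULie.word_exchange (a : List (Letter V.cpx)) (x y : Letter V.cpx) (b : List (Letter V.cpx)) :
    V.word (a ++ x :: y :: b) = koszul x y • V.word (a ++ y :: x :: b) +
      V.word (a ++ V.br x y :: b) := by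
  simp only [V.word_append, V.word_cons]
  rw [ULie.br, V.gen_bracket, sub_mul, mul_sub, sign_mul_left, sign_mul_right, mul_assoc, mul_assoc]
  exact (add_sub_cancel _ _).symm

lemma ULie.span_word : Submodule.span K (Set.range V.word) = ⊤ := by
  refine Submodule.eq_top_iff'.2 fun z => ?_
  induction z using ULie.Env.induction with
  | scalar k =>
    rw [Algebra.algebraMap_eq_smul_one]
    exact Submodule.smul_mem _ _ (Submodule.subset_span ⟨[], rfl⟩)
  | gen p x => exact Submodule.subset_span ⟨[⟨p, x⟩], by simp [V.word_cons]⟩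
  | mul a b ha hb =>
    induction ha using Submodule.span_induction with
    | mem a ha =>
      obtain ⟨w, rfl⟩ := ha
      induction hb using Submodule.span_induction with
      | mem b hb =>
        obtain ⟨w', rfl⟩ := hb
        exact Submodule.subset_span ⟨w ++ w', V.word_append w w'⟩
      | zero => simp
      | add x y _ _ hx hy => rw [mul_add]; exact add_mem hx hy
      | smul c x _ hx => rw [mul_smul_comm]; exact Submodule.smul_mem _ _ hx
    | zero => simp
    | add x y _ _ hx hy => rw [add_mul]; exact add_mem hx hy
    | smul c x _ hx => rw [smul_mul_assoc]; exact Submodule.smul_mem _ _ hx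
  | add a b ha hb => exact add_mem ha hb

variable {V} in
lemma ULie.env_hom_ext {f g : V.Env →ₗ[K] A} (h : ∀ w, f (V.word w) = g (V.word w)) : f = g :=
  LinearMap.ext_on V.span_word (by rintro _ ⟨w, rfl⟩; exact h w)

lemma ULie.isWord_iff {n : ℤ} {a : V.Env} :
    V.IsWord n a ↔ ∃ w, wordDeg w = n ∧ V.word w = a := by
  constructor
  · intro h
    induction h with
    | one => exact ⟨[], rfl, rfl⟩
    | @cons p q n h x a _ ih =>
      obtain ⟨w, hw, rfl⟩ := ih
      exact ⟨⟨p, x⟩ :: w, by rw [← h, ← hw]; rfl, V.word_cons _ _⟩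
  · rintro ⟨w, rfl, rfl⟩
    induction w with
    | nil => exact .one
    | cons x w ih => rw [V.word_cons]; exact .cons rfl x.2 ih

lemma ULie.word_mem_grade (w : List (Letter V.cpx)) : V.word w ∈ V.grade (wordDeg w) :=
  (V.isWord_iff.2 ⟨w, rfl, rfl⟩).mem_grade

variable {V} in
lemma ULie.grade_le_of_word {n : ℤ} {S : Submodule K V.Env}
    (h : ∀ w, wordDeg w = n → V.word w ∈ S) : V.grade n ≤ S :=
  V.grade_le fun a ha => by
    obtain ⟨w, hw, rfl⟩ := V.isWord_iff.1 ha
    exact h w hw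

variable (A) in
/-- The functions on words which descend to linear maps on the enveloping algebra. -/
def ULie.envFun : Submodule K (List (Letter V.cpx) → A) where
  carrier := {φ | IsMultilinear φ ∧
    (∀ a x y b, φ (a ++ x :: y :: b) = koszul x y • φ (a ++ y :: x :: b) +
      φ (a ++ V.br x y :: b)) ∧ ∀ a b, φ (a ++ ⟨0, V.unit⟩ :: b) = φ (a ++ b)}
  zero_mem' := ⟨(multilinearSubmodule V.cpx A).zero_mem, by simp, by simp⟩
  add_mem' {φ ψ} h h' := ⟨(multilinearSubmodule V.cpx A).add_mem h.1 h'.1, fun a x y b => by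
      rw [Pi.add_apply, Pi.add_apply, Pi.add_apply, h.2.1, h'.2.1, smul_add]; abel,
    fun a b => by rw [Pi.add_apply, Pi.add_apply, h.2.2, h'.2.2]⟩
  smul_mem' c φ h := ⟨(multilinearSubmodule V.cpx A).smul_mem c h.1, fun a x y b => by
      rw [Pi.smul_apply, Pi.smul_apply, Pi.smul_apply, h.2.1, smul_add, smul_comm c],
    fun a b => by rw [Pi.smul_apply, Pi.smul_apply, h.2.2]⟩

variable (A) in
/-- The action of the homogeneous elements on `V.envFun A` by appending letters. -/
def ULie.appendLetter (p : ℤ) : V.cpx.X p →ₗ[K] Module.End K (V.envFun A) :=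
  LinearMap.mk₂ K (fun x φ => ⟨fun w => φ.1 (w ++ [⟨p, x⟩]), fun a b q => by
      simpa only [List.append_assoc, List.cons_append] using φ.2.1 a (b ++ [⟨p, x⟩]) q,
    fun a y z b => by
      simpa only [List.append_assoc, List.cons_append] using φ.2.2.1 a y z (b ++ [⟨p, x⟩]),
    fun a b => by
      simpa only [List.append_assoc, List.cons_append] using φ.2.2.2 a (b ++ [⟨p, x⟩])⟩)
    (fun x y φ => Subtype.ext (funext fun w => (φ.2.1 w [] p).map_add x y))
    (fun c x φ => Subtype.ext (funext fun w => (φ.2.1 w [] p).map_smul c x))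
    (fun _ _ _ => rfl) (fun _ _ _ => rfl)

lemma ULie.appendLetter_apply {p : ℤ} (x : V.cpx.X p) (φ : V.envFun A)
    (w : List (Letter V.cpx)) : (V.appendLetter A p x φ).1 w = φ.1 (w ++ [⟨p, x⟩]) := rfl

lemma envFun_sign_smul (e : ℤˣ) (φ : V.envFun A) (w : List (Letter V.cpx)) :
    (e • φ).1 w = e • φ.1 w := by
  obtain rfl | rfl := Int.units_eq_one_or e <;> simp

variable (A) in
lemma ULie.appendLetter_bracket {p q n : ℤ} (h : p + q = n) (x : V.cpx.X p) (y : V.cpx.X q) :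
    V.appendLetter A n (V.bracket h x y) = V.appendLetter A p x * V.appendLetter A q y -
      (p * q).negOnePow • (V.appendLetter A q y * V.appendLetter A p x) := by
  refine LinearMap.ext fun φ => Subtype.ext (funext fun w => ?_)
  rw [LinearMap.sub_apply, sign_smul_apply, Module.End.mul_apply, Module.End.mul_apply]
  change _ = (V.appendLetter A p x (V.appendLetter A q y φ)).1 w -
    ((p * q).negOnePow • (V.appendLetter A q y (V.appendLetter A p x φ))).1 w
  rw [envFun_sign_smul]
  simp only [V.appendLetter_apply, List.append_assoc, List.cons_append, List.nil_append]
  rw [φ.2.2.1 w ⟨p, x⟩ ⟨q, y⟩ [], V.br_mk h]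
  exact (add_sub_cancel_left _ _).symm

variable (A) in
lemma ULie.appendLetter_unit : V.appendLetter A 0 V.unit = 1 :=
  LinearMap.ext fun φ => Subtype.ext (funext fun w => by
    rw [V.appendLetter_apply, φ.2.2.2, List.append_nil]; rfl)

variable (A) in
/-- The action of the enveloping algebra on `V.envFun A`. -/
def ULie.envFunAction : V.Env →ₐ[K] Module.End K (V.envFun A) :=
  ULie.Env.lift V (B := Module.End K (V.envFun A)) (V.appendLetter A) (V.appendLetter_bracket A)
    (V.appendLetter_unit A)

lemma ULie.envFunAction_gen {p : ℤ} (x : V.cpx.X p) :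
    V.envFunAction A (V.gen p x) = V.appendLetter A p x := by
  rw [ULie.envFunAction, ULie.Env.lift_gen]

/-- The linear map on the enveloping algebra induced by a function on words. -/
def ULie.descend (φ : V.envFun A) : V.Env →ₗ[K] A :=
  -- The algebra acts on `φ` by appending letters, and the result is evaluated at the empty word.
  (LinearMap.proj (R := K) (φ := fun _ : List (Letter V.cpx) => A) []).comp
    ((V.envFun A).subtype.comp ((LinearMap.applyₗ φ).comp (V.envFunAction A).toLinearMap))

lemma ULie.descend_word (φ : V.envFun A) (w : List (Letter V.cpx)) :
    V.descend φ (V.word w) = φ.1 w := by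
  -- The induction transfers letters from `w` to the prefix, so all prefixes `v` have to be treated
  -- together.
  suffices h : ∀ v, (V.envFunAction A (V.word w) φ).1 v = φ.1 (v ++ w) from h []
  induction w with
  | nil => intro v; rw [V.word_nil, map_one, List.append_nil]; rfl
  | cons x w ih =>
    intro v
    rw [V.word_cons, map_mul, Module.End.mul_apply, V.envFunAction_gen,
      V.appendLetter_apply]
    refine (ih _).trans ?_
    rw [List.append_assoc]
    rfl

-- A unit in the middle of a word moves to the front by the exchange rule: each step costs the
-- bracket with the unit, which vanishes, and no sign. Hence only the leading position has to be
-- checked.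
variable {V} in
lemma ULie.mem_envFun {φ : List (Letter V.cpx) → A} (h₁ : IsMultilinear φ)
    (h₂ : ∀ a x y b, φ (a ++ x :: y :: b) = koszul x y • φ (a ++ y :: x :: b) +
      φ (a ++ V.br x y :: b)) (h₃ : ∀ b, φ (⟨0, V.unit⟩ :: b) = φ b) : φ ∈ V.envFun A := by
  refine ⟨h₁, h₂, fun a => ?_⟩
  induction a using List.reverseRecOn with
  | nil => exact h₃
  | append_singleton a y ih =>
    intro b
    have e : V.br y ⟨0, V.unit⟩ = ⟨y.1 + 0, 0⟩ := by
      rw [ULie.br, V.bracket_unit]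
    simp only [List.append_assoc, List.cons_append, List.nil_append]
    rw [h₂, e, h₁.map_zero, ih]
    simp [koszul]

lemma isMultilinear_glue {E : Ch K} {Q : ℕ → List (Letter E) → A}
    (h : ∀ n, IsMultilinear (Q n)) : IsMultilinear fun w => Q w.length w := by
  intro a b p
  have e : (fun x : E.X p => Q (a ++ ⟨p, x⟩ :: b).length (a ++ ⟨p, x⟩ :: b)) =
      fun x => Q (a.length + (b.length + 1)) (a ++ ⟨p, x⟩ :: b) := by
    funext x; simp
  rw [e]
  exact h _ a b p

end EnvFun

/-! ### Extension of functions of commuting letters to the enveloping algebra -/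

section Pbw

variable {K : Type u} [Field K] (V : ULie K) {A : Type*} [AddCommGroup A] [Module K A]

/-- Replace the letters at the positions `i` and `i + 1` of a word by their bracket. -/
def ULie.brAt : ℕ → List (Letter V.cpx) → List (Letter V.cpx)
  | 0, x :: y :: l => V.br x y :: l
  | i + 1, x :: l => x :: ULie.brAt i l
  | _, l => l

lemma ULie.brAt_append (a : List (Letter V.cpx)) (k : ℕ) (l : List (Letter V.cpx)) :
    V.brAt (a.length + k) (a ++ l) = a ++ V.brAt k l := by
  induction a with
  | nil => simp
  | cons x a ih => rw [List.length_cons, Nat.add_right_comm]; exact congrArg _ ih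

lemma ULie.brAt_length_append (a : List (Letter V.cpx)) (x y : Letter V.cpx)
    (b : List (Letter V.cpx)) : V.brAt a.length (a ++ x :: y :: b) = a ++ V.br x y :: b :=
  V.brAt_append a 0 (x :: y :: b)

lemma ULie.brAt_length_append_one (a : List (Letter V.cpx)) (x y z : Letter V.cpx)
    (b : List (Letter V.cpx)) :
    V.brAt (a.length + 1) (a ++ x :: y :: z :: b) = a ++ x :: V.br y z :: b :=
  V.brAt_append a 1 (x :: y :: z :: b)

lemma ULie.brAt_length_append_two (a : List (Letter V.cpx)) (x y : Letter V.cpx)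
    (b : List (Letter V.cpx)) (z t : Letter V.cpx) (c : List (Letter V.cpx)) :
    V.brAt (a.length + (b.length + 2)) (a ++ x :: y :: (b ++ z :: t :: c)) =
      a ++ x :: y :: (b ++ V.br z t :: c) := by
  rw [V.brAt_append]
  exact congrArg (fun l => a ++ x :: y :: l) (V.brAt_length_append b z t c)

lemma ULie.wordDeg_brAt (i : ℕ) (w : List (Letter V.cpx)) :
    wordDeg (V.brAt i w) = wordDeg w := by
  induction w generalizing i with
  | nil => cases i <;> rfl
  | cons x l ih =>
    cases i with
    | zero =>
      cases l with
      | nil => rfl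
      | cons y l => simp only [wordDeg, ULie.brAt, ULie.br, List.map_cons, List.sum_cons]; ring
    | succ i => exact congrArg (x.1 + ·) (ih i)

/-- Bracketing replaces the chosen letter by a linear function of it, the other letters being fixed;
multilinearity is thus preserved. -/
lemma ULie.exists_brAt_insert (i : ℕ) (a b : List (Letter V.cpx)) (p : ℤ) :
    ∃ (a' b' : List (Letter V.cpx)) (q : ℤ) (g : V.cpx.X p →ₗ[K] V.cpx.X q), ∀ x : V.cpx.X p,
      V.brAt i (a ++ ⟨p, x⟩ :: b) = a' ++ ⟨q, g x⟩ :: b' := by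
  induction i generalizing a with
  | zero =>
    match a, b with
    | [], [] => exact ⟨[], [], p, LinearMap.id, fun x => rfl⟩
    | [], y :: b => exact ⟨[], b, p + y.1, (V.bracket rfl).flip y.2, fun x => rfl⟩
    | [y], b => exact ⟨[], b, y.1 + p, V.bracket rfl y.2, fun x => rfl⟩
    | y :: z :: a, b => exact ⟨V.br y z :: a, b, p, LinearMap.id, fun x => rfl⟩
  | succ i ih =>
    match a with
    | [] => exact ⟨[], V.brAt i b, p, LinearMap.id, fun x => rfl⟩
    | y :: a =>
      obtain ⟨a', b', q, g, h⟩ := ih a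
      exact ⟨y :: a', b', q, g, fun x => congrArg (y :: ·) (h x)⟩

variable {V} in
lemma IsMultilinear.comp_brAt {φ : List (Letter V.cpx) → A} (h : IsMultilinear φ) (i : ℕ) :
    IsMultilinear fun w => φ (V.brAt i w) := by
  intro a b p
  obtain ⟨a', b', q, g, hg⟩ := V.exists_brAt_insert i a b p
  simp only [hg]
  exact (((h a' b' q).mk' _).comp g).isLinear

/-- The Jacobi identity in the form which says that bracketing with `x` is a graded derivation;
antisymmetry reorders the cyclic terms. -/
lemma ULie.bracket_leibniz {p q r pq qr pr n : ℤ} (hpq : p + q = pq) (hqr : q + r = qr)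
    (hpr : p + r = pr) (h₁ : p + qr = n) (h₂ : q + pr = n) (h₃ : pq + r = n)
    (x : V.cpx.X p) (y : V.cpx.X q) (z : V.cpx.X r) :
    V.bracket h₃ (V.bracket hpq x y) z + (p * q).negOnePow • V.bracket h₂ y (V.bracket hpr x z) =
      V.bracket h₁ x (V.bracket hqr y z) := by
  subst hpq
  have hrp : r + p = pr := by omega
  have h₃' : r + (p + q) = n := by omega
  have h := V.jacobi rfl hqr hrp h₁ h₂ h₃' x y z
  rw [V.bracket_antisymm h₃' h₃, V.bracket_antisymm hrp hpr, map_neg, map_sign_smul, smul_neg,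
    smul_neg, smul_smul, smul_smul, Int.units_mul_self, one_smul, ← Int.negOnePow_add] at h
  have e : (p * (q + r) + r * p).negOnePow = (p * q).negOnePow := by
    have : p * (q + r) + r * p = p * q + 2 * (p * r) := by ring
    rw [this, Int.negOnePow_add, Int.negOnePow_even (2 * (p * r)) ⟨p * r, by ring⟩, mul_one]
  rw [e, ← sub_eq_add_neg, ← sub_eq_add_neg, sub_eq_zero, sub_eq_iff_eq_add] at h
  rw [h, add_comm]

-- The iterated brackets have degrees `(p + q) + r`, `q + (p + r)` and `p + (q + r)`, equal only
-- propositionally; once they are placed in one degree, linearity of `φ` in that letter applies.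
variable {V} in
lemma IsMultilinear.br_leibniz {φ : List (Letter V.cpx) → A} (hφ : IsMultilinear φ)
    (a b : List (Letter V.cpx)) (x y z : Letter V.cpx) :
    φ (a ++ V.br (V.br x y) z :: b) + koszul x y • φ (a ++ V.br y (V.br x z) :: b) =
      φ (a ++ V.br x (V.br y z) :: b) := by
  obtain ⟨p, x⟩ := x
  obtain ⟨q, y⟩ := y
  obtain ⟨r, z⟩ := z
  have h₂ : q + (p + r) = p + (q + r) := by ring
  have h₃ : (p + q) + r = p + (q + r) := by ring
  rw [V.br_mk rfl x y, V.br_mk rfl x z, V.br_mk rfl y z, V.br_mk h₃, V.br_mk h₂, V.br_mk rfl x,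
    ← V.bracket_leibniz rfl rfl rfl rfl h₂ h₃, (hφ a b _).map_add]
  congr 1
  exact (map_sign_smul ((hφ a b (p + (q + r))).mk' _) _ _).symm

variable {V} in
/-- A function on words which exchanges letters up to the bracket gives rise to a cocycle. -/
lemma isCocycle_brAt {m : ℕ} {Q Q' : List (Letter V.cpx) → A} (hQ : IsMultilinear Q)
    (hQ' : IsMultilinear Q')
    (h : ∀ a x y b, (a ++ x :: y :: b).length = m → Q (a ++ x :: y :: b) =
      koszul x y • Q (a ++ y :: x :: b) + Q' (a ++ V.br x y :: b)) :
    IsCocycle (m + 1) fun i w => Q (V.brAt i w) where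
  antisymm a x y b _ := by
    simp only [V.brAt_length_append]
    obtain ⟨p, x⟩ := x
    obtain ⟨q, y⟩ := y
    have hqp : q + p = p + q := by ring
    rw [V.br_mk rfl x y, V.br_mk hqp, V.bracket_antisymm rfl hqp]
    set L := (hQ a b (p + q)).mk' _ with hL
    change koszul _ _ • L _ + L _ = 0
    rw [map_neg, map_sign_smul]
    exact add_neg_cancel _
  comm a x y b z t c hn := by
    simp only [V.brAt_length_append, V.brAt_length_append_two]
    -- After expansion, the value of `Q'` on the word with both pairs bracketed occurs once on each
    -- side.
    have h₁ := h a x y (b ++ V.br z t :: c) (by simp at hn ⊢; omega)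
    have h₂ := h (a ++ V.br x y :: b) z t c (by simp at hn ⊢; omega)
    simp only [List.append_assoc, List.cons_append] at h₁ h₂
    rw [h₁, h₂]
    abel
  braid a x y z b hn := by
    simp only [V.brAt_length_append, V.brAt_length_append_one]
    -- Moving each single bracket past the third letter leaves three double brackets under `Q'`,
    -- which cancel by the Jacobi identity.
    have h₁ := h a (V.br x y) z b (by simp at hn ⊢; omega)
    have h₂ := h a x (V.br y z) b (by simp at hn ⊢; omega)
    have h₃ := h a y (V.br x z) b (by simp at hn ⊢; omega)
    have h₄ := hQ'.br_leibniz a b x y z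
    have e₁ : koszul (V.br x y) z = koszul y z * koszul x z := by
      simp only [koszul, ULie.br, add_mul, Int.negOnePow_add]
      rw [mul_comm]
    have e₂ : koszul x (V.br y z) = koszul x y * koszul x z := by
      simp only [koszul, ULie.br, mul_add, Int.negOnePow_add]
    have e₃ : koszul y (V.br x z) = koszul x y * koszul y z := by
      rw [koszul_comm x y]
      simp only [koszul, ULie.br, mul_add, Int.negOnePow_add]
    rw [h₁, h₂, h₃, e₁, e₂, e₃, smul_add, smul_smul, ← mul_assoc, koszul_mul_self, one_mul, ← h₄]
    abel

/-- The components, on words of a given length, of the extension of a function `π` of commuting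
letters to a function on words which exchanges letters up to the bracket. -/
def ULie.pbwSeq (π : List (Letter V.cpx) → A) : ℕ → List (Letter V.cpx) → A
  | 0 => π
  | n + 1 => symmetrize (n + 1) (fun i w => ULie.pbwSeq π n (V.brAt i w)) π

variable {V} {π : List (Letter V.cpx) → A}

lemma ULie.isMultilinear_pbwSeq (hπ : IsMultilinear π) (n : ℕ) :
    IsMultilinear (V.pbwSeq π n) := by
  induction n with
  | zero => exact hπ
  | succ n ih => exact isMultilinear_symmetrize (fun i _ => ih.comp_brAt i) hπ

variable [CharZero K]

/-- The cocycle condition for one length gives, by averaging, the exchange rule for `V.pbwSeq π (n +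
1)`, and that rule is the hypothesis of `isCocycle_brAt` for the next length. At the start there is
nothing to exchange in the empty word. -/
lemma ULie.isCocycle_pbwSeq (hπ : IsMultilinear π) (n : ℕ) :
    IsCocycle (n + 1) fun i w => V.pbwSeq π n (V.brAt i w) := by
  induction n with
  | zero =>
    refine isCocycle_brAt (isMultilinear_pbwSeq hπ 0) (isMultilinear_pbwSeq hπ 0) ?_
    intro a x y b h
    simp at h
  | succ n ih =>
    refine isCocycle_brAt (isMultilinear_pbwSeq hπ _) (isMultilinear_pbwSeq hπ n) ?_
    intro a x y b h
    exact (symmetrize_append ih π h).trans (by rw [V.brAt_length_append]; rfl)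

lemma ULie.pbwSeq_exchange (hπ : IsMultilinear π) (n : ℕ) {a b : List (Letter V.cpx)}
    {x y : Letter V.cpx} (h : (a ++ x :: y :: b).length = n + 1) :
    V.pbwSeq π (n + 1) (a ++ x :: y :: b) = koszul x y • V.pbwSeq π (n + 1) (a ++ y :: x :: b) +
      V.pbwSeq π n (a ++ V.br x y :: b) :=
  (symmetrize_append (isCocycle_pbwSeq hπ n) π h).trans (by rw [V.brAt_length_append]; rfl)

/-- The corrections average to zero, so the symmetric part of the extension is that of `π`. This
makes the map built from it a left inverse of symmetrization. -/
lemma ULie.symmetrize_pbwSeq (hπ : IsMultilinear π) (n : ℕ) (w : List (Letter V.cpx)) :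
    symmetrize n 0 (V.pbwSeq π n) w = symmetrize n 0 π w := by
  cases n with
  | zero => rfl
  | succ n => exact symmetrize_symmetrize (isCocycle_pbwSeq hπ n) π w

lemma ULie.length_brAt {i : ℕ} {w : List (Letter V.cpx)} (h : i + 1 < w.length) :
    (V.brAt i w).length + 1 = w.length := by
  obtain ⟨a, x, y, b, rfl, rfl⟩ := exists_eq_append_cons_cons h
  rw [V.brAt_length_append]
  simp
  omega

/-- Corrections which bracket the unit with a neighbour vanish, and those among the other letters
are known by induction on the length; `symmetrize_unit` then removes the unit. -/
lemma ULie.pbwSeq_unit (hπ : IsMultilinear π)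
    (hu : ∀ a b, π (a ++ ⟨0, V.unit⟩ :: b) = π (a ++ b)) (n : ℕ) (t : List (Letter V.cpx)) 
    (ht : t.length = n) :
    V.pbwSeq π (n + 1) (⟨0, V.unit⟩ :: t) = V.pbwSeq π n t := by
  have hC : ∀ n, ∀ a y b, (a ++ ⟨0, V.unit⟩ :: y :: b : List (Letter V.cpx)).length = n + 1 →
      V.pbwSeq π n (V.brAt a.length (a ++ ⟨0, V.unit⟩ :: y :: b)) = 0 := by
    intro n a y b _
    have e : V.br ⟨0, V.unit⟩ y = ⟨0 + y.1, 0⟩ := by rw [ULie.br, V.unit_bracket]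
    rw [V.brAt_length_append, e]
    exact (isMultilinear_pbwSeq hπ n).map_zero _ _ _
  induction n generalizing t with
  | zero =>
    exact symmetrize_unit (n := 0) (C' := 0) hu (hC 0) (fun i t hi _ => by omega) t
  | succ n ih =>
    refine symmetrize_unit (C' := fun i w => V.pbwSeq π n (V.brAt i w)) hu (hC (n + 1))
      (fun i t hi ht => ?_) t
    refine ih (V.brAt i t) ?_
    have := ULie.length_brAt (V := V) (i := i) (w := t) (by omega)
    omega

/-- The extension of a function of commuting letters to a function on the enveloping algebra. -/
def ULie.pbwFun (hπ : IsMultilinear π)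
    (hu : ∀ a b, π (a ++ ⟨0, V.unit⟩ :: b) = π (a ++ b)) : V.envFun A :=
  ⟨fun w => V.pbwSeq π w.length w, mem_envFun (isMultilinear_glue (isMultilinear_pbwSeq hπ))
    (fun a x y b => by
      have e₁ : (a ++ x :: y :: b).length = a.length + (b.length + 1) + 1 := by simp; omega
      have e₂ : (a ++ y :: x :: b).length = a.length + (b.length + 1) + 1 := by simp; omega
      have e₃ : (a ++ V.br x y :: b).length = a.length + (b.length + 1) := by simp
      rw [e₁, e₂, e₃]
      exact pbwSeq_exchange hπ _ e₁)
    (fun b => pbwSeq_unit hπ hu _ b rfl)⟩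

end Pbw

/-! ### The symmetrization isomorphism -/

section SymIso

variable {K : Type u} [Field K]

/-- The abelian unital Lie algebra with the same underlying complex and unit. -/
abbrev ULie.ab (V : ULie K) : ULie K where
  cpx := V.cpx
  bracket _ := 0
  unit := V.unit
  d_bracket := by intros; simp
  d_unit := V.d_unit
  bracket_antisymm := by intros; simp
  jacobi := by intros; simp
  bracket_unit := by intros; simp

/-- The morphism of abelian unital Lie algebras underlying a morphism of unital Lie algebras. -/
abbrev ULie.abMap {V W : ULie K} (f : V ⟶ W) : V.ab ⟶ W.ab :=
  ULie.Hom.mk (V := V.ab) (W := W.ab) f.hom (by intros; simp) f.map_unit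

variable (V : ULie K)

lemma ULie.map_ab_br {A : Type*} [AddCommGroup A] [Module K A] {φ : List (Letter V.cpx) → A}
    (h : IsMultilinear φ) (a : List (Letter V.cpx)) (x y : Letter V.cpx)
    (b : List (Letter V.cpx)) : φ (a ++ V.ab.br x y :: b) = 0 := h.map_zero a b _

lemma ULie.ab_word_exchange (a : List (Letter V.cpx)) (x y : Letter V.cpx)
    (b : List (Letter V.cpx)) :
    V.ab.word (a ++ x :: y :: b) = koszul x y • V.ab.word (a ++ y :: x :: b) := by
  refine (V.ab.word_exchange a x y b).trans ?_
  rw [V.map_ab_br V.ab.isMultilinear_word, add_zero]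

variable [CharZero K]

/-- The function on words whose values are the symmetrized products in the enveloping algebra. -/
def ULie.symFun : V.ab.envFun V.Env :=
  ⟨fun w => symmetrize w.length 0 V.word w, by
    have h : IsMultilinear fun w => symmetrize w.length 0 V.word w :=
      isMultilinear_glue (Q := fun n => symmetrize n 0 V.word) fun n =>
        isMultilinear_symmetrize
          (fun _ _ => (multilinearSubmodule V.cpx V.Env).zero_mem) V.isMultilinear_word
    refine ULie.mem_envFun (V := V.ab) h (fun a x y b => ?_) (fun b => ?_)
    · rw [V.map_ab_br h, add_zero]
      have e : (a ++ y :: x :: b).length = (a ++ x :: y :: b).length := by simp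
      rw [e]
      exact (symmetrize_append (isCocycle_zero _) V.word rfl).trans (add_zero _)
    · exact symmetrize_unit (C := 0) (C' := 0) V.word_unit (fun _ _ _ _ => rfl)
        (fun _ _ _ _ => rfl) b⟩

/-- The symmetrization map. -/
def ULie.sym : V.ab.Env →ₗ[K] V.Env := V.ab.descend V.symFun

lemma ULie.sym_word (w : List (Letter V.cpx)) :
    V.sym (V.ab.word w) = symmetrize w.length 0 V.word w := V.ab.descend_word V.symFun w

/-- The inverse of the symmetrization map. -/
def ULie.symInv : V.Env →ₗ[K] V.ab.Env :=
  V.descend (ULie.pbwFun (π := V.ab.word) V.ab.isMultilinear_word V.ab.word_unit)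

lemma ULie.symInv_word (w : List (Letter V.cpx)) :
    V.symInv (V.word w) = V.pbwSeq V.ab.word w.length w := V.descend_word _ w

/-- On a word, the composite is the symmetrization of `V.pbwSeq V.ab.word`, which is that of
`V.ab.word`; the latter is already symmetric, as letters of `V.ab` commute up to sign. -/
lemma ULie.symInv_sym (z : V.ab.Env) : V.symInv (V.sym z) = z := by
  suffices h : V.symInv ∘ₗ V.sym = LinearMap.id from LinearMap.congr_fun h z
  refine ULie.env_hom_ext fun w => ?_
  rw [LinearMap.comp_apply, V.sym_word, symmetrize_comp]
  rw [symmetrize_congr (π' := V.pbwSeq V.ab.word w.length) 0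
    (fun v hv => by rw [V.symInv_word, hv]) rfl]
  refine (ULie.symmetrize_pbwSeq (V := V) (π := V.ab.word) V.ab.isMultilinear_word _ w).trans ?_
  exact symmetrize_of_symmetric (fun a x y b _ => V.ab_word_exchange a x y b) w

/-- Induction on the length: modulo the range, exchanging letters changes a word only by a shorter
word, which already vanishes. So the class of a word equals that of its symmetrization, which lies
in the range. -/
lemma ULie.sym_surjective : Function.Surjective V.sym := by
  rw [← LinearMap.range_eq_top]
  set q := (LinearMap.range V.sym).mkQ with hq
  suffices h : ∀ n (w : List (Letter V.cpx)), w.length = n → q (V.word w) = 0 by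
    have : q = 0 := ULie.env_hom_ext fun w => h _ w rfl
    rw [← Submodule.ker_mkQ (LinearMap.range V.sym), ← hq, this, LinearMap.ker_zero]
  intro n
  induction n with
  | zero =>
    intro w hw
    rw [hq, Submodule.mkQ_apply, Submodule.Quotient.mk_eq_zero]
    refine ⟨V.ab.word w, ?_⟩
    rw [V.sym_word, hw]
    rfl
  | succ n ih =>
    intro w hw
    rw [← symmetrize_of_symmetric (n := n + 1) (π := fun w => q (V.word w))
      (fun a x y b h => ?_) w, ← symmetrize_comp, ← hw, ← V.sym_word]
    · rw [hq, Submodule.mkQ_apply, Submodule.Quotient.mk_eq_zero]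
      exact ⟨_, rfl⟩
    · rw [V.word_exchange, map_add, map_sign_smul, ih (a ++ V.br x y :: b), add_zero]
      simp at h ⊢
      omega

lemma ULie.sym_symInv (z : V.Env) : V.sym (V.symInv z) = z := by
  obtain ⟨y, rfl⟩ := V.sym_surjective z
  rw [V.symInv_sym]

lemma ULie.sym_mem_grade {n : ℤ} {z : V.ab.Env} (hz : z ∈ V.ab.grade n) :
    V.sym z ∈ V.grade n := by
  refine ULie.grade_le_of_word (S := (V.grade n).comap V.sym) (fun w hw => ?_) hz
  rw [Submodule.mem_comap, V.sym_word, ← hw]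
  exact symmetrize_mem_grading V.grade (fun _ _ _ => zero_mem _) V.word_mem_grade w

lemma ULie.pbwSeq_mem_grade (n : ℕ) (w : List (Letter V.cpx)) :
    V.pbwSeq V.ab.word n w ∈ V.ab.grade (wordDeg w) := by
  induction n generalizing w with
  | zero => exact V.ab.word_mem_grade w
  | succ n ih =>
    refine symmetrize_mem_grading V.ab.grade (fun i _ v => ?_) V.ab.word_mem_grade w
    rw [← V.wordDeg_brAt i v]
    exact ih _

lemma ULie.symInv_mem_grade {n : ℤ} {z : V.Env} (hz : z ∈ V.grade n) :
    V.symInv z ∈ V.ab.grade n := by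
  refine ULie.grade_le_of_word (S := (V.ab.grade n).comap V.symInv) (fun w hw => ?_) hz
  rw [Submodule.mem_comap, V.symInv_word, ← hw]
  exact V.pbwSeq_mem_grade _ w

end SymIso

/-! ### The differential on words commutes with symmetrization -/

section WordDiff

variable {K : Type u} [Field K] {E : Ch K} {A : Type*} [AddCommGroup A] [Module K A]

/-- The differential of a homogeneous element. -/
def letterDiff (x : Letter E) : Letter E := ⟨x.1 - 1, E.d x.1 (x.1 - 1) x.2⟩

/-- The sum, with Koszul signs, of the values of a function on the words in which one letter is
replaced by its differential. -/
def wordDiff : (List (Letter E) → A) → List (Letter E) → A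
  | _, [] => 0
  | φ, x :: l => φ (letterDiff x :: l) + x.1.negOnePow • wordDiff (fun l => φ (x :: l)) l

lemma wordDiff_nil (φ : List (Letter E) → A) : wordDiff φ [] = 0 := rfl

lemma wordDiff_cons (φ : List (Letter E) → A) (x : Letter E) (l : List (Letter E)) :
    wordDiff φ (x :: l) =
      φ (letterDiff x :: l) + x.1.negOnePow • wordDiff (fun l => φ (x :: l)) l := rfl

lemma wordDiff_comp {A' : Type*} [AddCommGroup A'] [Module K A'] (g : A →ₗ[K] A')
    (φ : List (Letter E) → A) (w : List (Letter E)) :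
    wordDiff (fun w => g (φ w)) w = g (wordDiff φ w) := by
  induction w generalizing φ with
  | nil => exact (map_zero g).symm
  | cons x l ih => rw [wordDiff_cons, wordDiff_cons, map_add, map_sign_smul, ih]

lemma wordDiff_congr {φ ψ : List (Letter E) → A} {w : List (Letter E)}
    (h : ∀ v, v.length = w.length → φ v = ψ v) : wordDiff φ w = wordDiff ψ w := by
  induction w generalizing φ ψ with
  | nil => rfl
  | cons x l ih =>
    rw [wordDiff_cons, wordDiff_cons, h (letterDiff x :: l) rfl,
      ih fun v hv => h (x :: v) (by simp [hv])]

variable (E A) in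
/-- `wordDiff` as a linear map. -/
def wordDiffLin : (List (Letter E) → A) →ₗ[K] (List (Letter E) → A) where
  toFun := wordDiff
  map_add' φ ψ := by
    funext w
    induction w generalizing φ ψ with
    | nil => exact (add_zero _).symm
    | cons x l ih =>
      have h := ih (fun l => φ (x :: l)) (fun l => ψ (x :: l))
      rw [Pi.add_apply, wordDiff_cons, wordDiff_cons, wordDiff_cons, add_add_add_comm, ← smul_add]
      exact congrArg (fun t => _ + x.1.negOnePow • t) h
  map_smul' c φ := by
    funext w
    induction w generalizing φ with
    | nil => exact (smul_zero c).symm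
    | cons x l ih =>
      have h := ih (fun l => φ (x :: l))
      rw [Pi.smul_apply, wordDiff_cons, wordDiff_cons, smul_add, smul_comm _ x.1.negOnePow]
      exact congrArg (fun t => _ + x.1.negOnePow • t) h

lemma wordDiff_sign_smul (e : ℤˣ) (φ : List (Letter E) → A) (w : List (Letter E)) :
    wordDiff (fun w => e • φ w) w = e • wordDiff φ w := by
  have h := congrFun (map_sign_smul (wordDiffLin E A) e φ) w
  obtain rfl | rfl := Int.units_eq_one_or e
  · simp
  · simp only [Units.neg_smul, one_smul] at h ⊢
    exact h

/-- Replacing `x` by its differential changes the exchange sign by `(-1)^|y|`, which is the sign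
picked up when the differential passes `y`; the same holds with the roles exchanged. -/
lemma wordDiff_swap (φ : List (Letter E) → A) (i : ℕ) (w : List (Letter E)) :
    wordDiff (fun w => signAt i w • φ (swapAt i w)) w =
      signAt i w • wordDiff φ (swapAt i w) := by
  induction i generalizing φ w with
  | zero =>
    match w with
    | [] => simp [wordDiff_nil, swapAt]
    | [x] => simp [wordDiff_cons, wordDiff_nil, swapAt, signAt]
    | x :: y :: l =>
      have e₁ : koszul (letterDiff x) y = koszul x y * y.1.negOnePow := by
        rw [koszul, koszul, ← Int.negOnePow_add]
        have : x.1 * y.1 + y.1 = (letterDiff x).1 * y.1 + 2 * y.1 := by simp [letterDiff]; ring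
        rw [this, Int.negOnePow_add, Int.negOnePow_even (2 * y.1) ⟨y.1, by ring⟩, mul_one]
      have e₂ : koszul x (letterDiff y) = koszul x y * x.1.negOnePow := by
        rw [koszul, koszul, ← Int.negOnePow_add]
        have : x.1 * y.1 + x.1 = x.1 * (letterDiff y).1 + 2 * x.1 := by simp [letterDiff]; ring
        rw [this, Int.negOnePow_add, Int.negOnePow_even (2 * x.1) ⟨x.1, by ring⟩, mul_one]
      have e₃ := Int.units_mul_self x.1.negOnePow
      simp only [wordDiff_cons, swapAt, signAt, e₁, e₂]
      rw [wordDiff_sign_smul]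
      simp only [smul_add, smul_smul]
      have e₄ : y.1.negOnePow * (x.1.negOnePow * koszul x y) =
          koszul x y * (y.1.negOnePow * x.1.negOnePow) := by ac_rfl
      rw [mul_left_comm x.1.negOnePow, e₃, mul_one, mul_left_comm x.1.negOnePow, e₄]
      abel
  | succ i ih =>
    match w with
    | [] => simp [wordDiff_nil, swapAt]
    | x :: l =>
      simp only [wordDiff_cons, swapAt, signAt]
      rw [ih (fun l => φ (x :: l)) l, smul_add, smul_comm x.1.negOnePow]

lemma symmetrize_wordDiff (n : ℕ) (π : List (Letter E) → A) (w : List (Letter E)) :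
    wordDiff (symmetrize n 0 π) w = symmetrize n 0 (wordDiff π) w := by
  refine congrFun (symmetrize_intertwine (C := 0) (C' := 0) (wordDiffLin E A) (m := n)
    (fun i hi φ c => ?_) (π, 1)) w
  funext w
  change wordDiff _ w = (swapOp n 0 i (wordDiff φ, c)).1 w
  by_cases hw : w.length = n
  · rw [swapOp_fst _ _ _ _ hw]
    simp only [Pi.zero_apply, smul_zero, add_zero]
    rw [← wordDiff_swap]
    refine wordDiff_congr fun v hv => ?_
    rw [swapOp_fst _ _ _ _ (hv.trans hw)]
    simp
  · rw [swapOp_fst_of_ne _ _ _ _ hw]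
    exact wordDiff_congr fun v hv => swapOp_fst_of_ne _ _ _ _ (by rwa [hv])

lemma ULie.diff_word (V : ULie K) (w : List (Letter V.cpx)) :
    V.diff (V.word w) = wordDiff V.word w := by
  induction w with
  | nil => exact V.diff_one
  | cons x l ih =>
    rw [V.word_cons, V.diff_gen_mul (by omega : x.1 - 1 + 1 = x.1), ih, wordDiff_cons, V.word_cons]
    congr 2
    rw [← LinearMap.mulLeft_apply (R := K), ← wordDiff_comp]
    simp only [LinearMap.mulLeft_apply, V.word_cons]

end WordDiff

/-! ### Symmetrization is a natural isomorphism of complexes -/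

section SymNatural

variable {K : Type u} [Field K] [CharZero K]

/-- On words both differentials are `wordDiff`, which preserves length and commutes with
symmetrization. -/
lemma ULie.diff_sym (V : ULie K) (z : V.ab.Env) : V.diff (V.sym z) = V.sym (V.ab.diff z) := by
  suffices h : V.diff ∘ₗ V.sym = V.sym ∘ₗ V.ab.diff from LinearMap.congr_fun h z
  refine ULie.env_hom_ext fun w => ?_
  rw [LinearMap.comp_apply, LinearMap.comp_apply, V.sym_word, symmetrize_comp, V.ab.diff_word,
    ← wordDiff_comp]
  simp only [V.sym_word, V.diff_word]
  refine (symmetrize_wordDiff w.length V.word w).symm.trans ?_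
  exact wordDiff_congr fun v hv => by rw [hv]

lemma ULie.gen_map_bracket {K : Type u} [Field K] {V W : ULie K} (f : V ⟶ W) {p q n : ℤ}
    (h : p + q = n) (x : V.cpx.X p) (y : V.cpx.X q) :
    (W.gen n).comp (f.hom.f n).hom (V.bracket h x y) =
      (W.gen p).comp (f.hom.f p).hom x * (W.gen q).comp (f.hom.f q).hom y -
        (p * q).negOnePow •
          ((W.gen q).comp (f.hom.f q).hom y * (W.gen p).comp (f.hom.f p).hom x) :=
  (congrArg (W.gen n) (f.map_bracket h x y)).trans
    (W.gen_bracket h (f.hom.f p x) (f.hom.f q y))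

/-- The algebra homomorphism of enveloping algebras induced by a morphism `V ⟶ W`. -/
def ULie.envMap {K : Type u} [Field K] {V W : ULie K} (f : V ⟶ W) : V.Env →ₐ[K] W.Env :=
  ULie.Env.lift V (fun p => (W.gen p).comp (f.hom.f p).hom) (ULie.gen_map_bracket f)
    ((congrArg (W.gen 0) f.map_unit).trans W.gen_unit)

lemma ULie.envMap_gen {K : Type u} [Field K] {V W : ULie K} (f : V ⟶ W) {p : ℤ}
    (x : V.cpx.X p) : ULie.envMap f (V.gen p x) = W.gen p (f.hom.f p x) :=
  ULie.Env.lift_gen V (fun p => (W.gen p).comp (f.hom.f p).hom) (ULie.gen_map_bracket f)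
    _ p x

lemma ULie.envMap_word {K : Type u} [Field K] {V W : ULie K} (f : V ⟶ W)
    (w : List (Letter V.cpx)) : ULie.envMap f (V.word w) =
      W.word (w.map fun x => (⟨x.1, f.hom.f x.1 x.2⟩ : Letter W.cpx)) := by
  induction w with
  | nil => exact map_one _
  | cons x l ih => rw [V.word_cons, map_mul, ih, ULie.envMap_gen, List.map_cons, W.word_cons]

/-- The chain map underlying the morphism of enveloping algebras induced by `V ⟶ W`. -/
def ULie.mapCpx {K : Type u} [Field K] {V W : ULie K} (f : V ⟶ W) : V.envCpx ⟶ W.envCpx :=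
  ((phiShriek K).map f).hom

lemma ULie.val_mapCpx {K : Type u} [Field K] {V W : ULie K} (f : V ⟶ W) {n : ℤ}
    (a : V.envCpx.X n) :
    W.val n ((ULie.mapCpx f).f n a) = ULie.envMap f (V.val n a) := by
  change ULie.mapVal f n a = _
  induction n, a using V.env_induction with
  | one => rw [ULie.mapVal_one, V.val_toCpx, map_one]
  | gen_mul h x a ih =>
    rw [ULie.mapVal_gen_mul, ih, V.val_envMul, map_mul, V.val_toEnvCpx, ULie.envMap_gen]
  | zero n => simp
  | add n a b ha hb => rw [map_add, map_add, map_add, ha, hb]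
  | smul n c a ha => rw [map_smul, map_smul, map_smul, ha]

lemma ULie.envMap_sym {V W : ULie K} (f : V ⟶ W) (z : V.ab.Env) :
    ULie.envMap f (V.sym z) = W.sym (ULie.envMap (ULie.abMap f) z) := by
  suffices h : (ULie.envMap f).toLinearMap ∘ₗ V.sym =
      W.sym ∘ₗ (ULie.envMap (ULie.abMap f)).toLinearMap from LinearMap.congr_fun h z
  refine ULie.env_hom_ext fun w => ?_
  rw [LinearMap.comp_apply, LinearMap.comp_apply, V.sym_word, symmetrize_comp]
  simp only [AlgHom.toLinearMap_apply, ULie.envMap_word]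
  refine (symmetrize_map f.hom w.length W.word w).symm.trans ?_
  refine Eq.trans ?_ (W.sym_word _).symm
  rw [List.length_map]

/-- The isomorphism of chain complexes given by symmetrization. -/
def ULie.symIso (V : ULie K) : V.ab.envCpx ≅ V.envCpx :=
  HomologicalComplex.Hom.isoOfComponents
    (fun n => LinearEquiv.toModuleIso (X₁ := V.ab.grade n) (X₂ := V.grade n) (LinearEquiv.ofLinearMap
      (V.sym.restrict fun _ h => V.sym_mem_grade h)
      (V.symInv.restrict fun _ h => V.symInv_mem_grade h)
      (LinearMap.ext fun x => Subtype.ext (V.sym_symInv x.1))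
      (LinearMap.ext fun x => Subtype.ext (V.symInv_sym x.1))))
    (fun i j h => by
      ext x
      refine V.val_injective j ((V.val_d h _).trans ((V.diff_sym _).trans ?_))
      exact congrArg V.sym (V.ab.val_d h x).symm)

lemma ULie.val_symIso_hom (V : ULie K) {n : ℤ} (x : V.ab.envCpx.X n) :
    V.val n (V.symIso.hom.f n x) = V.sym (V.ab.val n x) := rfl

lemma ULie.symIso_hom_naturality {V W : ULie K} (f : V ⟶ W) :
    ULie.mapCpx (ULie.abMap f) ≫ W.symIso.hom =
      V.symIso.hom ≫ ULie.mapCpx f := by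
  refine HomologicalComplex.hom_ext _ _ fun n => ModuleCat.hom_ext (LinearMap.ext fun x => ?_)
  refine W.val_injective n ?_
  change W.val n (W.symIso.hom.f n ((ULie.mapCpx (ULie.abMap f)).f n x)) =
    W.val n ((ULie.mapCpx f).f n (V.symIso.hom.f n x))
  refine (W.val_symIso_hom _).trans ?_
  refine Eq.trans ?_ (ULie.val_mapCpx f _).symm
  rw [ULie.val_mapCpx (ULie.abMap f), V.val_symIso_hom, ULie.envMap_sym]

/-- Up to isomorphism, the map of chain complexes induced on enveloping algebras does not depend on
the Lie brackets. -/
lemma quasiIso_mapCpx_iff {V W : ULie K} (f : V ⟶ W) :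
    QuasiIso (ULie.mapCpx f) ↔ QuasiIso (ULie.mapCpx (ULie.abMap f)) := by
  have h := ULie.symIso_hom_naturality f
  constructor
  · intro hf
    have : QuasiIso (ULie.mapCpx (ULie.abMap f) ≫ W.symIso.hom) := by
      rw [h]; infer_instance
    exact quasiIso_of_comp_right _ W.symIso.hom
  · intro hf
    have : QuasiIso (V.symIso.hom ≫ ULie.mapCpx f) := by
      rw [← h]; infer_instance
    exact quasiIso_of_comp_left V.symIso.hom _

end SymNatural

/-! ### Quasi-isomorphisms in terms of cycles and boundaries -/

section QuasiIso

variable {K : Type u} [Field K]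

lemma ModuleCat.d_d {E : Ch K} (i j k : ℤ) (x : E.X i) : E.d j k (E.d i j x) = 0 := by
  rw [← ModuleCat.comp_apply, E.d_comp_d]; rfl

lemma hom_f_d {E F : Ch K} (f : E ⟶ F) (i j : ℤ) (x : E.X i) :
    f.f j (E.d i j x) = F.d i j (f.f i x) := by
  rw [← ModuleCat.comp_apply, ← ModuleCat.comp_apply, f.comm]

/-- A description of quasi-isomorphisms of short complexes of modules in terms of elements. -/
lemma shortComplex_quasiIso_iff {S T : ShortComplex (ModuleCat.{u} K)} (φ : S ⟶ T) :
    ShortComplex.QuasiIso φ ↔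
      (∀ x, S.g x = 0 → (∃ y, T.f y = φ.τ₂ x) → ∃ x', S.f x' = x) ∧
      (∀ y, T.g y = 0 → ∃ x, S.g x = 0 ∧ ∃ y', φ.τ₂ x + T.f y' = y) := by
  have γ : ShortComplex.LeftHomologyMapData φ S.moduleCatLeftHomologyData
    T.moduleCatLeftHomologyData := default
  have hi : ∀ x : LinearMap.ker S.g.hom, (γ.φK x : LinearMap.ker T.g.hom).1 = φ.τ₂ x.1 := fun x =>
    congrArg (fun m : S.moduleCatLeftHomologyData.K ⟶ T.X₂ => m.hom x) γ.commi
  have hπ : ∀ x : LinearMap.ker S.g.hom,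
      γ.φH ((LinearMap.range S.moduleCatToCycles).mkQ x) =
        (LinearMap.range T.moduleCatToCycles).mkQ (γ.φK x) := fun x =>
    congrArg (fun m : S.moduleCatLeftHomologyData.K ⟶ T.moduleCatLeftHomologyData.H => m.hom x)
      γ.commπ
  -- With homology presented as kernel modulo range, injectivity of the induced map gives the first
  -- condition and surjectivity the second.
  rw [γ.quasiIso_iff, ConcreteCategory.isIso_iff_bijective]
  refine and_congr ?_ ?_
  · rw [injective_iff_map_eq_zero]
    constructor
    · rintro h x hx ⟨y, hy⟩
      have h₁ := h ((LinearMap.range S.moduleCatToCycles).mkQ ⟨x, hx⟩) (by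
        rw [hπ]
        refine (Submodule.Quotient.mk_eq_zero _).2 ⟨y, Subtype.ext ?_⟩
        exact hy.trans (hi ⟨x, hx⟩).symm)
      obtain ⟨x', hx'⟩ := (Submodule.Quotient.mk_eq_zero _).1 h₁
      exact ⟨x', congrArg Subtype.val hx'⟩
    · intro h z hz
      obtain ⟨⟨x, hx⟩, rfl⟩ := Submodule.mkQ_surjective (LinearMap.range S.moduleCatToCycles) z
      rw [hπ] at hz
      obtain ⟨y, hy⟩ := (Submodule.Quotient.mk_eq_zero _).1 hz
      obtain ⟨x', hx'⟩ := h x hx ⟨y, (congrArg Subtype.val hy).trans (hi ⟨x, hx⟩)⟩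
      exact (Submodule.Quotient.mk_eq_zero _).2 ⟨x', Subtype.ext hx'⟩
  · constructor
    · intro h y hy
      obtain ⟨z, hz⟩ := h ((LinearMap.range T.moduleCatToCycles).mkQ ⟨y, hy⟩)
      obtain ⟨⟨x, hx⟩, rfl⟩ := Submodule.mkQ_surjective (LinearMap.range S.moduleCatToCycles) z
      rw [hπ] at hz
      obtain ⟨y', hy'⟩ := (Submodule.Quotient.eq _).1 hz.symm
      refine ⟨x, hx, y', ?_⟩
      have e : T.f y' = y - φ.τ₂ x :=
        (congrArg Subtype.val hy').trans (congrArg (y - ·) (hi ⟨x, hx⟩))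
      rw [e]
      abel
    · intro h z
      obtain ⟨⟨y, hy⟩, rfl⟩ := Submodule.mkQ_surjective (LinearMap.range T.moduleCatToCycles) z
      obtain ⟨x, hx, y', hy'⟩ := h y hy
      refine ⟨(LinearMap.range S.moduleCatToCycles).mkQ ⟨x, hx⟩, ?_⟩
      rw [hπ]
      refine ((Submodule.Quotient.eq (LinearMap.range T.moduleCatToCycles)).2
        ⟨y', Subtype.ext ?_⟩).symm
      have e : T.f y' = y - φ.τ₂ x := by rw [← hy']; abel
      exact e.trans (congrArg (y - ·) (hi ⟨x, hx⟩)).symm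

/-- A description of quasi-isomorphisms of chain complexes in terms of elements. -/
lemma quasiIso_iff_elements {E F : Ch K} (f : E ⟶ F) :
    QuasiIso f ↔ ∀ n : ℤ,
      (∀ x : E.X n, E.d n (n - 1) x = 0 → (∃ y, F.d (n + 1) n y = f.f n x) →
        ∃ x', E.d (n + 1) n x' = x) ∧
      (∀ y : F.X n, F.d n (n - 1) y = 0 →
        ∃ x, E.d n (n - 1) x = 0 ∧ ∃ y', f.f n x + F.d (n + 1) n y' = y) := by
  rw [quasiIso_iff]
  refine forall_congr' fun n => ?_
  rw [quasiIsoAt_iff' f (n + 1) n (n - 1) ((ComplexShape.down ℤ).prev_eq' rfl)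
    ((ComplexShape.down ℤ).next_eq' (by simp))]
  exact shortComplex_quasiIso_iff _

end QuasiIso

/-! ### Contraction of a complex onto representatives of its homology -/

section Contraction

variable {K : Type u} [Field K] (E : Ch K)

/-- A linear section of `f` over its range, extended to all of `N`. -/
lemma exists_generalized_inverse {M N : Type*} [AddCommGroup M] [Module K M] [AddCommGroup N]
    [Module K N] (f : M →ₗ[K] N) : ∃ g : N →ₗ[K] M, ∀ x, f (g (f x)) = f x := by
  obtain ⟨r, hr⟩ := f.rangeRestrict.exists_rightInverse_of_surjective f.range_rangeRestrict
  obtain ⟨g, hg⟩ := r.exists_extend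
  refine ⟨g, fun x => ?_⟩
  have h₁ : g (f x) = r (f.rangeRestrict x) := LinearMap.congr_fun hg (f.rangeRestrict x)
  rw [h₁]
  exact congrArg Subtype.val (LinearMap.congr_fun hr (f.rangeRestrict x))

/-- Projection onto `X` along a complement chosen to contain `B`. -/
lemma exists_projection {M : Type*} [AddCommGroup M] [Module K M] {X B : Submodule K M}
    (h : Disjoint X B) : ∃ P : M →ₗ[K] M, (∀ x ∈ X, P x = x) ∧ (∀ x ∈ B, P x = 0) ∧
      ∀ x, P x ∈ X := by
  obtain ⟨B', hB, hc⟩ := h.symm.exists_isCompl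
  refine ⟨LinearMap.ofIsCompl hc 0 X.subtype, fun x hx => ?_, fun x hx => ?_, fun x => ?_⟩
  · exact LinearMap.ofIsCompl_apply_right hc (⟨x, hx⟩ : X)
  · exact LinearMap.ofIsCompl_apply_left hc (⟨x, hB hx⟩ : B')
  · obtain ⟨b, hb, y, hy, rfl⟩ := Submodule.mem_sup.1 (hc.sup_eq_top ▸ Submodule.mem_top (x := x))
    rw [map_add]
    have h₁ := LinearMap.ofIsCompl_apply_left (φ := 0) (ψ := X.subtype) hc (⟨b, hb⟩ : B')
    have h₂ := LinearMap.ofIsCompl_apply_right (φ := 0) (ψ := X.subtype) hc (⟨y, hy⟩ : X)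
    dsimp only at h₁ h₂
    rw [h₁, h₂]
    simpa using hy

variable {E}

/-- Graded subspaces of cycles which represent the homology of a chain complex. -/
def IsHomologySplitting (E : Ch K) (X : ∀ n, Submodule K (E.X n)) : Prop :=
  (∀ n, ∀ x ∈ X n, E.d n (n - 1) x = 0) ∧ (∀ n, ∀ x ∈ X n, ∀ y, E.d (n + 1) n y = x → x = 0) ∧
    ∀ n x, E.d n (n - 1) x = 0 → ∃ x' ∈ X n, ∃ y, x = x' + E.d (n + 1) n y

/-- The projection onto representatives of the homology is homotopic to the identity. -/
lemma IsHomologySplitting.exists_contraction {X : ∀ n, Submodule K (E.X n)}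
    (hX : IsHomologySplitting E X) :
    ∃ (P : ∀ n, E.X n →ₗ[K] E.X n) (h : ∀ i j, E.X i →ₗ[K] E.X j),
      (∀ n, ∀ x ∈ X n, P n x = x) ∧ (∀ n x, P n x ∈ X n) ∧
      (∀ i j (_ : j + 1 = i) x, P j (E.d i j x) = 0) ∧
      (∀ i j, ∀ x ∈ X i, h i j x = 0) ∧
      ∀ i j k (_ : j + 1 = i) (_ : k + 1 = j) (x : E.X j),
        E.d i j (h j i x) + h k j (E.d j k x) = x - P j x := by
  obtain ⟨h₁, h₂, h₃⟩ := hX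
  choose s hs using fun i j => exists_generalized_inverse (E.d i j).hom
  have hd : ∀ n, Disjoint (X n) (LinearMap.range (E.d (n + 1) n).hom) := fun n => by
    rw [Submodule.disjoint_def]
    rintro x hx ⟨y, hy⟩
    exact h₂ n x hx y hy
  choose Q hQ₁ hQ₂ hQ₃ using fun n => exists_projection (hd n)
  -- `z n` is a projection onto the cycles, built from the generalized inverse of the differential.
  let z : ∀ n, E.X n →ₗ[K] E.X n := fun n =>
    LinearMap.id - (s n (n - 1)).comp (E.d n (n - 1)).hom
  have hz : ∀ n x, z n x = x - s n (n - 1) (E.d n (n - 1) x) := fun _ _ => rfl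
  have hz₁ : ∀ n x, E.d n (n - 1) x = 0 → z n x = x := fun n x hx => by
    rw [hz, hx, map_zero, sub_zero]
  have hz₂ : ∀ n x, E.d n (n - 1) (z n x) = 0 := fun n x => by
    rw [hz, map_sub]
    exact sub_eq_zero.2 (hs n (n - 1) x).symm
  have hzQ : ∀ n x, ∃ y, E.d (n + 1) n y = z n x - Q n (z n x) := fun n x => by
    obtain ⟨x', hx', y, hy⟩ := h₃ n _ (hz₂ n x)
    refine ⟨y, ?_⟩
    rw [hy, map_add, hQ₁ n x' hx', hQ₂ n _ ⟨y, rfl⟩]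
    abel
  -- `P = Q z` and `h = s (1 - Q) z`. As `(1 - Q) z x` is a boundary, on which `d s` is the
  -- identity, `d h = z - P`; as boundaries are cycles killed by `Q`, `h d = s d = 1 - z`. The sum
  -- is `1 - P`.
  refine ⟨fun n => (Q n).comp (z n),
    fun i j => (s j i).comp ((LinearMap.id - Q i).comp (z i)), ?_, ?_, ?_, ?_, ?_⟩
  · intro n x hx
    rw [LinearMap.comp_apply, hz₁ n x (h₁ n x hx), hQ₁ n x hx]
  · intro n x
    exact hQ₃ n _
  · rintro _ j rfl x
    rw [LinearMap.comp_apply, hz₁ j _ (ModuleCat.d_d _ _ _ _)]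
    exact hQ₂ j _ ⟨x, rfl⟩
  · intro i j x hx
    rw [LinearMap.comp_apply, LinearMap.comp_apply, hz₁ i x (h₁ i x hx), LinearMap.sub_apply,
      hQ₁ i x hx, LinearMap.id_apply, sub_self, map_zero]
  · rintro _ j k rfl hk x
    obtain rfl : k = j - 1 := by omega
    simp only [LinearMap.comp_apply, LinearMap.sub_apply, LinearMap.id_apply]
    obtain ⟨y, hy⟩ := hzQ j x
    have e₁ : E.d (j + 1) j (s (j + 1) j (z j x - Q j (z j x))) = z j x - Q j (z j x) := by
      rw [← hy]
      exact hs (j + 1) j y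
    have e₂ : Q (j - 1) (E.d j (j - 1) x) = 0 := hQ₂ (j - 1) _ (by
      have : j = (j - 1) + 1 := by omega
      generalize j - 1 = k at this ⊢
      subst this
      exact ⟨x, rfl⟩)
    rw [e₁, hz₁ (j - 1) _ (ModuleCat.d_d _ _ _ _), e₂, sub_zero, hz]
    abel

/-- If a cycle is not a boundary, there are representatives of the homology which contain it. -/
lemma exists_isHomologySplitting {x₀ : E.X 0} (h₀ : E.d 0 (-1) x₀ = 0)
    (hx₀ : ∀ y, E.d 1 0 y ≠ x₀) :
    ∃ X : ∀ n, Submodule K (E.X n), IsHomologySplitting E X ∧ x₀ ∈ X 0 := by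
  -- `S` is the line of `x₀` in degree zero and trivial elsewhere. Equality of letters expresses
  -- membership of `x₀` without transport along `n = 0`.
  have key : ∀ n, ∃ S : Submodule K (E.X n),
      Disjoint S (LinearMap.range (E.d (n + 1) n).hom) ∧
        ∀ x, (⟨n, x⟩ : Letter E) = ⟨0, x₀⟩ → x ∈ S := by
    intro n
    by_cases hn : n = 0
    · subst hn
      refine ⟨Submodule.span K {x₀}, ?_, fun x hx => ?_⟩
      · rw [Submodule.disjoint_def]
        rintro x hx ⟨y, hy⟩
        obtain ⟨c, rfl⟩ := Submodule.mem_span_singleton.1 hx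
        by_cases hc : c = 0
        · rw [hc, zero_smul]
        · refine absurd ?_ (hx₀ (c⁻¹ • y))
          rw [map_smul]
          refine (congrArg (c⁻¹ • ·) hy).trans ?_
          exact inv_smul_smul₀ hc x₀
      · rw [eq_of_heq (Sigma.mk.inj hx).2]
        exact Submodule.mem_span_singleton_self x₀
    · exact ⟨⊥, disjoint_bot_left, fun x hx => absurd (Sigma.mk.inj hx).1 hn⟩
  choose S hS₁ hS₂ using key
  -- `T n` contains `S n` and is a complement of the boundaries; its cycles represent the homology.
  choose T hT₁ hT₂ using fun n => (hS₁ n).exists_isCompl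
  refine ⟨fun n => T n ⊓ LinearMap.ker (E.d n (n - 1)).hom, ⟨fun n x hx => hx.2,
    fun n x hx y hy => ?_, fun n x hx => ?_⟩, hT₁ 0 (hS₂ 0 x₀ rfl), h₀⟩
  · exact (Submodule.disjoint_def.1 (hT₂ n).disjoint) x hx.1 ⟨y, hy⟩
  · obtain ⟨t, ht, _, ⟨y, rfl⟩, e⟩ := Submodule.mem_sup.1
      ((hT₂ n).sup_eq_top ▸ Submodule.mem_top (x := x))
    refine ⟨t, ⟨ht, ?_⟩, y, e.symm⟩
    change E.d n (n - 1) t = 0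
    rw [eq_sub_of_add_eq e, map_sub]
    refine sub_eq_zero.2 (hx.trans ?_)
    exact (ModuleCat.d_d (n + 1) n (n - 1) y).symm

end Contraction

/-! ### Extending a contraction to a derivation in the abelian case -/

section ContractionDerivation

variable {K : Type u} [Field K] (V : ULie K)

/-- A unital Lie algebra is abelian if its bracket vanishes. -/
def ULie.IsAbelian : Prop :=
  ∀ {p q n : ℤ} (h : p + q = n) (x : V.cpx.X p) (y : V.cpx.X q), V.bracket h x y = 0

variable {V}

lemma ULie.IsAbelian.gen_mul_gen (hV : V.IsAbelian) {p q : ℤ} (x : V.cpx.X p) (y : V.cpx.X q) :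
    V.gen p x * V.gen q y = (p * q).negOnePow • (V.gen q y * V.gen p x) := by
  have := V.gen_bracket rfl x y
  rw [hV, map_zero] at this
  exact sub_eq_zero.1 this.symm

/-- The endomorphism `(a, b) ↦ (h x * b + (-1)^p x * a, x * b)` of `Env × Env` for `x` of
degree `p`. -/
def ULie.contrAux (h : ∀ i j, V.cpx.X i →ₗ[K] V.cpx.X j) (p : ℤ) :
    V.cpx.X p →ₗ[K] Module.End K (V.Env × V.Env) :=
  LinearMap.mk₂ K
    (fun x ab => (V.gen (p + 1) (h p (p + 1) x) * ab.2 + p.negOnePow • (V.gen p x * ab.1),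
      V.gen p x * ab.2))
    (fun x y ab => by
      ext <;> simp only [map_add, add_mul, smul_add, Prod.mk_add_mk]
      abel)
    (fun c x ab => by
      ext <;> simp [smul_comm c])
    (fun x ab ab' => by
      ext <;> simp only [mul_add, smul_add, Prod.mk_add_mk, Prod.fst_add, Prod.snd_add]
      abel)
    (fun c x ab => by
      ext <;> simp [smul_comm c])

lemma ULie.contrAux_apply (h : ∀ i j, V.cpx.X i →ₗ[K] V.cpx.X j) {p : ℤ} (x : V.cpx.X p)
    (a b : V.Env) : ULie.contrAux h p x (a, b) =
      (V.gen (p + 1) (h p (p + 1) x) * b + p.negOnePow • (V.gen p x * a), V.gen p x * b) := rfl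

/-- No compatibility of `h` with brackets is available. With zero bracket the relation only asks for
graded commutation, which holds because all generators commute up to sign. -/
lemma ULie.IsAbelian.contrAux_bracket (hV : V.IsAbelian)
    (h : ∀ i j, V.cpx.X i →ₗ[K] V.cpx.X j) {p q n : ℤ} (hpq : p + q = n) (x : V.cpx.X p)
    (y : V.cpx.X q) :
    ULie.contrAux h n (V.bracket hpq x y) = ULie.contrAux h p x * ULie.contrAux h q y -
      (p * q).negOnePow • (ULie.contrAux h q y * ULie.contrAux h p x) := by
  have e₁ : ((p + 1) * q).negOnePow = (p * q).negOnePow * q.negOnePow := by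
    rw [← Int.negOnePow_add]; congr 1; ring
  have e₂ : (p * (q + 1)).negOnePow = (p * q).negOnePow * p.negOnePow := by
    rw [← Int.negOnePow_add]; congr 1; ring
  have h₁ := hV.gen_mul_gen x y
  have h₂ := hV.gen_mul_gen (h p (p + 1) x) y
  have h₃ := hV.gen_mul_gen x (h q (q + 1) y)
  rw [e₁] at h₂
  rw [e₂] at h₃
  rw [hV, map_zero]
  refine LinearMap.ext fun ⟨a, b⟩ => ?_
  rw [LinearMap.sub_apply, sign_smul_apply, Module.End.mul_apply, Module.End.mul_apply,
    ULie.contrAux_apply, ULie.contrAux_apply, ULie.contrAux_apply, ULie.contrAux_apply,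
    LinearMap.zero_apply, eq_comm, sub_eq_zero]
  ext
  · simp only [Prod.smul_fst, mul_add, smul_add, sign_mul_right, ← mul_assoc]
    rw [h₁, h₂, h₃]
    simp only [sign_mul_left, smul_smul]
    have e₃ : p.negOnePow * ((p * q).negOnePow * p.negOnePow) = (p * q).negOnePow := by
      rw [mul_left_comm, Int.units_mul_self, mul_one]
    have e₄ : p.negOnePow * (q.negOnePow * (p * q).negOnePow) =
        (p * q).negOnePow * (q.negOnePow * p.negOnePow) := by ac_rfl
    simp only [mul_assoc, e₃, e₄] at *
    abel
  · simp only [Prod.smul_snd, ← mul_assoc]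
    rw [h₁, sign_mul_left]

variable (hV : V.IsAbelian) {h : ∀ i j, V.cpx.X i →ₗ[K] V.cpx.X j} (hu : h 0 1 V.unit = 0)

/-- A derivation kills `1`, which is identified with the unit of `V`; hence the condition that `h`
vanishes there. -/
lemma ULie.contrAux_unit (hu : h 0 1 V.unit = 0) : ULie.contrAux h 0 V.unit = 1 := by
  refine LinearMap.ext fun ⟨a, b⟩ => ?_
  rw [ULie.contrAux_apply, V.gen_unit]
  have : h 0 (0 + 1) V.unit = 0 := hu
  rw [this]
  simp

/-- The algebra homomorphism from which the extension of a contraction to a graded derivation is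
read off. -/
def ULie.contrHom : V.Env →ₐ[K] Module.End K (V.Env × V.Env) :=
  ULie.Env.lift V (ULie.contrAux h) (hV.contrAux_bracket h) (ULie.contrAux_unit hu)

lemma ULie.contrHom_gen {p : ℤ} (x : V.cpx.X p) :
    ULie.contrHom hV hu (V.gen p x) = ULie.contrAux h p x :=
  ULie.Env.lift_gen V (ULie.contrAux h) (hV.contrAux_bracket h) (ULie.contrAux_unit hu) p x

/-- The extension of a contraction of `V` to a graded derivation of the enveloping algebra. -/
def ULie.contr : V.Env →ₗ[K] V.Env :=
  (LinearMap.fst K V.Env V.Env).comp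
    ((LinearMap.applyₗ ((0, 1) : V.Env × V.Env)).comp (ULie.contrHom hV hu).toLinearMap)

lemma ULie.contr_one : ULie.contr hV hu 1 = 0 := by
  change (ULie.contrHom hV hu 1 (0, 1)).1 = 0
  rw [map_one]; rfl

lemma ULie.contrHom_snd (w : List (Letter V.cpx)) (c b : V.Env) :
    (ULie.contrHom hV hu (V.word w) (c, b)).2 = V.word w * b := by
  induction w generalizing c b with
  | nil => rw [V.word_nil, map_one, one_mul]; rfl
  | cons x w ih =>
    rw [V.word_cons, map_mul, Module.End.mul_apply, mul_assoc, ← ih c b, ULie.contrHom_gen]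
    rfl

lemma ULie.contr_gen_mul_word {p : ℤ} (x : V.cpx.X p) (w : List (Letter V.cpx)) :
    ULie.contr hV hu (V.gen p x * V.word w) = V.gen (p + 1) (h p (p + 1) x) * V.word w +
      p.negOnePow • (V.gen p x * ULie.contr hV hu (V.word w)) := by
  change (ULie.contrHom hV hu (V.gen p x * V.word w) (0, 1)).1 = _
  have e : ULie.contrHom hV hu (V.word w) (0, 1) = (ULie.contr hV hu (V.word w), V.word w) :=
    Prod.ext rfl ((ULie.contrHom_snd hV hu w 0 1).trans (mul_one _))
  rw [map_mul, Module.End.mul_apply, e, ULie.contrHom_gen]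
  rfl

lemma sign_smul_eq_intCast_smul {M : Type*} [AddCommGroup M] [Module K M] (e : ℤˣ) (x : M) :
    e • x = ((e : ℤ) : K) • x := by
  obtain rfl | rfl := Int.units_eq_one_or e <;> simp

lemma ULie.contr_gen_mul {p : ℤ} (x : V.cpx.X p) (a : V.Env) :
    ULie.contr hV hu (V.gen p x * a) = V.gen (p + 1) (h p (p + 1) x) * a +
      p.negOnePow • (V.gen p x * ULie.contr hV hu a) := by
  -- The sign is written as a scalar of `K`, so that both sides are linear maps determined by their
  -- values on words.
  have key : (ULie.contr hV hu).comp (LinearMap.mulLeft K (V.gen p x)) =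
      LinearMap.mulLeft K (V.gen (p + 1) (h p (p + 1) x)) +
        ((p.negOnePow : ℤ) : K) • (LinearMap.mulLeft K (V.gen p x)).comp (ULie.contr hV hu) := by
    refine ULie.env_hom_ext fun w => ?_
    refine (ULie.contr_gen_mul_word hV hu x w).trans ?_
    rw [sign_smul_eq_intCast_smul (K := K)]
    rfl
  refine (LinearMap.congr_fun key a).trans ?_
  rw [sign_smul_eq_intCast_smul (K := K)]
  rfl

lemma ULie.contr_mem_grade {n : ℤ} {a : V.Env} (ha : a ∈ V.grade n) :
    ULie.contr hV hu a ∈ V.grade (n + 1) := by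
  refine V.grade_le (S := (V.grade (n + 1)).comap (ULie.contr hV hu)) (fun w hw => ?_) ha
  rw [Submodule.mem_comap]
  clear ha a
  induction hw with
  | one => rw [ULie.contr_one]; exact zero_mem _
  | @cons p q n hn x a hw ih =>
    rw [ULie.contr_gen_mul]
    refine add_mem (V.gen_mul_mem_grade (by omega) _ hw.mem_grade) (sign_smul_mem _ _ ?_)
    exact V.gen_mul_mem_grade (by omega) x ih

/-- The graded commutator of the differential with a contraction is a derivation. -/
lemma ULie.diff_contr_gen_mul {p p' : ℤ} (hp : p' + 1 = p) (x : V.cpx.X p) (a : V.Env) :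
    V.diff (ULie.contr hV hu (V.gen p x * a)) + ULie.contr hV hu (V.diff (V.gen p x * a)) =
      V.gen p (V.cpx.d (p + 1) p (h p (p + 1) x) + h p' p (V.cpx.d p p' x)) * a +
        V.gen p x * (V.diff (ULie.contr hV hu a) + ULie.contr hV hu (V.diff a)) := by
  subst hp
  have e : (p' + 1 + 1).negOnePow = p'.negOnePow := by
    rw [Int.negOnePow_succ, Int.negOnePow_succ, neg_neg]
  rw [ULie.contr_gen_mul, V.diff_gen_mul rfl, map_add, map_add, map_sign_smul, map_sign_smul,
    V.diff_gen_mul rfl, V.diff_gen_mul rfl, ULie.contr_gen_mul, ULie.contr_gen_mul, map_add,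
    add_mul, mul_add, e, Int.negOnePow_succ]
  obtain e' | e' := Int.units_eq_one_or p'.negOnePow <;>
  simp only [e', one_smul, Units.neg_smul, smul_add, neg_neg] <;> abel

end ContractionDerivation

/-! ### A projection homotopic to the identity acts trivially on homology -/

section HomotopyInvariance

variable {K : Type u} [Field K] {V : ULie K}

lemma ULie.diff_envMap {W : ULie K} (f : V ⟶ W) (a : V.Env) :
    W.diff (ULie.envMap f a) = ULie.envMap f (V.diff a) := by
  suffices h : W.diff ∘ₗ (ULie.envMap f).toLinearMap = (ULie.envMap f).toLinearMap ∘ₗ V.diff from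
    LinearMap.congr_fun h a
  refine ULie.env_hom_ext fun w => ?_
  rw [LinearMap.comp_apply, LinearMap.comp_apply, AlgHom.toLinearMap_apply,
    AlgHom.toLinearMap_apply]
  induction w with
  | nil => rw [V.word_nil, map_one, V.diff_one, W.diff_one, map_zero]
  | cons x w ih =>
    have hp : x.1 - 1 + 1 = x.1 := by omega
    rw [V.word_cons, map_mul, ULie.envMap_gen, W.diff_gen_mul hp, V.diff_gen_mul hp, ih, map_add,
      map_sign_smul, map_mul, map_mul, ULie.envMap_gen, ULie.envMap_gen, hom_f_d]

lemma ULie.envMap_mem_grade {W : ULie K} (f : V ⟶ W) {n : ℤ} {a : V.Env} (ha : a ∈ V.grade n) :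
    ULie.envMap f a ∈ W.grade n := by
  refine V.grade_le (S := (W.grade n).comap (ULie.envMap f).toLinearMap) (fun w hw => ?_) ha
  rw [Submodule.mem_comap, AlgHom.toLinearMap_apply]
  clear ha a
  induction hw with
  | one => rw [map_one]; exact W.one_mem_grade
  | cons hn x _ ih =>
    rw [map_mul, ULie.envMap_gen]
    exact W.gen_mul_mem_grade hn _ ih

/-- Products of `m` elements of the form `x - P x` and an arbitrary number of elements of the form
`P x`. -/
inductive ULie.IsWeighted (P : V ⟶ V) : ℕ → V.Env → Prop
  | one : ULie.IsWeighted P 0 1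
  | fixed {m p} (x : V.cpx.X p) {a} (_ : ULie.IsWeighted P m a) :
      ULie.IsWeighted P m (V.gen p (P.hom.f p x) * a)
  | moved {m p} (x : V.cpx.X p) {a} (_ : ULie.IsWeighted P m a) :
      ULie.IsWeighted P (m + 1) (V.gen p (x - P.hom.f p x) * a)

/-- The span of the products of at most `m` elements of the form `x - P x` and an arbitrary number
of elements of the form `P x`. -/
def ULie.weightLE (P : V ⟶ V) (m : ℕ) : Submodule K V.Env :=
  Submodule.span K {a | ∃ k ≤ m, ULie.IsWeighted P k a}

lemma ULie.weightLE_mono (P : V ⟶ V) : Monotone (ULie.weightLE P) := fun _ _ hm =>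
  Submodule.span_mono fun _ ⟨k, hk, ha⟩ => ⟨k, hk.trans hm, ha⟩

lemma ULie.gen_mul_mem_weightLE (P : V ⟶ V) {m : ℕ} {p : ℤ} (x : V.cpx.X p) {a : V.Env}
    (ha : a ∈ ULie.weightLE P m) : V.gen p x * a ∈ ULie.weightLE P (m + 1) := by
  suffices h : ULie.weightLE P m ≤
      (ULie.weightLE P (m + 1)).comap (LinearMap.mulLeft K (V.gen p x)) from h ha
  refine Submodule.span_le.2 ?_
  rintro b ⟨k, hk, hb⟩
  change V.gen p x * b ∈ ULie.weightLE P (m + 1)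
  -- Splitting the letter into its fixed and moved parts raises the weight by at most one.
  have e : x = P.hom.f p x + (x - P.hom.f p x) := by abel
  rw [e, map_add, add_mul]
  exact add_mem (Submodule.subset_span ⟨k, by omega, .fixed x hb⟩)
    (Submodule.subset_span ⟨k + 1, by omega, .moved x hb⟩)

lemma ULie.exists_mem_weightLE (P : V ⟶ V) (a : V.Env) : ∃ m, a ∈ ULie.weightLE P m := by
  have ha : a ∈ Submodule.span K (Set.range V.word) := V.span_word ▸ Submodule.mem_top
  induction ha using Submodule.span_induction with
  | mem a ha =>
    obtain ⟨w, rfl⟩ := ha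
    induction w with
    | nil => exact ⟨0, Submodule.subset_span ⟨0, le_rfl, .one⟩⟩
    | cons x w ih =>
      obtain ⟨m, hm⟩ := ih
      exact ⟨m + 1, by rw [V.word_cons]; exact ULie.gen_mul_mem_weightLE P _ hm⟩
  | zero => exact ⟨0, zero_mem _⟩
  | add x y _ _ hx hy =>
    obtain ⟨m, hm⟩ := hx
    obtain ⟨n, hn⟩ := hy
    exact ⟨max m n, add_mem (ULie.weightLE_mono P (le_max_left _ _) hm)
      (ULie.weightLE_mono P (le_max_right _ _) hn)⟩
  | smul c x _ hx =>
    obtain ⟨m, hm⟩ := hx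
    exact ⟨m, Submodule.smul_mem _ _ hm⟩

variable [CharZero K] (hV : V.IsAbelian) {P : V ⟶ V} {h : ∀ i j, V.cpx.X i →ₗ[K] V.cpx.X j}
  (hu : h 0 1 V.unit = 0) (hP : ∀ n x, P.hom.f n (P.hom.f n x) = P.hom.f n x)
  (hh : ∀ i j k (_ : j + 1 = i) (_ : k + 1 = j) (x : V.cpx.X j),
    V.cpx.d i j (h j i x) + h k j (V.cpx.d j k x) = x - P.hom.f j x)

-- The operator `d h + h d` is a derivation which acts on letters as `1 - P`. Since `P` is
-- idempotent, it kills `P x` and fixes `x - P x`, so it counts the moved letters.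
include hP hh in
lemma ULie.laplace_isWeighted {m : ℕ} {a : V.Env} (ha : ULie.IsWeighted P m a) :
    V.diff (ULie.contr hV hu a) + ULie.contr hV hu (V.diff a) = (m : K) • a := by
  induction ha with
  | one => simp [ULie.contr_one, V.diff_one]
  | @fixed m p x a _ ih =>
    rw [ULie.diff_contr_gen_mul hV hu (sub_add_cancel p 1), hh _ _ _ rfl (sub_add_cancel p 1), hP,
      sub_self, map_zero, zero_mul, zero_add, ih, mul_smul_comm]
  | @moved m p x a _ ih =>
    rw [ULie.diff_contr_gen_mul hV hu (sub_add_cancel p 1), hh _ _ _ rfl (sub_add_cancel p 1),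
      map_sub (P.hom.f p).hom, hP, sub_self, sub_zero, ih, mul_smul_comm, Nat.cast_succ, add_smul,
      one_smul, add_comm]

-- In weight zero every letter has the form `P x`, and `P` is idempotent.
include hP in
lemma ULie.envMap_weightLE_zero {a : V.Env} (ha : a ∈ ULie.weightLE P 0) :
    ULie.envMap P a = a := by
  suffices h : ULie.weightLE P 0 ≤ LinearMap.eqLocus (ULie.envMap P).toLinearMap LinearMap.id from
    h ha
  refine Submodule.span_le.2 ?_
  rintro b ⟨k, hk, hb⟩
  obtain rfl : k = 0 := by omega
  clear hk ha
  generalize hm : 0 = m at hb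
  change ULie.envMap P b = b
  induction hb with
  | one => exact map_one _
  | fixed x _ ih => rw [map_mul, ULie.envMap_gen, hP, ih hm]
  | moved x _ ih => omega

include hV hu hP hh in
/-- An idempotent endomorphism of an abelian unital Lie algebra which is homotopic to the identity
induces the identity on the homology of the enveloping algebra. -/
lemma ULie.IsAbelian.exists_envMap_eq_add_diff {n : ℤ} {z : V.Env} (hz : z ∈ V.grade n)
    (hdz : V.diff z = 0) : ∃ w ∈ V.grade (n + 1), ULie.envMap P z = z + V.diff w := by
  obtain ⟨m, hm⟩ := ULie.exists_mem_weightLE P z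
  induction m generalizing z with
  | zero => exact ⟨0, zero_mem _, by rw [ULie.envMap_weightLE_zero hP hm, map_zero, add_zero]⟩
  | succ m ih =>
    have hm0 : ((m + 1 : ℕ) : K) ≠ 0 := Nat.cast_ne_zero.2 (Nat.succ_ne_zero m)
    -- On products of weight `m + 1`, the operator `d h + h d` is multiplication by `m + 1`. As `z`
    -- is a cycle, subtracting `d b` therefore removes its part of weight `m + 1`, and products of
    -- smaller weight are only rescaled.
    set b := ((m + 1 : ℕ) : K)⁻¹ • ULie.contr hV hu z with hb
    have hbg : b ∈ V.grade (n + 1) := Submodule.smul_mem _ _ (ULie.contr_mem_grade hV hu hz)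
    have h₁ : z - V.diff b ∈ ULie.weightLE P m := by
      have key : ULie.weightLE P (m + 1) ≤ (ULie.weightLE P m).comap
          (LinearMap.id - ((m + 1 : ℕ) : K)⁻¹ • (V.diff ∘ₗ ULie.contr hV hu +
            ULie.contr hV hu ∘ₗ V.diff)) := by
        refine Submodule.span_le.2 ?_
        rintro a ⟨k, hk, ha⟩
        have e := ULie.laplace_isWeighted hV hu hP hh ha
        change a - ((m + 1 : ℕ) : K)⁻¹ •
          (V.diff (ULie.contr hV hu a) + ULie.contr hV hu (V.diff a)) ∈ ULie.weightLE P m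
        rw [e]
        obtain rfl | hk' : k = m + 1 ∨ k ≤ m := by omega
        · rw [inv_smul_smul₀ hm0, sub_self]
          exact zero_mem _
        · have ha' : a ∈ ULie.weightLE P m := Submodule.subset_span ⟨k, hk', ha⟩
          exact sub_mem ha' (Submodule.smul_mem _ _ (Submodule.smul_mem _ _ ha'))
      have := key hm
      change z - ((m + 1 : ℕ) : K)⁻¹ •
        (V.diff (ULie.contr hV hu z) + ULie.contr hV hu (V.diff z)) ∈ ULie.weightLE P m at this
      rw [hdz, map_zero, add_zero, ← map_smul] at this
      exact this
    have h₂ : V.diff (z - V.diff b) = 0 := by rw [map_sub, hdz, V.diff_diff hbg, sub_zero]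
    obtain ⟨w, hw, e⟩ := ih (sub_mem hz (V.diff_mem_grade rfl hbg)) h₂ h₁
    -- From `P (z - d b) = z - d b + d w` it follows that `P z = z + d (w - b + P b)`.
    refine ⟨w - b + ULie.envMap P b, add_mem (sub_mem hw hbg) (ULie.envMap_mem_grade P hbg), ?_⟩
    rw [map_sub, ← ULie.diff_envMap] at e
    rw [map_add, map_sub, eq_add_of_sub_eq e]
    abel

end HomotopyInvariance

/-! ### Quasi-isomorphisms between abelian unital Lie algebras -/

section AbelianCase

variable {K : Type u} [Field K]

/-- `quasiIso_iff_elements` for the maps of enveloping algebras. -/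
lemma ULie.quasiIso_mapCpx_iff_elements {V W : ULie K} (f : V ⟶ W) :
    QuasiIso (ULie.mapCpx f) ↔ ∀ n : ℤ,
      (∀ z ∈ V.grade n, V.diff z = 0 → (∃ y ∈ W.grade (n + 1), W.diff y = ULie.envMap f z) →
        ∃ z' ∈ V.grade (n + 1), V.diff z' = z) ∧
      (∀ y ∈ W.grade n, W.diff y = 0 →
        ∃ z ∈ V.grade n, V.diff z = 0 ∧
          ∃ y' ∈ W.grade (n + 1), ULie.envMap f z + W.diff y' = y) := by
  have hd : ∀ (U : ULie K) (n : ℤ) (x : U.envCpx.X n),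
      U.envCpx.d n (n - 1) x = 0 ↔ U.diff (U.val n x) = 0 := fun U n x => by
    rw [← U.val_d (sub_add_cancel n 1)]
    exact (map_eq_zero_iff _ (U.val_injective _)).symm
  rw [quasiIso_iff_elements]
  refine forall_congr' fun n => and_congr ⟨fun h z hz hdz => ?_, fun h z hdz => ?_⟩
    ⟨fun h y hy hdy => ?_, fun h y hdy => ?_⟩
  · rintro ⟨y, hy, e⟩
    obtain ⟨z', hz'⟩ := h (V.toCpx z hz) ((hd V n _).2 hdz) ⟨W.toCpx y hy, W.val_injective n (by
      rw [W.val_d rfl, ULie.val_mapCpx, W.val_toCpx, e, V.val_toCpx])⟩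
    refine ⟨V.val _ z', V.val_mem z', ?_⟩
    rw [← V.val_d rfl, hz', V.val_toCpx]
  · rintro ⟨y, e⟩
    obtain ⟨z', hz', e'⟩ := h (V.val n z) (V.val_mem z) ((hd V n z).1 hdz)
      ⟨W.val _ y, W.val_mem y, by rw [← W.val_d rfl, e, ULie.val_mapCpx]⟩
    exact ⟨V.toCpx z' hz', V.val_injective n (by rw [V.val_d rfl, V.val_toCpx, e'])⟩
  · obtain ⟨z, hz, y', e⟩ := h (W.toCpx y hy) ((hd W n _).2 hdy)
    refine ⟨V.val n z, V.val_mem z, (hd V n z).1 hz, W.val _ y', W.val_mem y', ?_⟩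
    rw [← W.val_d rfl, ← ULie.val_mapCpx, ← map_add, e, W.val_toCpx]
  · obtain ⟨z, hz, hdz, y', hy', e⟩ := h (W.val n y) (W.val_mem y) ((hd W n y).1 hdy)
    refine ⟨V.toCpx z hz, (hd V n _).2 hdz, W.toCpx y' hy', W.val_injective n ?_⟩
    rw [map_add, W.val_d rfl, ULie.val_mapCpx, W.val_toCpx, V.val_toCpx, e]

/-- If the unit is a boundary, the enveloping algebra is acyclic. -/
lemma ULie.exists_diff_eq_of_unit {V : ULie K} {v : V.cpx.X 1} (hv : V.cpx.d 1 0 v = V.unit)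
    {n : ℤ} {z : V.Env} (hz : z ∈ V.grade n) (hdz : V.diff z = 0) :
    ∃ z' ∈ V.grade (n + 1), V.diff z' = z := by
  -- `v` has degree one, its differential becomes `1` in the algebra, and `z` is a cycle, so `d (v
  -- z) = z`.
  refine ⟨V.gen 1 v * z, V.gen_mul_mem_grade (by omega) v hz, ?_⟩
  rw [V.diff_gen_mul (zero_add 1), hv, hdz, V.gen_unit, one_mul, mul_zero, smul_zero, add_zero]

lemma ULie.envMap_comp {U V W : ULie K} (f : U ⟶ V) (g : V ⟶ W) (a : U.Env) :
    ULie.envMap g (ULie.envMap f a) = ULie.envMap (f ≫ g) a := by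
  suffices h : (ULie.envMap g).toLinearMap ∘ₗ (ULie.envMap f).toLinearMap =
      (ULie.envMap (f ≫ g)).toLinearMap from LinearMap.congr_fun h a
  refine ULie.env_hom_ext fun w => ?_
  change ULie.envMap g (ULie.envMap f (V := U) (U.word w)) = ULie.envMap (f ≫ g) (U.word w)
  rw [ULie.envMap_word, ULie.envMap_word, ULie.envMap_word, List.map_map]
  rfl

/-- A family of linear maps between abelian unital Lie algebras which kills boundaries and takes
values in cycles is a morphism if it preserves the unit. -/
def ULie.IsAbelian.homMk {V W : ULie K} (hV : V.IsAbelian) (hW : W.IsAbelian)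
    (g : ∀ n, V.cpx.X n →ₗ[K] W.cpx.X n)
    (h₁ : ∀ i j (_ : j + 1 = i) (x : V.cpx.X i), g j (V.cpx.d i j x) = 0)
    (h₂ : ∀ i j (_ : j + 1 = i) (x : V.cpx.X i), W.cpx.d i j (g i x) = 0)
    (hu : g 0 V.unit = W.unit) : V ⟶ W :=
  ULie.Hom.mk (V := V) (W := W)
    { f := fun n => ModuleCat.ofHom (g n)
      comm' := fun i j hij => ModuleCat.hom_ext (LinearMap.ext fun x =>
        (h₂ i j hij x).trans (h₁ i j hij x).symm) }
    (fun h x y => by rw [hV, hW, map_zero]) hu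

variable [CharZero K]

/-- The unital universal enveloping algebra functor preserves quasi-isomorphisms between abelian
unital Lie algebras. -/
lemma ULie.IsAbelian.quasiIso_mapCpx {V W : ULie K} (hV : V.IsAbelian) (hW : W.IsAbelian)
    (f : V ⟶ W) (hf : QuasiIso f.hom) : QuasiIso (ULie.mapCpx f) := by
  rw [quasiIso_iff_elements] at hf
  rw [ULie.quasiIso_mapCpx_iff_elements]
  by_cases hv : ∃ v, V.cpx.d 1 0 v = V.unit
  · obtain ⟨v, hv⟩ := hv
    have hw : W.cpx.d 1 0 (f.hom.f 1 v) = W.unit := by rw [← hom_f_d, hv, f.map_unit]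
    refine fun n => ⟨fun z hz hdz _ => ULie.exists_diff_eq_of_unit hv hz hdz, fun y hy hdy => ?_⟩
    obtain ⟨y', hy', e⟩ := ULie.exists_diff_eq_of_unit hw hy hdy
    exact ⟨0, zero_mem _, map_zero _, y', hy', by rw [map_zero, zero_add, e]⟩
  obtain ⟨X, hX, huX⟩ := exists_isHomologySplitting V.d_unit fun y hy => hv ⟨y, hy⟩
  have hX₁ : ∀ i j (_ : j + 1 = i) (x : V.cpx.X i), x ∈ X i → V.cpx.d i j x = 0 := by
    intro i j hij x hx
    obtain rfl : j = i - 1 := by omega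
    exact hX.1 i x hx
  -- Since `f` is a quasi-isomorphism, the images of the representatives in `V` represent the
  -- homology of `W`.
  have hY : IsHomologySplitting W.cpx fun n => (X n).map (f.hom.f n).hom := by
    refine ⟨?_, ?_, ?_⟩
    · rintro n _ ⟨x, hx, rfl⟩
      change W.cpx.d n (n - 1) (f.hom.f n x) = 0
      rw [← hom_f_d, hX.1 n x hx]
      exact map_zero _
    · rintro n _ ⟨x, hx, rfl⟩ y hy
      obtain ⟨x', hx'⟩ := (hf n).1 x (hX.1 n x hx) ⟨y, hy⟩
      rw [hX.2.1 n x hx x' hx', map_zero]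
    · intro n y hy
      obtain ⟨x, hx, y', rfl⟩ := (hf n).2 y hy
      obtain ⟨x', hx', x'', rfl⟩ := hX.2.2 n x hx
      refine ⟨_, ⟨x', hx', rfl⟩, f.hom.f (n + 1) x'' + y', ?_⟩
      rw [map_add, map_add, ← hom_f_d, add_assoc]
  have hinj : ∀ n, ∀ x ∈ X n, f.hom.f n x = 0 → x = 0 := fun n x hx h0 => by
    obtain ⟨x', hx'⟩ := (hf n).1 x (hX.1 n x hx) ⟨0, by rw [map_zero, h0]⟩
    exact hX.2.1 n x hx x' hx'
  -- `f` is injective on representatives, so it has a left inverse there.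
  have hr : ∀ n, ∃ r : W.cpx.X n →ₗ[K] X n, ∀ x : X n, r (f.hom.f n x) = x := fun n => by
    obtain ⟨r, hr⟩ := LinearMap.exists_leftInverse_of_injective
      ((f.hom.f n).hom.comp (X n).subtype) (LinearMap.ker_eq_bot'.2 fun x hx =>
        Subtype.ext (hinj n x.1 x.2 hx))
    exact ⟨r, fun x => LinearMap.congr_fun hr x⟩
  choose r hr using hr
  obtain ⟨P, h, hP₁, hP₂, hP₃, hP₄, hP₅⟩ := hX.exists_contraction
  obtain ⟨Q, k, hQ₁, hQ₂, hQ₃, hQ₄, hQ₅⟩ := hY.exists_contraction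
  have huY : W.unit ∈ (X 0).map (f.hom.f 0).hom := ⟨V.unit, huX, f.map_unit⟩
  let p : V ⟶ V := hV.homMk hV P hP₃ (fun i j hij x => hX₁ i j hij _ (hP₂ i x)) (hP₁ 0 _ huX)
  let q : W ⟶ W := hW.homMk hW Q hQ₃ (fun i j hij x => by
    obtain rfl : j = i - 1 := by omega
    exact hY.1 i _ (hQ₂ i x)) (hQ₁ 0 _ huY)
  -- `g` projects onto the representatives in `W` and then inverts `f` on them. It need not invert
  -- `f` itself, only after the projections `q` and `p`.
  let g : W ⟶ V := hW.homMk hV (fun n => (X n).subtype.comp ((r n).comp (Q n)))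
    (fun i j hij y => by
      change (r j (Q j (W.cpx.d i j y))).1 = 0
      rw [hQ₃ i j hij y, map_zero]
      rfl)
    (fun i j hij y => hX₁ i j hij _ (r i (Q i y)).2) (by
      change (r 0 (Q 0 W.unit)).1 = V.unit
      rw [hQ₁ 0 _ huY, ← f.map_unit]
      exact congrArg Subtype.val (hr 0 ⟨V.unit, huX⟩))
  have hgf : g ≫ f = q := by
    refine ULie.Hom.ext (HomologicalComplex.hom_ext _ _ fun n =>
      ModuleCat.hom_ext (LinearMap.ext fun y => ?_))
    change f.hom.f n (r n (Q n y)).1 = Q n y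
    obtain ⟨x, hx, e⟩ := hQ₂ n y
    rw [← e]
    exact congrArg (fun t : X n => f.hom.f n t.1) (hr n ⟨x, hx⟩)
  have hpfg : p ≫ f ≫ g = p := by
    refine ULie.Hom.ext (HomologicalComplex.hom_ext _ _ fun n =>
      ModuleCat.hom_ext (LinearMap.ext fun x => ?_))
    change (r n (Q n (f.hom.f n (P n x)))).1 = P n x
    rw [hQ₁ n _ ⟨P n x, hP₂ n x, rfl⟩]
    exact congrArg Subtype.val (hr n ⟨P n x, hP₂ n x⟩)
  have hp : ∀ {n : ℤ} {z : V.Env}, z ∈ V.grade n → V.diff z = 0 →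
      ∃ w ∈ V.grade (n + 1), ULie.envMap p z = z + V.diff w := fun hz hdz =>
    hV.exists_envMap_eq_add_diff (hP₄ 0 1 _ huX) (fun n x => hP₁ n _ (hP₂ n x)) hP₅ hz hdz
  have hq : ∀ {n : ℤ} {z : W.Env}, z ∈ W.grade n → W.diff z = 0 →
      ∃ w ∈ W.grade (n + 1), ULie.envMap q z = z + W.diff w := fun hz hdz =>
    hW.exists_envMap_eq_add_diff (hQ₄ 0 1 _ huY) (fun n x => hQ₁ n _ (hQ₂ n x)) hQ₅ hz hdz
  refine fun n => ⟨?_, fun y hy hdy => ?_⟩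
  · rintro z hz hdz ⟨y, hy, e⟩
    obtain ⟨w, hw, ew⟩ := hp hz hdz
    -- With `p z = z + d w` and `f z = d y`, one gets `p z = g f p z = g (d y + d f w)`.
    have h₁ : ULie.envMap p z = V.diff (ULie.envMap g (y + ULie.envMap f w)) := by
      rw [ULie.diff_envMap, map_add, e, ULie.diff_envMap, ← map_add, ← ew, ULie.envMap_comp f,
        ULie.envMap_comp, hpfg]
    refine ⟨ULie.envMap g (y + ULie.envMap f w) - w, sub_mem (ULie.envMap_mem_grade _
      (add_mem hy (ULie.envMap_mem_grade _ hw))) hw, ?_⟩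
    rw [map_sub, ← h₁, ew, add_sub_cancel_right]
  · obtain ⟨w, hw, ew⟩ := hq hy hdy
    -- `g y` is the required cycle: `f g y = q y`, which differs from `y` by the boundary `d w`.
    refine ⟨ULie.envMap g y, ULie.envMap_mem_grade g hy, by
      rw [ULie.diff_envMap, hdy, map_zero], -w, neg_mem hw, ?_⟩
    rw [ULie.envMap_comp, hgf, ew, map_neg, add_neg_cancel_right]

end AbelianCase

/-- The unital universal enveloping algebra functor preserves quasi-isomorphisms. -/
theorem quasiIso_phiShriek_map {K : Type u} [Field K] [CharZero K] {V W : ULie K} (f : V ⟶ W)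
    (hf : QuasiIso f.hom) : QuasiIso ((phiShriek K).map f).hom :=
  (quasiIso_mapCpx_iff f).2
    (ULie.IsAbelian.quasiIso_mapCpx (V := V.ab) (W := W.ab) (fun _ _ _ => rfl) (fun _ _ _ => rfl)
      (ULie.abMap f) hf)

end LinearQuantization

end

/-- Linear quantization maps homotopy `W`-constant `Ch(K)`-valued linear field theories to homotopy
`W`-constant quantum field theories. -/
theorem proposition6p8 {K : Type u} [Field K] [CharZero K]
    {C : Type v} [Category.{w} C] (O : LinearQuantization.Orthogonality C)
    (W : MorphismProperty C) (B : LinearQuantization.LFT K O)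
    (hB : B.HomotopyConstant W) :
    ((LinearQuantization.Qlin K O).obj B).HomotopyConstant W :=
  fun _ _ f hf => LinearQuantization.quasiIso_phiShriek_map (B.obj.map f) (hB f hf)
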